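/- Let $\mathbb K$ be a field of characteristic $0$. Operads are (reduced, $\mathbb K$-linear) shuffle operads: they have components $P(k)$ for $k\ge 1$, and an indexed set is a family of sets indexed by the arities $k\geq 1$. A shuffle $\omega$-operad is a strict $\omega$-category internal to the category of shuffle operads. A shuffle $\omega$-polygraph $X$ consists of indexed sets $X_n$ of $n$-generators ($n\ge 0$) such that $X_{n+1}$ is a cellular extension of the free shuffle $n$-operad $X^{\sqcup}_n$ generated by $X_0,\dots,X_n$: every $x\in X_{n+1}(k)$ has a source $s_n(x)$ and a target $t_n(x)$ in $X^{\sqcup}_n(k)$, with $s_{n-1}s_n(x)=s_{n-1}t_n(x)$ and $t_{n-1}s_n(x)=t_{n-1}t_n(x)$ if $n\geq 1$. It is acyclic if for all $n\ge 1$ and all parallel $n$-cells $f,g$ of the free shuffle $\omega$-operad $X^\sqcup$ there is an $(n+1)$-cell of $X^\sqcup$ with source $f$ and target $g$. It is graded if every generator has a degree (weight) in $\mathbb N$ such that the source and the target of every generator are homogeneous, of the degree of that generator, for the induced grading of the cells. The operad presented by $X$ is the coequalizer $P$ of $s_0,t_0: X^\sqcup_1\rightrightarrows X^\sqcup_0$;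 write $u\mapsto\overline u$ for the projection $X_0^\sqcup\to P$. Let $X_{-1}=\mathbf 1$ be the indexed set with a single element $\varepsilon$, of arity $1$. For $n\ge -1$, let $P\langle X\rangle_n=P\langle X_n\rangle$ be the free $P$-bimodule on $X_n$, with generators $[x]$, $x\in X_n$, where $[\varepsilon]$ is also written $\varepsilon$. Let $[\;]:X_0^\sqcup\to P\langle X_0\rangle$ be the derivation along $u\mapsto\overline u$ with $x\mapsto[x]$ for $x\in X_0$. For $n\ge1$, every $n$-cell of $X^\sqcup$ is of the form $f=\sum_i\lambda_i\Gamma_i[\alpha_i]+1_c$ with $\lambda_i\in\mathbb K$, $\alpha_i\in X_n$, $\Gamma_i$ one-hole contexts of $0$-cells, and $1_c$ the identity of an $(n-1)$-cell $c$; set $[f]=\sum_i\lambda_i\overline\Gamma_i\big[[\alpha_i]\big]$, where $\overline\Gamma_i$ is the context of $P$ induced by $\Gamma_i$. Let $\delta_n:P\langle X\rangle_{n+1}\to P\langle X\rangle_n$ be the morphisms of $P$-bimodules with $$\delta_{-1}[x]=(\varepsilon\mid\overline x)-\sum_{i=1}^k\overline x\circ_i\varepsilon\quad(x\in X_0(k)),\qquad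 \delta_n[A]=[s_n(A)]-[t_n(A)]\quad(A\in X_{n+1},\ n\ge0).$$ The trivial $P$-bimodule $\Omega_P$ is the quotient of $P\langle\mathbf 1\rangle$ by the sub-bimodule generated by the elements $(\varepsilon\mid u)-\sum_{i=1}^k u\circ_i\varepsilon$ with $k\ge 1$, $u\in P(k)$. **Proposition.** Let $X$ be an acyclic graded shuffle $\omega$-polygraph, and let $w:\mathbb N\to\mathbb N\setminus\{0\}$ be a strictly increasing function such that, for every $n\geq 0$, all $n$-generators of $X$ have degree $w(n)$. Then $P\langle X\rangle$ is a minimal resolution of $\Omega_P$ by free $P$-bimodules. That is: each $P\langle X\rangle_n$ is a free $P$-bimodule; the sequence $$\cdots\to P\langle X_1\rangle\xrightarrow{\delta_0}P\langle X_0\rangle\xrightarrow{\delta_{-1}}P\langle\mathbf 1\rangle\to\Omega_P\to0$$ is exact; and, if $P_+\subseteq P$ denotes the part of positive degree, every $\delta_n$ induces the zero map $P\langle X\rangle_{n+1}\otimes_P\mathbb K\to P\langle X\rangle_n\otimes_P\mathbb K$, where $A\otimes_P\mathbb K$ is the quotient of a $P$-bimodule $A$ by the span of all composites $p\circ a$ and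 $a\circ p$ with $a\in A$ and $p\in P_+$. -/

import Mathlib

universe u

namespace ShuffleOp

/-! ### Elementary shuffle compositions

Arities are positive integers, and the inputs of an element of arity `k` are numbered by `Fin k`. -/

/-- The data `(i, τ)` of an elementary shuffle composition `x ∘_{i,τ} y` of an element `x` of arity
`k` with an element `y` of arity `l`, the result having arity `n`: the root of `y` is attached to
the input `pos` of `x`; in the composite, the inputs of `y` are the `leaf b`, and the inputs of `x`
other than `pos` are the `root a`, in increasing order. The block of inputs of `y` is ordered among
the inputs of `x` by its least element, which is recorded as `root pos`. -/
structure Shuf (k l n : ℕ+) where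
  pos : Fin k
  root : Fin k ↪o Fin n
  leaf : Fin l ↪o Fin n
  base : leaf ⟨0, l.pos⟩ = root pos
  inter : ∀ a b, root a = leaf b → a = pos
  cover : ∀ c, (∃ a, root a = c) ∨ ∃ b, leaf b = c

namespace Shuf

/-- The two bracketings `(x ∘_E y) ∘_F z` and `x ∘_{E'} (y ∘_{F'} z)` describe the same tree, in
which `z` is attached to an input of `y` and `y` to an input of `x`. -/
structure Nested {k l m n q N : ℕ+} (E : Shuf k l n) (F : Shuf n m N)
    (F' : Shuf l m q) (E' : Shuf k q N) : Prop where
  pos_F : F.pos = E.leaf F'.pos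
  pos_E : E'.pos = E.pos
  root_root : ∀ a, F.root (E.root a) = E'.root a
  root_leaf : ∀ b, F.root (E.leaf b) = E'.leaf (F'.root b)
  leaf_leaf : ∀ c, F.leaf c = E'.leaf (F'.leaf c)

/-- The two composites `(x ∘_E y) ∘_F z` and `(x ∘_G z) ∘_H y` describe the same tree, in
which `y` and `z` are attached to distinct inputs of `x`. -/
structure Parallel {k l m n n' N : ℕ+} (E : Shuf k l n) (F : Shuf n m N)
    (G : Shuf k m n') (H : Shuf n' l N) : Prop where
  ne : E.pos ≠ G.pos
  pos_F : F.pos = E.root G.pos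
  pos_H : H.pos = G.root E.pos
  root_root : ∀ a, F.root (E.root a) = H.root (G.root a)
  root_leaf : ∀ b, F.root (E.leaf b) = H.leaf b
  leaf_root : ∀ c, F.leaf c = H.root (G.leaf c)

theorem Parallel.symm {k l m n n' N : ℕ+} {E : Shuf k l n} {F : Shuf n m N}
    {G : Shuf k m n'} {H : Shuf n' l N} (h : Parallel E F G H) : Parallel G H E F :=
  ⟨h.ne.symm, h.pos_H, h.pos_F, fun a => (h.root_root a).symm, fun c => (h.leaf_root c).symm,
    fun b => (h.root_leaf b).symm⟩

instance : Subsingleton (Fin ((1 : ℕ+) : ℕ)) := by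
  rw [PNat.one_coe]; infer_instance

/-- The order embedding of a one-point order onto `x`. -/
def point {n : ℕ+} (x : Fin n) : Fin ((1 : ℕ+) : ℕ) ↪o Fin n :=
  OrderEmbedding.ofStrictMono (fun _ => x) (fun a b h => by
    rw [Subsingleton.elim a b] at h; exact absurd h (lt_irrefl _))

/-- Attaching an element of arity `k` to the unique input of an element of arity `1`. -/
def underRoot (k : ℕ+) : Shuf 1 k k where
  pos := ⟨0, PNat.pos 1⟩
  root := point ⟨0, k.pos⟩
  leaf := RelEmbedding.refl _
  base := rfl
  inter := fun _ _ _ => Subsingleton.elim _ _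
  cover := fun c => Or.inr ⟨c, rfl⟩

/-- Attaching an element of arity `1` to the input `i` of an element of arity `k`. -/
def onLeaf (k : ℕ+) (i : Fin k) : Shuf k 1 k where
  pos := i
  root := RelEmbedding.refl _
  leaf := point i
  base := rfl
  inter := fun _ _ h => h
  cover := fun c => Or.inl ⟨c, rfl⟩

end Shuf

/-! ### Shuffle operads -/

/-- Shuffle operads over `K`, described by their elementary shuffle compositions. -/
structure ShuffleOperad (K : Type u) [Field K] where
  carrier : ℕ+ → Type u
  [grp : ∀ k, AddCommGroup (carrier k)]
  [mod : ∀ k, Module K (carrier k)]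
  one : carrier 1
  comp : ∀ {k l n : ℕ+}, Shuf k l n → carrier k →ₗ[K] carrier l →ₗ[K] carrier n
  comp_one : ∀ {k : ℕ+} (E : Shuf k 1 k) (x : carrier k), comp E x one = x
  one_comp : ∀ {k : ℕ+} (E : Shuf 1 k k) (x : carrier k), comp E one x = x
  nested : ∀ {k l m n q N : ℕ+} {E : Shuf k l n} {F : Shuf n m N} {F' : Shuf l m q}
    {E' : Shuf k q N}, Shuf.Nested E F F' E' → ∀ (x : carrier k) (y : carrier l) (z : carrier m),
    comp F (comp E x y) z = comp E' x (comp F' y z)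
  parallel : ∀ {k l m n n' N : ℕ+} {E : Shuf k l n} {F : Shuf n m N} {G : Shuf k m n'}
    {H : Shuf n' l N}, Shuf.Parallel E F G H → ∀ (x : carrier k) (y : carrier l) (z : carrier m),
    comp F (comp E x y) z = comp H (comp G x z) y

attribute [instance] ShuffleOperad.grp ShuffleOperad.mod

variable {K : Type u} [Field K]

/-- Morphisms of shuffle operads. -/
structure ShuffleOperad.Hom (P Q : ShuffleOperad K) where
  map : ∀ k, P.carrier k →ₗ[K] Q.carrier k
  map_one : map 1 P.one = Q.one
  map_comp : ∀ {k l n : ℕ+} (E : Shuf k l n) (x : P.carrier k) (y : P.carrier l),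
    map n (P.comp E x y) = Q.comp E (map k x) (map l y)

namespace ShuffleOperad

variable (P : ShuffleOperad K)

/-- Membership in the ideal of `P` generated by `S`. -/
inductive IdealMem (S : ∀ k, Set (P.carrier k)) : ∀ {k : ℕ+}, P.carrier k → Prop
  | of {k : ℕ+} {x : P.carrier k} (h : x ∈ S k) : IdealMem S x
  | zero {k : ℕ+} : IdealMem S (0 : P.carrier k)
  | add {k : ℕ+} {x y : P.carrier k} (hx : IdealMem S x) (hy : IdealMem S y) : IdealMem S (x + y)
  | smul {k : ℕ+} (r : K) {x : P.carrier k} (hx : IdealMem S x) : IdealMem S (r • x)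
  | left {k l n : ℕ+} (E : Shuf k l n) (x : P.carrier k) {y : P.carrier l} (hy : IdealMem S y) :
      IdealMem S (P.comp E x y)
  | right {k l n : ℕ+} (E : Shuf k l n) {x : P.carrier k} (y : P.carrier l) (hx : IdealMem S x) :
      IdealMem S (P.comp E x y)

/-- The ideal of `P` generated by `S`. -/
def ideal (S : ∀ k, Set (P.carrier k)) (k : ℕ+) : Submodule K (P.carrier k) where
  carrier := {x | P.IdealMem S x}
  add_mem' := fun hx hy => IdealMem.add hx hy
  zero_mem' := IdealMem.zero
  smul_mem' := fun r _ hx => IdealMem.smul r hx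

/-- The quotient of `P` by the ideal generated by `S`. -/
def quotient (S : ∀ k, Set (P.carrier k)) : ShuffleOperad K where
  carrier k := P.carrier k ⧸ P.ideal S k
  one := Submodule.Quotient.mk P.one
  comp {k l n} E := (P.ideal S k).liftQ
    { toFun := fun x => (P.ideal S l).mapQ (P.ideal S n) (P.comp E x)
        (fun _ hy => IdealMem.left E x hy)
      map_add' := fun x x' => by
        ext y; simp; rfl
      map_smul' := fun r x => by
        ext y; simp; rfl }
    (fun x hx => by
      ext y
      exact (Submodule.Quotient.mk_eq_zero (P.ideal S n)).2 (IdealMem.right E y hx))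
  comp_one E x := by
    induction x using Submodule.Quotient.induction_on with
    | H x => exact congrArg Submodule.Quotient.mk (P.comp_one E x)
  one_comp E x := by
    induction x using Submodule.Quotient.induction_on with
    | H x => exact congrArg Submodule.Quotient.mk (P.one_comp E x)
  nested h x y z := by
    induction x using Submodule.Quotient.induction_on with
    | H x =>
      induction y using Submodule.Quotient.induction_on with
      | H y =>
        induction z using Submodule.Quotient.induction_on with
        | H z => exact congrArg Submodule.Quotient.mk (P.nested h x y z)
  parallel h x y z := by
    induction x using Submodule.Quotient.induction_on with
    | H x =>
      induction y using Submodule.Quotient.induction_on with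
      | H y =>
        induction z using Submodule.Quotient.induction_on with
        | H z => exact congrArg Submodule.Quotient.mk (P.parallel h x y z)

/-- The projection of an operad onto a quotient. -/
def quotientMap (S : ∀ k, Set (P.carrier k)) : Hom P (P.quotient S) where
  map k := (P.ideal S k).mkQ
  map_one := rfl
  map_comp _ _ _ := rfl

/-- The relations `f x = g x`. -/
def eqRel {Q P : ShuffleOperad K} (f g : Hom Q P) (k : ℕ+) : Set (P.carrier k) :=
  {y | ∃ x, y = f.map k x - g.map k x}

/-- The coequalizer of two morphisms of shuffle operads. -/
def coequalizer {Q P : ShuffleOperad K} (f g : Hom Q P) : ShuffleOperad K := P.quotient (eqRel f g)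

/-- The projection onto the coequalizer. -/
def coequalizerMap {Q P : ShuffleOperad K} (f g : Hom Q P) : Hom P (coequalizer f g) :=
  P.quotientMap (eqRel f g)

theorem coequalizer_condition {Q P : ShuffleOperad K} (f g : Hom Q P) (k : ℕ+) (x : Q.carrier k) :
    (coequalizerMap f g).map k (f.map k x) = (coequalizerMap f g).map k (g.map k x) :=
  (Submodule.Quotient.eq _).2 (IdealMem.of ⟨x, rfl⟩)

end ShuffleOperad

/-! ### Bimodules over a shuffle operad -/

/-- Bimodules over a shuffle operad `P`: `lact E x a` is `x ∘ a` and `ract E a y` is `a ∘ y`. -/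
structure Bimodule (P : ShuffleOperad K) where
  carrier : ℕ+ → Type u
  [grp : ∀ k, AddCommGroup (carrier k)]
  [mod : ∀ k, Module K (carrier k)]
  lact : ∀ {k l n : ℕ+}, Shuf k l n → P.carrier k →ₗ[K] carrier l →ₗ[K] carrier n
  ract : ∀ {k l n : ℕ+}, Shuf k l n → carrier k →ₗ[K] P.carrier l →ₗ[K] carrier n
  one_lact : ∀ {k : ℕ+} (E : Shuf 1 k k) (a : carrier k), lact E P.one a = a
  ract_one : ∀ {k : ℕ+} (E : Shuf k 1 k) (a : carrier k), ract E a P.one = a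
  nested_left : ∀ {k l m n q N : ℕ+} {E : Shuf k l n} {F : Shuf n m N} {F' : Shuf l m q}
    {E' : Shuf k q N}, Shuf.Nested E F F' E' →
    ∀ (x : P.carrier k) (y : P.carrier l) (a : carrier m),
    lact F (P.comp E x y) a = lact E' x (lact F' y a)
  nested_mid : ∀ {k l m n q N : ℕ+} {E : Shuf k l n} {F : Shuf n m N} {F' : Shuf l m q}
    {E' : Shuf k q N}, Shuf.Nested E F F' E' →
    ∀ (x : P.carrier k) (a : carrier l) (z : P.carrier m),
    ract F (lact E x a) z = lact E' x (ract F' a z)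
  nested_right : ∀ {k l m n q N : ℕ+} {E : Shuf k l n} {F : Shuf n m N} {F' : Shuf l m q}
    {E' : Shuf k q N}, Shuf.Nested E F F' E' →
    ∀ (a : carrier k) (y : P.carrier l) (z : P.carrier m),
    ract F (ract E a y) z = ract E' a (P.comp F' y z)
  parallel_root : ∀ {k l m n n' N : ℕ+} {E : Shuf k l n} {F : Shuf n m N} {G : Shuf k m n'}
    {H : Shuf n' l N}, Shuf.Parallel E F G H →
    ∀ (a : carrier k) (y : P.carrier l) (z : P.carrier m),
    ract F (ract E a y) z = ract H (ract G a z) y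
  parallel_leaf : ∀ {k l m n n' N : ℕ+} {E : Shuf k l n} {F : Shuf n m N} {G : Shuf k m n'}
    {H : Shuf n' l N}, Shuf.Parallel E F G H →
    ∀ (x : P.carrier k) (a : carrier l) (z : P.carrier m),
    ract F (lact E x a) z = lact H (P.comp G x z) a

attribute [instance] Bimodule.grp Bimodule.mod

/-- Morphisms of bimodules. -/
structure Bimodule.Hom {P : ShuffleOperad K} (A B : Bimodule P) where
  map : ∀ k, A.carrier k →ₗ[K] B.carrier k
  map_lact : ∀ {k l n : ℕ+} (E : Shuf k l n) (x : P.carrier k) (a : A.carrier l),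
    map n (A.lact E x a) = B.lact E x (map l a)
  map_ract : ∀ {k l n : ℕ+} (E : Shuf k l n) (a : A.carrier k) (y : P.carrier l),
    map n (A.ract E a y) = B.ract E (map k a) y

namespace Bimodule

variable {P : ShuffleOperad K} (A : Bimodule P)

/-- Membership in the sub-bimodule of `A` generated by `S`. -/
inductive SubMem (S : ∀ k, Set (A.carrier k)) : ∀ {k : ℕ+}, A.carrier k → Prop
  | of {k : ℕ+} {a : A.carrier k} (h : a ∈ S k) : SubMem S a
  | zero {k : ℕ+} : SubMem S (0 : A.carrier k)
  | add {k : ℕ+} {a b : A.carrier k} (ha : SubMem S a) (hb : SubMem S b) : SubMem S (a + b)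
  | smul {k : ℕ+} (r : K) {a : A.carrier k} (ha : SubMem S a) : SubMem S (r • a)
  | lact {k l n : ℕ+} (E : Shuf k l n) (x : P.carrier k) {a : A.carrier l} (ha : SubMem S a) :
      SubMem S (A.lact E x a)
  | ract {k l n : ℕ+} (E : Shuf k l n) {a : A.carrier k} (y : P.carrier l) (ha : SubMem S a) :
      SubMem S (A.ract E a y)

/-- The sub-bimodule of `A` generated by `S`. -/
def sub (S : ∀ k, Set (A.carrier k)) (k : ℕ+) : Submodule K (A.carrier k) where
  carrier := {a | A.SubMem S a}
  add_mem' := fun ha hb => SubMem.add ha hb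
  zero_mem' := SubMem.zero
  smul_mem' := fun r _ ha => SubMem.smul r ha

/-- The quotient of `A` by the sub-bimodule generated by `S`. -/
def quotient (S : ∀ k, Set (A.carrier k)) : Bimodule P where
  carrier k := A.carrier k ⧸ A.sub S k
  lact {k l n} E :=
    { toFun := fun x => (A.sub S l).mapQ (A.sub S n) (A.lact E x)
        (fun _ ha => SubMem.lact E x ha)
      map_add' := fun x x' => by
        ext a; simp; rfl
      map_smul' := fun r x => by
        ext a; simp; rfl }
  ract {k l n} E := (A.sub S k).liftQ
    { toFun := fun a => (A.sub S n).mkQ ∘ₗ A.ract E a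
      map_add' := fun a a' => by
        ext y; simp
      map_smul' := fun r a => by
        ext y; simp }
    (fun a ha => by
      ext y
      simpa using (Submodule.Quotient.mk_eq_zero (A.sub S n)).2 (SubMem.ract E y ha))
  one_lact E a := by
    induction a using Submodule.Quotient.induction_on with
    | H a => exact congrArg Submodule.Quotient.mk (A.one_lact E a)
  ract_one E a := by
    induction a using Submodule.Quotient.induction_on with
    | H a => exact congrArg Submodule.Quotient.mk (A.ract_one E a)
  nested_left h x y a := by
    induction a using Submodule.Quotient.induction_on with
    | H a => exact congrArg Submodule.Quotient.mk (A.nested_left h x y a)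
  nested_mid h x a z := by
    induction a using Submodule.Quotient.induction_on with
    | H a => exact congrArg Submodule.Quotient.mk (A.nested_mid h x a z)
  nested_right h a y z := by
    induction a using Submodule.Quotient.induction_on with
    | H a => exact congrArg Submodule.Quotient.mk (A.nested_right h a y z)
  parallel_root h a y z := by
    induction a using Submodule.Quotient.induction_on with
    | H a => exact congrArg Submodule.Quotient.mk (A.parallel_root h a y z)
  parallel_leaf h x a z := by
    induction a using Submodule.Quotient.induction_on with
    | H a => exact congrArg Submodule.Quotient.mk (A.parallel_leaf h x a z)

/-- The projection of a bimodule onto a quotient. -/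
def quotientMap (S : ∀ k, Set (A.carrier k)) : Hom A (A.quotient S) where
  map k := (A.sub S k).mkQ
  map_lact _ _ _ := rfl
  map_ract _ _ _ := rfl

end Bimodule

/-! ### Vector spaces of formal expressions -/

/-- A congruence on a type of formal expressions for which the vector space axioms hold. -/
structure LinearCongruence (K : Type u) [Field K] (T : Type u) where
  zero : T
  add : T → T → T
  smul : K → T → T
  rel : T → T → Prop
  refl : ∀ a, rel a a
  symm : ∀ {a b}, rel a b → rel b a
  trans : ∀ {a b c}, rel a b → rel b c → rel a c
  add_congr : ∀ {a a' b b'}, rel a a' → rel b b' → rel (add a b) (add a' b')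
  smul_congr : ∀ (r : K) {a a'}, rel a a' → rel (smul r a) (smul r a')
  add_assoc : ∀ a b c, rel (add (add a b) c) (add a (add b c))
  add_comm : ∀ a b, rel (add a b) (add b a)
  zero_add : ∀ a, rel (add zero a) a
  one_smul : ∀ a, rel (smul 1 a) a
  mul_smul : ∀ r s a, rel (smul (r * s) a) (smul r (smul s a))
  smul_add : ∀ r a b, rel (smul r (add a b)) (add (smul r a) (smul r b))
  add_smul : ∀ r s a, rel (smul (r + s) a) (add (smul r a) (smul s a))
  zero_smul : ∀ a, rel (smul 0 a) zero

namespace LinearCongruence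

variable {T T₁ T₂ T₃ : Type u}

/-- The vector space of expressions modulo the congruence. -/
def Space (L : LinearCongruence K T) : Type u := Quot L.rel

/-- The class of an expression. -/
def cls (L : LinearCongruence K T) (a : T) : L.Space := Quot.mk _ a

theorem cls_surjective (L : LinearCongruence K T) (x : L.Space) : ∃ a, L.cls a = x :=
  Quot.exists_rep x

theorem sound (L : LinearCongruence K T) {a b : T} (h : L.rel a b) : L.cls a = L.cls b :=
  Quot.sound h

theorem exact (L : LinearCongruence K T) {a b : T} (h : L.cls a = L.cls b) : L.rel a b := by
  have e : Equivalence L.rel := ⟨L.refl, L.symm, L.trans⟩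
  exact e.eqvGen_iff.1 (Quot.eqvGen_exact h)

instance (L : LinearCongruence K T) : Zero L.Space := ⟨L.cls L.zero⟩

instance (L : LinearCongruence K T) : Add L.Space :=
  ⟨Quot.map₂ L.add (fun _ _ _ h => L.add_congr (L.refl _) h)
    (fun _ _ _ h => L.add_congr h (L.refl _))⟩

instance (L : LinearCongruence K T) : Neg L.Space :=
  ⟨Quot.map (L.smul (-1)) (fun _ _ h => L.smul_congr _ h)⟩

instance (L : LinearCongruence K T) : AddCommGroup L.Space where
  add_assoc := by
    rintro ⟨a⟩ ⟨b⟩ ⟨c⟩; exact L.sound (L.add_assoc a b c)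
  add_comm := by
    rintro ⟨a⟩ ⟨b⟩; exact L.sound (L.add_comm a b)
  zero_add := by
    rintro ⟨a⟩; exact L.sound (L.zero_add a)
  add_zero := by
    rintro ⟨a⟩; exact L.sound (L.trans (L.add_comm _ _) (L.zero_add a))
  neg_add_cancel := by
    rintro ⟨a⟩
    refine L.sound (L.trans (L.add_congr (L.refl _) (L.symm (L.one_smul a))) ?_)
    refine L.trans (L.symm (L.add_smul (-1) 1 a)) ?_
    rw [neg_add_cancel]
    exact L.zero_smul a
  nsmul := nsmulRec
  zsmul := zsmulRec

theorem cls_zero (L : LinearCongruence K T) : L.cls L.zero = 0 := rfl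

theorem cls_add (L : LinearCongruence K T) (a b : T) : L.cls (L.add a b) = L.cls a + L.cls b := rfl

instance (L : LinearCongruence K T) : Module K L.Space where
  smul r := Quot.map (L.smul r) (fun _ _ h => L.smul_congr r h)
  one_smul := by
    rintro ⟨a⟩; exact L.sound (L.one_smul a)
  mul_smul := by
    rintro r s ⟨a⟩; exact L.sound (L.mul_smul r s a)
  smul_zero := by
    intro r
    refine L.sound (L.trans (L.smul_congr r (L.symm (L.zero_smul L.zero))) ?_)
    refine L.trans (L.symm (L.mul_smul r 0 L.zero)) ?_
    rw [mul_zero]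
    exact L.zero_smul _
  smul_add := by
    rintro r ⟨a⟩ ⟨b⟩; exact L.sound (L.smul_add r a b)
  add_smul := by
    rintro r s ⟨a⟩; exact L.sound (L.add_smul r s a)
  zero_smul := by
    rintro ⟨a⟩; exact L.sound (L.zero_smul a)

theorem cls_smul (L : LinearCongruence K T) (r : K) (a : T) : L.cls (L.smul r a) = r • L.cls a := rfl

/-- A linear map defined on expressions. -/
def lift (L : LinearCongruence K T) {M : Type u} [AddCommGroup M] [Module K M] (f : T → M)
    (hadd : ∀ a b, f (L.add a b) = f a + f b) (hsmul : ∀ r a, f (L.smul r a) = r • f a)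
    (hrel : ∀ {a b}, L.rel a b → f a = f b) : L.Space →ₗ[K] M where
  toFun := Quot.lift f (fun _ _ h => hrel h)
  map_add' := by
    rintro ⟨a⟩ ⟨b⟩; exact hadd a b
  map_smul' := by
    rintro r ⟨a⟩; exact hsmul r a

/-- A bilinear map defined on expressions. -/
def lift₂ (L₁ : LinearCongruence K T₁) (L₂ : LinearCongruence K T₂) (L₃ : LinearCongruence K T₃)
    (f : T₁ → T₂ → T₃)
    (hrel : ∀ {a a' b b'}, L₁.rel a a' → L₂.rel b b' → L₃.rel (f a b) (f a' b'))
    (add_left : ∀ a a' b, L₃.rel (f (L₁.add a a') b) (L₃.add (f a b) (f a' b)))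
    (smul_left : ∀ r a b, L₃.rel (f (L₁.smul r a) b) (L₃.smul r (f a b)))
    (add_right : ∀ a b b', L₃.rel (f a (L₂.add b b')) (L₃.add (f a b) (f a b')))
    (smul_right : ∀ r a b, L₃.rel (f a (L₂.smul r b)) (L₃.smul r (f a b))) :
    L₁.Space →ₗ[K] L₂.Space →ₗ[K] L₃.Space :=
  LinearMap.mk₂ K
    (Quot.map₂ f (fun _ _ _ h => hrel (L₁.refl _) h) (fun _ _ _ h => hrel h (L₂.refl _)))
    (by rintro ⟨a⟩ ⟨a'⟩ ⟨b⟩; exact L₃.sound (add_left a a' b))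
    (by rintro r ⟨a⟩ ⟨b⟩; exact L₃.sound (smul_left r a b))
    (by rintro ⟨a⟩ ⟨b⟩ ⟨b'⟩; exact L₃.sound (add_right a b b'))
    (by rintro r ⟨a⟩ ⟨b⟩; exact L₃.sound (smul_right r a b))

end LinearCongruence

/-! ### Free bimodules -/

/-- Expressions for the elements of the free `P`-bimodule on an indexed set `Y`. -/
inductive BiExpr (P : ShuffleOperad K) (Y : ℕ+ → Type u) : ℕ+ → Type u
  | gen {k : ℕ+} (y : Y k) : BiExpr P Y k
  | lact {k l n : ℕ+} (E : Shuf k l n) (x : P.carrier k) (a : BiExpr P Y l) : BiExpr P Y n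
  | ract {k l n : ℕ+} (E : Shuf k l n) (a : BiExpr P Y k) (y : P.carrier l) : BiExpr P Y n
  | zero {k : ℕ+} : BiExpr P Y k
  | add {k : ℕ+} (a b : BiExpr P Y k) : BiExpr P Y k
  | smul {k : ℕ+} (r : K) (a : BiExpr P Y k) : BiExpr P Y k

namespace BiExpr

variable {P : ShuffleOperad K} {Y : ℕ+ → Type u}

/-- The congruence generated by the axioms of `P`-bimodules. -/
inductive Rel : ∀ {k : ℕ+}, BiExpr P Y k → BiExpr P Y k → Prop
  | refl {k : ℕ+} (a : BiExpr P Y k) : Rel a a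
  | symm {k : ℕ+} {a b : BiExpr P Y k} (h : Rel a b) : Rel b a
  | trans {k : ℕ+} {a b c : BiExpr P Y k} (h : Rel a b) (h' : Rel b c) : Rel a c
  | add_congr {k : ℕ+} {a a' b b' : BiExpr P Y k} (h : Rel a a') (h' : Rel b b') :
      Rel (add a b) (add a' b')
  | smul_congr {k : ℕ+} (r : K) {a a' : BiExpr P Y k} (h : Rel a a') : Rel (smul r a) (smul r a')
  | lact_congr {k l n : ℕ+} (E : Shuf k l n) (x : P.carrier k) {a a' : BiExpr P Y l}
      (h : Rel a a') : Rel (lact E x a) (lact E x a')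
  | ract_congr {k l n : ℕ+} (E : Shuf k l n) {a a' : BiExpr P Y k} (y : P.carrier l)
      (h : Rel a a') : Rel (ract E a y) (ract E a' y)
  | add_assoc {k : ℕ+} (a b c : BiExpr P Y k) : Rel (add (add a b) c) (add a (add b c))
  | add_comm {k : ℕ+} (a b : BiExpr P Y k) : Rel (add a b) (add b a)
  | zero_add {k : ℕ+} (a : BiExpr P Y k) : Rel (add zero a) a
  | one_smul {k : ℕ+} (a : BiExpr P Y k) : Rel (smul 1 a) a
  | mul_smul {k : ℕ+} (r s : K) (a : BiExpr P Y k) : Rel (smul (r * s) a) (smul r (smul s a))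
  | smul_add {k : ℕ+} (r : K) (a b : BiExpr P Y k) :
      Rel (smul r (add a b)) (add (smul r a) (smul r b))
  | add_smul {k : ℕ+} (r s : K) (a : BiExpr P Y k) :
      Rel (smul (r + s) a) (add (smul r a) (smul s a))
  | zero_smul {k : ℕ+} (a : BiExpr P Y k) : Rel (smul 0 a) zero
  | lact_add_left {k l n : ℕ+} (E : Shuf k l n) (x x' : P.carrier k) (a : BiExpr P Y l) :
      Rel (lact E (x + x') a) (add (lact E x a) (lact E x' a))
  | lact_smul_left {k l n : ℕ+} (E : Shuf k l n) (r : K) (x : P.carrier k) (a : BiExpr P Y l) :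
      Rel (lact E (r • x) a) (smul r (lact E x a))
  | lact_add_right {k l n : ℕ+} (E : Shuf k l n) (x : P.carrier k) (a a' : BiExpr P Y l) :
      Rel (lact E x (add a a')) (add (lact E x a) (lact E x a'))
  | lact_smul_right {k l n : ℕ+} (E : Shuf k l n) (r : K) (x : P.carrier k) (a : BiExpr P Y l) :
      Rel (lact E x (smul r a)) (smul r (lact E x a))
  | ract_add_left {k l n : ℕ+} (E : Shuf k l n) (a a' : BiExpr P Y k) (y : P.carrier l) :
      Rel (ract E (add a a') y) (add (ract E a y) (ract E a' y))
  | ract_smul_left {k l n : ℕ+} (E : Shuf k l n) (r : K) (a : BiExpr P Y k) (y : P.carrier l) :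
      Rel (ract E (smul r a) y) (smul r (ract E a y))
  | ract_add_right {k l n : ℕ+} (E : Shuf k l n) (a : BiExpr P Y k) (y y' : P.carrier l) :
      Rel (ract E a (y + y')) (add (ract E a y) (ract E a y'))
  | ract_smul_right {k l n : ℕ+} (E : Shuf k l n) (r : K) (a : BiExpr P Y k) (y : P.carrier l) :
      Rel (ract E a (r • y)) (smul r (ract E a y))
  | one_lact {k : ℕ+} (E : Shuf 1 k k) (a : BiExpr P Y k) : Rel (lact E P.one a) a
  | ract_one {k : ℕ+} (E : Shuf k 1 k) (a : BiExpr P Y k) : Rel (ract E a P.one) a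
  | nested_left {k l m n q N : ℕ+} {E : Shuf k l n} {F : Shuf n m N} {F' : Shuf l m q}
      {E' : Shuf k q N} (h : Shuf.Nested E F F' E')
      (x : P.carrier k) (y : P.carrier l) (a : BiExpr P Y m) :
      Rel (lact F (P.comp E x y) a) (lact E' x (lact F' y a))
  | nested_mid {k l m n q N : ℕ+} {E : Shuf k l n} {F : Shuf n m N} {F' : Shuf l m q}
      {E' : Shuf k q N} (h : Shuf.Nested E F F' E')
      (x : P.carrier k) (a : BiExpr P Y l) (z : P.carrier m) :
      Rel (ract F (lact E x a) z) (lact E' x (ract F' a z))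
  | nested_right {k l m n q N : ℕ+} {E : Shuf k l n} {F : Shuf n m N} {F' : Shuf l m q}
      {E' : Shuf k q N} (h : Shuf.Nested E F F' E')
      (a : BiExpr P Y k) (y : P.carrier l) (z : P.carrier m) :
      Rel (ract F (ract E a y) z) (ract E' a (P.comp F' y z))
  | parallel_root {k l m n n' N : ℕ+} {E : Shuf k l n} {F : Shuf n m N} {G : Shuf k m n'}
      {H : Shuf n' l N} (h : Shuf.Parallel E F G H)
      (a : BiExpr P Y k) (y : P.carrier l) (z : P.carrier m) :
      Rel (ract F (ract E a y) z) (ract H (ract G a z) y)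
  | parallel_leaf {k l m n n' N : ℕ+} {E : Shuf k l n} {F : Shuf n m N} {G : Shuf k m n'}
      {H : Shuf n' l N} (h : Shuf.Parallel E F G H)
      (x : P.carrier k) (a : BiExpr P Y l) (z : P.carrier m) :
      Rel (ract F (lact E x a) z) (lact H (P.comp G x z) a)

/-- The bimodule axioms contain those of vector spaces. -/
def cong (P : ShuffleOperad K) (Y : ℕ+ → Type u) (k : ℕ+) : LinearCongruence K (BiExpr P Y k) where
  zero := zero
  add := add
  smul := smul
  rel := Rel
  refl := Rel.refl
  symm := Rel.symm
  trans := Rel.trans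
  add_congr := Rel.add_congr
  smul_congr := Rel.smul_congr
  add_assoc := Rel.add_assoc
  add_comm := Rel.add_comm
  zero_add := Rel.zero_add
  one_smul := Rel.one_smul
  mul_smul := Rel.mul_smul
  smul_add := Rel.smul_add
  add_smul := Rel.add_smul
  zero_smul := Rel.zero_smul

/-- The value of an expression in a bimodule `B`, given the values of the generators. -/
def eval {B : Bimodule P} (g : ∀ k, Y k → B.carrier k) : ∀ {k : ℕ+}, BiExpr P Y k → B.carrier k
  | _, gen y => g _ y
  | _, lact E x a => B.lact E x (eval g a)
  | _, ract E a y => B.ract E (eval g a) y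
  | _, zero => 0
  | _, add a b => eval g a + eval g b
  | _, smul r a => r • eval g a

theorem eval_rel {B : Bimodule P} (g : ∀ k, Y k → B.carrier k) {k : ℕ+} {a b : BiExpr P Y k}
    (h : Rel a b) : eval g a = eval g b := by
  induction h with
  | refl a => rfl
  | symm _ ih => exact ih.symm
  | trans _ _ ih ih' => exact ih.trans ih'
  | add_congr _ _ ih ih' => simp only [eval, ih, ih']
  | smul_congr r _ ih => simp only [eval, ih]
  | lact_congr E x _ ih => simp only [eval, ih]
  | ract_congr E y _ ih => simp only [eval, ih]
  | add_assoc a b c => exact _root_.add_assoc _ _ _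
  | add_comm a b => exact _root_.add_comm _ _
  | zero_add a => exact _root_.zero_add _
  | one_smul a => exact _root_.one_smul _ _
  | mul_smul r s a => exact SemigroupAction.mul_smul _ _ _
  | smul_add r a b => exact _root_.smul_add _ _ _
  | add_smul r s a => exact _root_.add_smul _ _ _
  | zero_smul a => exact _root_.zero_smul _ _
  | lact_add_left | lact_smul_left | lact_add_right | lact_smul_right => simp [eval]
  | ract_add_left | ract_smul_left | ract_add_right | ract_smul_right => simp [eval]
  | one_lact E a => exact B.one_lact E _
  | ract_one E a => exact B.ract_one E _
  | nested_left h => exact B.nested_left h _ _ _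
  | nested_mid h => exact B.nested_mid h _ _ _
  | nested_right h => exact B.nested_right h _ _ _
  | parallel_root h => exact B.parallel_root h _ _ _
  | parallel_leaf h => exact B.parallel_leaf h _ _ _

end BiExpr

/-- The free `P`-bimodule `P⟨Y⟩` on an indexed set `Y`. -/
def freeBimodule (P : ShuffleOperad K) (Y : ℕ+ → Type u) : Bimodule P where
  carrier k := (BiExpr.cong P Y k).Space
  lact {k l n} E :=
    { toFun := fun x => (BiExpr.cong P Y l).lift
        (fun a => (BiExpr.cong P Y n).cls (BiExpr.lact E x a))
        (fun a b => LinearCongruence.sound _ (BiExpr.Rel.lact_add_right E x a b))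
        (fun r a => LinearCongruence.sound _ (BiExpr.Rel.lact_smul_right E r x a))
        (fun h => LinearCongruence.sound _ (BiExpr.Rel.lact_congr E x h))
      map_add' := fun x x' => by
        ext ⟨a⟩; exact LinearCongruence.sound _ (BiExpr.Rel.lact_add_left E x x' a)
      map_smul' := fun r x => by
        ext ⟨a⟩; exact LinearCongruence.sound _ (BiExpr.Rel.lact_smul_left E r x a) }
  ract {k l n} E := (BiExpr.cong P Y k).lift
    (fun a =>
      { toFun := fun y => (BiExpr.cong P Y n).cls (BiExpr.ract E a y)
        map_add' := fun y y' =>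
          LinearCongruence.sound _ (BiExpr.Rel.ract_add_right E a y y')
        map_smul' := fun r y =>
          LinearCongruence.sound _ (BiExpr.Rel.ract_smul_right E r a y) })
    (fun a b => by
      ext y; exact LinearCongruence.sound _ (BiExpr.Rel.ract_add_left E a b y))
    (fun r a => by
      ext y; exact LinearCongruence.sound _ (BiExpr.Rel.ract_smul_left E r a y))
    (fun h => by
      ext y; exact LinearCongruence.sound _ (BiExpr.Rel.ract_congr E y h))
  one_lact E := by
    rintro ⟨a⟩; exact LinearCongruence.sound _ (BiExpr.Rel.one_lact E a)
  ract_one E := by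
    rintro ⟨a⟩; exact LinearCongruence.sound _ (BiExpr.Rel.ract_one E a)
  nested_left h x y := by
    rintro ⟨a⟩; exact LinearCongruence.sound _ (BiExpr.Rel.nested_left h x y a)
  nested_mid h x := by
    rintro ⟨a⟩ z; exact LinearCongruence.sound _ (BiExpr.Rel.nested_mid h x a z)
  nested_right h := by
    rintro ⟨a⟩ y z; exact LinearCongruence.sound _ (BiExpr.Rel.nested_right h a y z)
  parallel_root h := by
    rintro ⟨a⟩ y z; exact LinearCongruence.sound _ (BiExpr.Rel.parallel_root h a y z)
  parallel_leaf h x := by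
    rintro ⟨a⟩ z; exact LinearCongruence.sound _ (BiExpr.Rel.parallel_leaf h x a z)

namespace freeBimodule

variable {P : ShuffleOperad K} {Y : ℕ+ → Type u}

/-- The generator `[y]`. -/
def gen (P : ShuffleOperad K) {Y : ℕ+ → Type u} {k : ℕ+} (y : Y k) :
    (freeBimodule P Y).carrier k :=
  (BiExpr.cong P Y k).cls (BiExpr.gen y)

/-- The morphism of bimodules with given values on the generators. -/
def lift {B : Bimodule P} (g : ∀ k, Y k → B.carrier k) : Bimodule.Hom (freeBimodule P Y) B where
  map k := (BiExpr.cong P Y k).lift (BiExpr.eval g) (fun _ _ => rfl) (fun _ _ => rfl)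
    (fun h => BiExpr.eval_rel g h)
  map_lact E x := by
    rintro ⟨a⟩; rfl
  map_ract E := by
    rintro ⟨a⟩ y; rfl

end freeBimodule

/-- A bimodule is free if it has a basis, that is a family of elements which induces an
isomorphism from the free bimodule on that family. -/
def Bimodule.IsFree {P : ShuffleOperad K} (A : Bimodule P) : Prop :=
  ∃ (Y : ℕ+ → Type u) (g : ∀ k, Y k → A.carrier k),
    ∀ k, Function.Bijective ((freeBimodule.lift (B := A) g).map k)

/-! ### Shuffle polygraphs

Cells of the free shuffle `ω`-operad on a family of generators are classes of formal expressions,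
which are built from generators and identities by the linear and the operadic structure. Sources
and targets of generators are given by expressions that represent them. -/

/-- Expressions of dimension `n` for cells over the generators `X n`. -/
inductive CellExpr (K : Type u) (X : ℕ → ℕ+ → Type u) : ℕ → ℕ+ → Type u
  | gen {n : ℕ} {k : ℕ+} (x : X n k) : CellExpr K X n k
  | ident {n : ℕ} {k : ℕ+} (a : CellExpr K X n k) : CellExpr K X (n + 1) k
  | one {n : ℕ} : CellExpr K X n 1
  | comp {n : ℕ} {k l m : ℕ+} (E : Shuf k l m) (a : CellExpr K X n k) (b : CellExpr K X n l) :
      CellExpr K X n m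
  | zero {n : ℕ} {k : ℕ+} : CellExpr K X n k
  | add {n : ℕ} {k : ℕ+} (a b : CellExpr K X n k) : CellExpr K X n k
  | smul {n : ℕ} {k : ℕ+} (r : K) (a : CellExpr K X n k) : CellExpr K X n k

namespace CellExpr

variable {X : ℕ → ℕ+ → Type u}

/-- A boundary map on generators, extended to dimension `0` by the identity. -/
def bdGen (s : ∀ n k, X (n + 1) k → CellExpr K X n k) :
    ∀ (n : ℕ) (k : ℕ+), X n k → CellExpr K X (n - 1) k
  | 0, _, x => gen x
  | n + 1, k, x => s n k x

/-- A boundary map on expressions, extended to dimension `0` by the identity. -/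
def bdAll (s : ∀ n k, X (n + 1) k → CellExpr K X n k) :
    ∀ {n : ℕ} {k : ℕ+}, CellExpr K X n k → CellExpr K X (n - 1) k
  | _, _, gen x => bdGen s _ _ x
  | _, _, ident a => a
  | _, _, one => one
  | _, _, comp E a b => comp E (bdAll s a) (bdAll s b)
  | _, _, zero => zero
  | _, _, add a b => add (bdAll s a) (bdAll s b)
  | _, _, smul r a => smul r (bdAll s a)

/-- The boundary map (source or target) on expressions of positive dimension, given its values `s`
on generators. It commutes with the operadic operations and is inverse to identities. -/
def bd (s : ∀ n k, X (n + 1) k → CellExpr K X n k) {n : ℕ} {k : ℕ+}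
    (a : CellExpr K X (n + 1) k) : CellExpr K X n k :=
  bdAll s a

/-- The iterated boundary of an expression of dimension `j + d`, in dimension `j`. -/
def bdIter (s : ∀ n k, X (n + 1) k → CellExpr K X n k) {j : ℕ} {k : ℕ+} :
    ∀ d : ℕ, CellExpr K X (j + d) k → CellExpr K X j k
  | 0, a => a
  | d + 1, a => bdIter s d (bd s a)

/-- The iterated identity in dimension `j + d` of an expression of dimension `j`. -/
def identIter {j : ℕ} {k : ℕ+} : ∀ d : ℕ, CellExpr K X j k → CellExpr K X (j + d) k
  | 0, a => a
  | d + 1, a => ident (identIter d a)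

/-- The composite `a ⋆_j b = a - t_j(a) + b` of two `j`-composable expressions of dimension
`j + d`. Being a linear map on the space of `j`-composable pairs for which identities are neutral,
`a ⋆_j b = (a - t_j(a) + t_j(a)) ⋆_j (s_j(b) - s_j(b) + b)` is forced to have this value in every
category internal to shuffle operads. -/
def star (t : ∀ n k, X (n + 1) k → CellExpr K X n k) {j : ℕ} {k : ℕ+} (d : ℕ)
    (a b : CellExpr K X (j + d) k) : CellExpr K X (j + d) k :=
  add (add a (smul (-1) (identIter d (bdIter t d a)))) b

/-- The congruence that defines the free shuffle `ω`-operad: each dimension is a shuffle operad,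
identities are morphisms of operads, and so are the compositions `⋆_j` (rule `exchange`). The
remaining axioms of `ω`-categories, namely associativity and neutrality for `⋆_j` and the exchange
between `⋆_i` and `⋆_j`, hold by linearity for compositions of the form `a - t_j(a) + b`. -/
inductive Rel (s t : ∀ n k, X (n + 1) k → CellExpr K X n k) :
    ∀ {n : ℕ} {k : ℕ+}, CellExpr K X n k → CellExpr K X n k → Prop
  | refl {n : ℕ} {k : ℕ+} (a : CellExpr K X n k) : Rel s t a a
  | symm {n : ℕ} {k : ℕ+} {a b : CellExpr K X n k} (h : Rel s t a b) : Rel s t b a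
  | trans {n : ℕ} {k : ℕ+} {a b c : CellExpr K X n k} (h : Rel s t a b) (h' : Rel s t b c) :
      Rel s t a c
  | add_congr {n : ℕ} {k : ℕ+} {a a' b b' : CellExpr K X n k} (h : Rel s t a a') (h' : Rel s t b b') :
      Rel s t (add a b) (add a' b')
  | smul_congr {n : ℕ} {k : ℕ+} (r : K) {a a' : CellExpr K X n k} (h : Rel s t a a') :
      Rel s t (smul r a) (smul r a')
  | comp_congr {n : ℕ} {k l m : ℕ+} (E : Shuf k l m) {a a' : CellExpr K X n k} {b b' : CellExpr K X n l}
      (h : Rel s t a a') (h' : Rel s t b b') : Rel s t (comp E a b) (comp E a' b')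
  | ident_congr {n : ℕ} {k : ℕ+} {a a' : CellExpr K X n k} (h : Rel s t a a') :
      Rel s t (ident a) (ident a')
  | add_assoc {n : ℕ} {k : ℕ+} (a b c : CellExpr K X n k) :
      Rel s t (add (add a b) c) (add a (add b c))
  | add_comm {n : ℕ} {k : ℕ+} (a b : CellExpr K X n k) : Rel s t (add a b) (add b a)
  | zero_add {n : ℕ} {k : ℕ+} (a : CellExpr K X n k) : Rel s t (add zero a) a
  | one_smul {n : ℕ} {k : ℕ+} (a : CellExpr K X n k) : Rel s t (smul 1 a) a
  | mul_smul {n : ℕ} {k : ℕ+} (r r' : K) (a : CellExpr K X n k) :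
      Rel s t (smul (r * r') a) (smul r (smul r' a))
  | smul_add {n : ℕ} {k : ℕ+} (r : K) (a b : CellExpr K X n k) :
      Rel s t (smul r (add a b)) (add (smul r a) (smul r b))
  | add_smul {n : ℕ} {k : ℕ+} (r r' : K) (a : CellExpr K X n k) :
      Rel s t (smul (r + r') a) (add (smul r a) (smul r' a))
  | zero_smul {n : ℕ} {k : ℕ+} (a : CellExpr K X n k) : Rel s t (smul 0 a) zero
  | comp_add_left {n : ℕ} {k l m : ℕ+} (E : Shuf k l m) (a a' : CellExpr K X n k) (b : CellExpr K X n l) :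
      Rel s t (comp E (add a a') b) (add (comp E a b) (comp E a' b))
  | comp_smul_left {n : ℕ} {k l m : ℕ+} (E : Shuf k l m) (r : K) (a : CellExpr K X n k)
      (b : CellExpr K X n l) : Rel s t (comp E (smul r a) b) (smul r (comp E a b))
  | comp_add_right {n : ℕ} {k l m : ℕ+} (E : Shuf k l m) (a : CellExpr K X n k) (b b' : CellExpr K X n l) :
      Rel s t (comp E a (add b b')) (add (comp E a b) (comp E a b'))
  | comp_smul_right {n : ℕ} {k l m : ℕ+} (E : Shuf k l m) (r : K) (a : CellExpr K X n k)
      (b : CellExpr K X n l) : Rel s t (comp E a (smul r b)) (smul r (comp E a b))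
  | comp_one {n : ℕ} {k : ℕ+} (E : Shuf k 1 k) (a : CellExpr K X n k) : Rel s t (comp E a one) a
  | one_comp {n : ℕ} {k : ℕ+} (E : Shuf 1 k k) (a : CellExpr K X n k) : Rel s t (comp E one a) a
  | nested {n : ℕ} {k l m p q N : ℕ+} {E : Shuf k l p} {F : Shuf p m N} {F' : Shuf l m q}
      {E' : Shuf k q N} (h : Shuf.Nested E F F' E')
      (a : CellExpr K X n k) (b : CellExpr K X n l) (c : CellExpr K X n m) :
      Rel s t (comp F (comp E a b) c) (comp E' a (comp F' b c))
  | parallel {n : ℕ} {k l m p q N : ℕ+} {E : Shuf k l p} {F : Shuf p m N} {G : Shuf k m q}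
      {H : Shuf q l N} (h : Shuf.Parallel E F G H)
      (a : CellExpr K X n k) (b : CellExpr K X n l) (c : CellExpr K X n m) :
      Rel s t (comp F (comp E a b) c) (comp H (comp G a c) b)
  | ident_add {n : ℕ} {k : ℕ+} (a b : CellExpr K X n k) :
      Rel s t (ident (add a b)) (add (ident a) (ident b))
  | ident_smul {n : ℕ} {k : ℕ+} (r : K) (a : CellExpr K X n k) :
      Rel s t (ident (smul r a)) (smul r (ident a))
  | ident_one {n : ℕ} : Rel s t (ident (one : CellExpr K X n 1)) one
  | ident_comp {n : ℕ} {k l m : ℕ+} (E : Shuf k l m) (a : CellExpr K X n k) (b : CellExpr K X n l) :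
      Rel s t (ident (comp E a b)) (comp E (ident a) (ident b))
  | exchange {j : ℕ} (d : ℕ) {k l m : ℕ+} (E : Shuf k l m) (a b : CellExpr K X (j + (d + 1)) k)
      (a' b' : CellExpr K X (j + (d + 1)) l)
      (h : Rel s t (bdIter t (d + 1) a) (bdIter s (d + 1) b))
      (h' : Rel s t (bdIter t (d + 1) a') (bdIter s (d + 1) b')) :
      Rel s t (comp E (star t (d + 1) a b) (star t (d + 1) a' b'))
        (star t (d + 1) (comp E a a') (comp E b b'))

/-- The congruence contains the axioms of vector spaces. -/
def cong (s t : ∀ n k, X (n + 1) k → CellExpr K X n k) (n : ℕ) (k : ℕ+) :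
    LinearCongruence K (CellExpr K X n k) where
  zero := zero
  add := add
  smul := smul
  rel := Rel s t
  refl := Rel.refl
  symm := Rel.symm
  trans := Rel.trans
  add_congr := Rel.add_congr
  smul_congr := Rel.smul_congr
  add_assoc := Rel.add_assoc
  add_comm := Rel.add_comm
  zero_add := Rel.zero_add
  one_smul := Rel.one_smul
  mul_smul := Rel.mul_smul
  smul_add := Rel.smul_add
  add_smul := Rel.add_smul
  zero_smul := Rel.zero_smul

/-- The operad of `n`-cells. -/
def cells (s t : ∀ n k, X (n + 1) k → CellExpr K X n k) (n : ℕ) : ShuffleOperad K where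
  carrier k := (cong s t n k).Space
  one := (cong s t n 1).cls one
  comp {k l m} E := LinearCongruence.lift₂ (cong s t n k) (cong s t n l) (cong s t n m) (comp E)
    (fun h h' => Rel.comp_congr E h h')
    (fun a a' b => Rel.comp_add_left E a a' b)
    (fun r a b => Rel.comp_smul_left E r a b)
    (fun a b b' => Rel.comp_add_right E a b b')
    (fun r a b => Rel.comp_smul_right E r a b)
  comp_one E := by
    rintro ⟨a⟩; exact LinearCongruence.sound _ (Rel.comp_one E a)
  one_comp E := by
    rintro ⟨a⟩; exact LinearCongruence.sound _ (Rel.one_comp E a)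
  nested h := by
    rintro ⟨a⟩ ⟨b⟩ ⟨c⟩; exact LinearCongruence.sound _ (Rel.nested h a b c)
  parallel h := by
    rintro ⟨a⟩ ⟨b⟩ ⟨c⟩; exact LinearCongruence.sound _ (Rel.parallel h a b c)

end CellExpr

/-- A shuffle `ω`-polygraph over `K`: an indexed set of `0`-generators and, for each `n`, a
cellular extension of the operad of `n`-cells freely generated so far, that is an indexed set of
`(n+1)`-generators with `n`-cells as sources and targets, subject to the globular relations. -/
structure Polygraph (K : Type u) [Field K] where
  gens : ℕ → ℕ+ → Type u
  s : ∀ n k, gens (n + 1) k → CellExpr K gens n k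
  t : ∀ n k, gens (n + 1) k → CellExpr K gens n k
  ss : ∀ n k (x : gens (n + 2) k),
    CellExpr.Rel s t (CellExpr.bd s (s (n + 1) k x)) (CellExpr.bd s (t (n + 1) k x))
  tt : ∀ n k (x : gens (n + 2) k),
    CellExpr.Rel s t (CellExpr.bd t (s (n + 1) k x)) (CellExpr.bd t (t (n + 1) k x))

namespace Polygraph

open CellExpr

variable (X : Polygraph K)

/-- Equality of the cells represented by two expressions. -/
abbrev Eqv {n : ℕ} {k : ℕ+} (a b : CellExpr K X.gens n k) : Prop := Rel X.s X.t a b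

theorem globular (f : ∀ n k, X.gens (n + 1) k → CellExpr K X.gens n k)
    (hf : ∀ n k (x : X.gens (n + 2) k), X.Eqv (bd f (X.s (n + 1) k x)) (bd f (X.t (n + 1) k x)))
    {n : ℕ} {k : ℕ+} (a : CellExpr K X.gens (n + 2) k) :
    X.Eqv (bd f (bd X.s a)) (bd f (bd X.t a)) := by
  have key : ∀ {N : ℕ} {k : ℕ+} (a : CellExpr K X.gens N k), 2 ≤ N →
      X.Eqv (bdAll f (bdAll X.s a)) (bdAll f (bdAll X.t a)) := by
    intro N k a
    induction a with
    | @gen N k x =>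
      intro h
      match N, h, x with
      | N + 2, _, x => exact hf _ _ x
    | ident a => intro _; exact Rel.refl _
    | one => intro _; exact Rel.refl _
    | comp E a b iha ihb => intro h; exact Rel.comp_congr E (iha h) (ihb h)
    | zero => intro _; exact Rel.refl _
    | add a b iha ihb => intro h; exact Rel.add_congr (iha h) (ihb h)
    | smul r a iha => intro h; exact Rel.smul_congr r (iha h)
  exact key a (by omega)

theorem cancel_right {n : ℕ} {k : ℕ+} {a b c : CellExpr K X.gens n k} (h : X.Eqv b c) :
    X.Eqv (add (add a (smul (-1) b)) c) a := by
  refine (cong X.s X.t n k).exact ?_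
  change (cong X.s X.t n k).cls a + (-1 : K) • (cong X.s X.t n k).cls b
    + (cong X.s X.t n k).cls c = _
  rw [(cong X.s X.t n k).sound h]
  simp

theorem cancel_left {n : ℕ} {k : ℕ+} (a b : CellExpr K X.gens n k) :
    X.Eqv (add (add a (smul (-1) a)) b) b := by
  refine (cong X.s X.t n k).exact ?_
  change (cong X.s X.t n k).cls a + (-1 : K) • (cong X.s X.t n k).cls a
    + (cong X.s X.t n k).cls b = _
  simp

/-- A choice of boundary map on which sources and targets of generators agree. -/
def IsBd (f : ∀ n k, X.gens (n + 1) k → CellExpr K X.gens n k) : Prop := f = X.s ∨ f = X.t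

theorem IsBd.globular {X : Polygraph K} {f : ∀ n k, X.gens (n + 1) k → CellExpr K X.gens n k}
    (hf : X.IsBd f) {n : ℕ} {k : ℕ+} (a : CellExpr K X.gens (n + 2) k) :
    X.Eqv (bd f (bd X.s a)) (bd f (bd X.t a)) := by
  rcases hf with rfl | rfl
  · exact X.globular _ X.ss a
  · exact X.globular _ X.tt a

theorem identIter_congr {j : ℕ} {k : ℕ+} (d : ℕ) {a b : CellExpr K X.gens j k} (h : X.Eqv a b) :
    X.Eqv (identIter d a) (identIter d b) := by
  induction d with
  | zero => exact h
  | succ d ih => exact Rel.ident_congr ih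

theorem bdIter_congr {f : ∀ n k, X.gens (n + 1) k → CellExpr K X.gens n k} {j : ℕ} {k : ℕ+}
    (d : ℕ) (ih : ∀ m, m < j + d → ∀ a b : CellExpr K X.gens (m + 1) k,
      X.Eqv a b → X.Eqv (bd f a) (bd f b))
    {a b : CellExpr K X.gens (j + d) k} (h : X.Eqv a b) : X.Eqv (bdIter f d a) (bdIter f d b) := by
  induction d with
  | zero => exact h
  | succ d ihd =>
    exact ihd (fun m hm => ih m (by omega)) (ih (j + d) (by omega) a b h)

/-- Source and target are well defined on cells. -/
theorem bd_congr : ∀ (n : ℕ) (k : ℕ+) (f : ∀ n k, X.gens (n + 1) k → CellExpr K X.gens n k),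
    X.IsBd f → ∀ a b : CellExpr K X.gens (n + 1) k, X.Eqv a b → X.Eqv (bd f a) (bd f b) := by
  intro n
  induction n using Nat.strong_induction_on with
  | _ n IH =>
    intro k f hf
    have key : ∀ {N : ℕ} {k : ℕ+} {a b : CellExpr K X.gens N k}, X.Eqv a b → N ≤ n + 1 →
        X.Eqv (bdAll f a) (bdAll f b) := by
      intro N k a b h
      induction h with
      | refl a => intro _; exact Rel.refl _
      | symm _ ih => intro e; exact Rel.symm (ih e)
      | trans _ _ ih ih' => intro e; exact Rel.trans (ih e) (ih' e)
      | add_congr _ _ ih ih' => intro e; exact Rel.add_congr (ih e) (ih' e)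
      | smul_congr r _ ih => intro e; exact Rel.smul_congr r (ih e)
      | comp_congr E _ _ ih ih' => intro e; exact Rel.comp_congr E (ih e) (ih' e)
      | ident_congr h _ => intro _; exact h
      | add_assoc a b c => intro _; exact Rel.add_assoc _ _ _
      | add_comm a b => intro _; exact Rel.add_comm _ _
      | zero_add a => intro _; exact Rel.zero_add _
      | one_smul a => intro _; exact Rel.one_smul _
      | mul_smul r r' a => intro _; exact Rel.mul_smul _ _ _
      | smul_add r a b => intro _; exact Rel.smul_add _ _ _
      | add_smul r r' a => intro _; exact Rel.add_smul _ _ _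
      | zero_smul a => intro _; exact Rel.zero_smul _
      | comp_add_left E a a' b => intro _; exact Rel.comp_add_left _ _ _ _
      | comp_smul_left E r a b => intro _; exact Rel.comp_smul_left _ _ _ _
      | comp_add_right E a b b' => intro _; exact Rel.comp_add_right _ _ _ _
      | comp_smul_right E r a b => intro _; exact Rel.comp_smul_right _ _ _ _
      | comp_one E a => intro _; exact Rel.comp_one E _
      | one_comp E a => intro _; exact Rel.one_comp E _
      | nested h a b c => intro _; exact Rel.nested h _ _ _
      | parallel h a b c => intro _; exact Rel.parallel h _ _ _
      | ident_add a b => intro _; exact Rel.refl _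
      | ident_smul r a => intro _; exact Rel.refl _
      | ident_one => intro _; exact Rel.refl _
      | ident_comp E a b => intro _; exact Rel.refl _
      | @exchange j d k l m E a b a' b' h h' _ _ =>
        intro e
        cases d with
        | zero =>
          change X.Eqv
            (comp E (add (add (bd f a) (smul (-1) (bd X.t a))) (bd f b))
              (add (add (bd f a') (smul (-1) (bd X.t a'))) (bd f b')))
            (add (add (comp E (bd f a) (bd f a')) (smul (-1) (comp E (bd X.t a) (bd X.t a'))))
              (comp E (bd f b) (bd f b')))
          rcases hf with rfl | rfl
          · exact Rel.trans (Rel.comp_congr E (X.cancel_right h) (X.cancel_right h'))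
              (Rel.symm (X.cancel_right (Rel.comp_congr E h h')))
          · exact Rel.trans (Rel.comp_congr E (X.cancel_left _ _) (X.cancel_left _ _))
              (Rel.symm (X.cancel_left _ _))
        | succ d =>
          have glob : ∀ (g : ∀ n k, X.gens (n + 1) k → CellExpr K X.gens n k), X.IsBd g →
              ∀ {k : ℕ+} (c : CellExpr K X.gens (j + (d + 1) + 1) k),
              X.Eqv (bdIter g (d + 1) (bd X.s c)) (bdIter g (d + 1) (bd X.t c)) := by
            intro g hg k c
            exact X.bdIter_congr d (fun m hm => IH m (by have := e; omega) k g hg) (hg.globular c)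
          have toT : ∀ (g : ∀ n k, X.gens (n + 1) k → CellExpr K X.gens n k), X.IsBd g →
              ∀ {k : ℕ+} (c : CellExpr K X.gens (j + (d + 1) + 1) k),
              X.Eqv (bdIter g (d + 1) (bd f c)) (bdIter g (d + 1) (bd X.t c)) := by
            intro g hg k c
            rcases hf with rfl | rfl
            · exact glob g hg c
            · exact Rel.refl _
          have toS : ∀ (g : ∀ n k, X.gens (n + 1) k → CellExpr K X.gens n k), X.IsBd g →
              ∀ {k : ℕ+} (c : CellExpr K X.gens (j + (d + 1) + 1) k),
              X.Eqv (bdIter g (d + 1) (bd X.s c)) (bdIter g (d + 1) (bd f c)) :=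
            fun g hg k c => Rel.trans (glob g hg c) (Rel.symm (toT g hg c))
          have st : ∀ {k : ℕ+} (c c' : CellExpr K X.gens (j + (d + 1) + 1) k),
              X.Eqv (bd f (star X.t (d + 2) c c')) (star X.t (d + 1) (bd f c) (bd f c')) := by
            intro k c c'
            exact Rel.add_congr (Rel.add_congr (Rel.refl _) (Rel.smul_congr _
              (X.identIter_congr (d + 1) (Rel.symm (toT X.t (Or.inr rfl) c))))) (Rel.refl _)
          have hh : ∀ {k : ℕ+} (c c' : CellExpr K X.gens (j + (d + 1) + 1) k),
              X.Eqv (bdIter X.t (d + 2) c) (bdIter X.s (d + 2) c') →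
              X.Eqv (bdIter X.t (d + 1) (bd f c)) (bdIter X.s (d + 1) (bd f c')) := by
            intro k c c' h
            exact Rel.trans (toT X.t (Or.inr rfl) c) (Rel.trans h (toS X.s (Or.inl rfl) c'))
          exact Rel.trans (Rel.comp_congr E (st a b) (st a' b'))
            (Rel.trans (Rel.exchange d E _ _ _ _ (hh a b h) (hh a' b' h'))
              (Rel.symm (st (comp E a a') (comp E b b'))))
    exact fun a b h => key h le_rfl

/-- The shuffle operad of `n`-cells of the shuffle `ω`-operad freely generated by `X`. -/
def cells (n : ℕ) : ShuffleOperad K := CellExpr.cells X.s X.t n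

/-- The `n`-cell represented by an expression. -/
def cell {n : ℕ} {k : ℕ+} (a : CellExpr K X.gens n k) : (X.cells n).carrier k :=
  (cong X.s X.t n k).cls a

/-- The boundary morphism induced on cells. -/
def bdHom {f : ∀ n k, X.gens (n + 1) k → CellExpr K X.gens n k} (hf : X.IsBd f) (n : ℕ) :
    ShuffleOperad.Hom (X.cells (n + 1)) (X.cells n) where
  map k := (cong X.s X.t (n + 1) k).lift (fun a => X.cell (bd f a)) (fun _ _ => rfl)
    (fun _ _ => rfl) (fun h => LinearCongruence.sound _ (X.bd_congr n k f hf _ _ h))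
  map_one := rfl
  map_comp E := by
    rintro ⟨a⟩ ⟨b⟩; rfl

/-- The source `s_n` of `(n+1)`-cells. -/
def src (n : ℕ) : ShuffleOperad.Hom (X.cells (n + 1)) (X.cells n) := X.bdHom (Or.inl rfl) n

/-- The target `t_n` of `(n+1)`-cells. -/
def tgt (n : ℕ) : ShuffleOperad.Hom (X.cells (n + 1)) (X.cells n) := X.bdHom (Or.inr rfl) n

/-- `X` is acyclic if, for `n ≥ 1`, any two parallel `n`-cells are the source and the target of
some `(n+1)`-cell. -/
def Acyclic : Prop :=
  ∀ (n : ℕ) (k : ℕ+) (f g : (X.cells (n + 1)).carrier k),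
    (X.src n).map k f = (X.src n).map k g → (X.tgt n).map k f = (X.tgt n).map k g →
    ∃ F : (X.cells (n + 2)).carrier k,
      (X.src (n + 1)).map k F = f ∧ (X.tgt (n + 1)).map k F = g

/-- The shuffle operad presented by `X`: the coequalizer of source and target of `1`-cells. -/
def presented : ShuffleOperad K := ShuffleOperad.coequalizer (X.src 0) (X.tgt 0)

/-- The projection of `0`-cells onto the presented operad. -/
def proj : ShuffleOperad.Hom (X.cells 0) X.presented :=
  ShuffleOperad.coequalizerMap (X.src 0) (X.tgt 0)

/-! ### The complex of bimodules -/

/-- The element of the presented operad defined by an `n`-cell, through its iterated source. -/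
def bar : ∀ {n : ℕ} {k : ℕ+}, CellExpr K X.gens n k → X.presented.carrier k
  | 0, k, a => X.proj.map k (X.cell a)
  | _ + 1, _, a => bar (bd X.s a)

/-- The bracket on expressions. For `n = 0` it is the derivation with `[x] = x` on generators. For
`n ≥ 1`, it is linear, it sends a generator `α` in a context `Γ` of `0`-cells (whose identities
have bracket zero) to the generator `[α]` in the context induced by `Γ`, and identities to `0`. -/
def bracketExpr : ∀ {n : ℕ} {k : ℕ+}, CellExpr K X.gens n k →
    (freeBimodule X.presented (X.gens n)).carrier k
  | _, _, gen x => freeBimodule.gen X.presented x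
  | _, _, ident _ => 0
  | _, _, one => 0
  | _, _, comp E a b =>
      (freeBimodule X.presented (X.gens _)).ract E (bracketExpr a) (X.bar b) +
        (freeBimodule X.presented (X.gens _)).lact E (X.bar a) (bracketExpr b)
  | _, _, zero => 0
  | _, _, add a b => bracketExpr a + bracketExpr b
  | _, _, smul r a => r • bracketExpr a

theorem bar_congr {n : ℕ} {k : ℕ+} {a b : CellExpr K X.gens n k} (h : X.Eqv a b) :
    X.bar a = X.bar b := by
  induction n with
  | zero => exact congrArg (X.proj.map k) (LinearCongruence.sound _ h)
  | succ n ih => exact ih (X.bd_congr n k X.s (Or.inl rfl) _ _ h)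

theorem bar_tgt {n : ℕ} {k : ℕ+} (a : CellExpr K X.gens (n + 1) k) :
    X.bar (bd X.t a) = X.bar (bd X.s a) := by
  cases n with
  | zero => exact (ShuffleOperad.coequalizer_condition (X.src 0) (X.tgt 0) k (X.cell a)).symm
  | succ n => exact (X.bar_congr (X.globular _ X.ss a)).symm

theorem bar_bdIter {f : ∀ n k, X.gens (n + 1) k → CellExpr K X.gens n k} (hf : X.IsBd f) {j : ℕ}
    {k : ℕ+} (d : ℕ) (a : CellExpr K X.gens (j + d) k) : X.bar (bdIter f d a) = X.bar a := by
  induction d with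
  | zero => rfl
  | succ d ih =>
    refine (ih (bd f a)).trans ?_
    rcases hf with rfl | rfl
    · rfl
    · exact X.bar_tgt a

theorem bar_add {n : ℕ} {k : ℕ+} (a b : CellExpr K X.gens n k) :
    X.bar (add a b) = X.bar a + X.bar b := by
  induction n with
  | zero => exact (X.proj.map k).map_add (X.cell a) (X.cell b)
  | succ n ih => exact ih (bd X.s a) (bd X.s b)

theorem bar_smul {n : ℕ} {k : ℕ+} (r : K) (a : CellExpr K X.gens n k) :
    X.bar (smul r a) = r • X.bar a := by
  induction n with
  | zero => exact (X.proj.map k).map_smul r (X.cell a)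
  | succ n ih => exact ih (bd X.s a)

theorem bar_one {n : ℕ} : X.bar (one : CellExpr K X.gens n 1) = X.presented.one := by
  induction n with
  | zero => exact X.proj.map_one
  | succ n ih => exact ih

theorem bar_comp {n : ℕ} {k l m : ℕ+} (E : Shuf k l m) (a : CellExpr K X.gens n k)
    (b : CellExpr K X.gens n l) :
    X.bar (comp E a b) = X.presented.comp E (X.bar a) (X.bar b) := by
  induction n with
  | zero => exact X.proj.map_comp E (X.cell a) (X.cell b)
  | succ n ih => exact ih (bd X.s a) (bd X.s b)

theorem bar_identIter {j : ℕ} {k : ℕ+} (d : ℕ) (a : CellExpr K X.gens j k) :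
    X.bar (identIter d a) = X.bar a := by
  induction d with
  | zero => rfl
  | succ d ih => exact ih

theorem bar_star {j : ℕ} {k : ℕ+} (d : ℕ) {a b : CellExpr K X.gens (j + d) k}
    (h : X.Eqv (bdIter X.t d a) (bdIter X.s d b)) :
    X.bar b = X.bar a ∧ X.bar (star X.t d a b) = X.bar a := by
  have h1 : X.bar b = X.bar a := by
    rw [← X.bar_bdIter (Or.inl rfl) d b, ← X.bar_congr h, X.bar_bdIter (Or.inr rfl) d a]
  refine ⟨h1, ?_⟩
  rw [CellExpr.star, bar_add, bar_add, bar_smul, bar_identIter, X.bar_bdIter (Or.inr rfl) d a, h1]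
  simp

/-- The bracket is well defined on cells. -/
theorem bracketExpr_congr {n : ℕ} {k : ℕ+} {a b : CellExpr K X.gens n k} (h : X.Eqv a b) :
    X.bracketExpr a = X.bracketExpr b := by
  induction h with
  | refl a => rfl
  | symm _ ih => exact ih.symm
  | trans _ _ ih ih' => exact ih.trans ih'
  | add_congr _ _ ih ih' => simp only [bracketExpr, ih, ih']
  | smul_congr r _ ih => simp only [bracketExpr, ih]
  | comp_congr E h h' ih ih' =>
    simp only [bracketExpr, ih, ih', X.bar_congr h, X.bar_congr h']
  | ident_congr => rfl
  | add_assoc a b c => exact _root_.add_assoc _ _ _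
  | add_comm a b => exact _root_.add_comm _ _
  | zero_add a => exact _root_.zero_add _
  | one_smul a => exact _root_.one_smul _ _
  | mul_smul r s a => exact SemigroupAction.mul_smul _ _ _
  | smul_add r a b => exact _root_.smul_add _ _ _
  | add_smul r s a => exact _root_.add_smul _ _ _
  | zero_smul a => exact _root_.zero_smul _ _
  | comp_add_left E a a' b =>
    simp only [bracketExpr, bar_add, map_add, LinearMap.add_apply]; abel
  | comp_smul_left E r a b =>
    simp only [bracketExpr, bar_smul, map_smul, LinearMap.smul_apply, _root_.smul_add]
  | comp_add_right E a b b' =>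
    simp only [bracketExpr, bar_add, map_add]; abel
  | comp_smul_right E r a b =>
    simp only [bracketExpr, bar_smul, map_smul, _root_.smul_add]
  | comp_one E a =>
    simp only [bracketExpr, bar_one, Bimodule.ract_one, map_zero, add_zero]
  | one_comp E a =>
    simp only [bracketExpr, bar_one, Bimodule.one_lact, map_zero, LinearMap.zero_apply,
      _root_.zero_add]
  | nested h a b c =>
    simp only [bracketExpr, bar_comp, map_add, LinearMap.add_apply]
    rw [Bimodule.nested_right _ h, Bimodule.nested_mid _ h, Bimodule.nested_left _ h]
    abel
  | parallel h a b c =>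
    simp only [bracketExpr, bar_comp, map_add, LinearMap.add_apply]
    rw [Bimodule.parallel_root _ h, Bimodule.parallel_leaf _ h,
      ← Bimodule.parallel_leaf _ h.symm]
    abel
  | ident_add a b => exact (_root_.add_zero _).symm
  | ident_smul r a => exact (smul_zero _).symm
  | ident_one => rfl
  | ident_comp E a b => simp [bracketExpr]
  | @exchange j d k l m E a b a' b' h h' _ _ =>
    have e := X.bar_star (d + 1) h
    have e' := X.bar_star (d + 1) h'
    have br : ∀ {k : ℕ+} (c c' : CellExpr K X.gens (j + (d + 1)) k),
        X.bracketExpr (star X.t (d + 1) c c') = X.bracketExpr c + X.bracketExpr c' := by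
      intro k c c'
      change X.bracketExpr c + (-1 : K) • 0 + X.bracketExpr c' = _
      rw [smul_zero, _root_.add_zero]
    rw [br]
    simp only [bracketExpr, br, e.1, e.2, e'.1, e'.2, map_add, LinearMap.add_apply]
    abel

/-- The bracket `[ ]` from `n`-cells to the free bimodule on the `n`-generators. -/
def bracket (n : ℕ) (k : ℕ+) :
    (X.cells n).carrier k →ₗ[K] (freeBimodule X.presented (X.gens n)).carrier k :=
  (cong X.s X.t n k).lift X.bracketExpr (fun _ _ => rfl) (fun _ _ => rfl)
    (fun h => X.bracketExpr_congr h)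

end Polygraph

/-- The unit indexed set: a singleton in arity `1`, and empty in the other arities. -/
inductive UnitIndexed : ℕ+ → Type u
  | eps : UnitIndexed 1

/-- The generator `ε` of the free bimodule on the unit indexed set. -/
def eps (P : ShuffleOperad K) : (freeBimodule P UnitIndexed.{u}).carrier 1 :=
  freeBimodule.gen P UnitIndexed.eps

/-- The element `(ε | x) - ∑ i, x ∘_i ε`. -/
def epsRel (P : ShuffleOperad K) {k : ℕ+} (x : P.carrier k) :
    (freeBimodule P UnitIndexed.{u}).carrier k :=
  (freeBimodule P UnitIndexed).ract (Shuf.underRoot k) (eps P) x -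
    ∑ i : Fin k, (freeBimodule P UnitIndexed).lact (Shuf.onLeaf k i) x (eps P)

/-- The trivial bimodule `Ω_P`. -/
def trivialBimodule (P : ShuffleOperad K) : Bimodule P :=
  (freeBimodule P UnitIndexed).quotient (fun k => {a | ∃ x : P.carrier k, a = epsRel P x})

/-- The projection onto the trivial bimodule. -/
def toTrivial (P : ShuffleOperad K) : Bimodule.Hom (freeBimodule P UnitIndexed) (trivialBimodule P) :=
  (freeBimodule P UnitIndexed).quotientMap (fun k => {a | ∃ x : P.carrier k, a = epsRel P x})

namespace Polygraph

variable (X : Polygraph K)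

/-- The indexed set of generators of the `n`-th term of the complex: the unit indexed set for
`n = 0`, and the `(n-1)`-generators for `n ≥ 1`. -/
def chainGens : ℕ → ℕ+ → Type u
  | 0 => UnitIndexed
  | n + 1 => X.gens n

/-- The terms of the complex `P⟨X⟩` of bimodules over the presented operad `P`, whose degrees are
shifted by one: `chain 0` is `P⟨𝟏⟩` and `chain (n + 1)` is `P⟨X_n⟩`. -/
def chain (n : ℕ) : Bimodule X.presented := freeBimodule X.presented (X.chainGens n)

/-- The boundary maps of the complex `P⟨X⟩`. -/
def boundary : ∀ n, Bimodule.Hom (X.chain (n + 1)) (X.chain n)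
  | 0 => freeBimodule.lift (B := X.chain 0)
      (fun k x => epsRel X.presented (X.proj.map k (X.cell (CellExpr.gen (x : X.gens 0 k)))))
  | n + 1 => freeBimodule.lift (B := X.chain (n + 1))
      (fun k A => X.bracket n k (X.cell (X.s n k A)) - X.bracket n k (X.cell (X.t n k A)))

/-! ### Gradings -/

/-- Expressions that are homogeneous of degree `d`, for given degrees of the generators. -/
inductive HomogExpr (deg : ∀ n k, X.gens n k → ℕ) :
    ℕ → ∀ {n : ℕ} {k : ℕ+}, CellExpr K X.gens n k → Prop
  | gen {n : ℕ} {k : ℕ+} (x : X.gens n k) : HomogExpr deg (deg n k x) (CellExpr.gen x)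
  | ident {d : ℕ} {n : ℕ} {k : ℕ+} {a : CellExpr K X.gens n k} (h : HomogExpr deg d a) :
      HomogExpr deg d (CellExpr.ident a)
  | one {n : ℕ} : HomogExpr deg 0 (CellExpr.one : CellExpr K X.gens n 1)
  | comp {d e : ℕ} {n : ℕ} {k l m : ℕ+} (E : Shuf k l m) {a : CellExpr K X.gens n k}
      {b : CellExpr K X.gens n l} (h : HomogExpr deg d a) (h' : HomogExpr deg e b) :
      HomogExpr deg (d + e) (CellExpr.comp E a b)
  | zero {d : ℕ} {n : ℕ} {k : ℕ+} : HomogExpr deg d (CellExpr.zero : CellExpr K X.gens n k)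
  | add {d : ℕ} {n : ℕ} {k : ℕ+} {a b : CellExpr K X.gens n k} (h : HomogExpr deg d a)
      (h' : HomogExpr deg d b) : HomogExpr deg d (CellExpr.add a b)
  | smul {d : ℕ} {n : ℕ} {k : ℕ+} (r : K) {a : CellExpr K X.gens n k} (h : HomogExpr deg d a) :
      HomogExpr deg d (CellExpr.smul r a)

/-- Cells that are homogeneous of degree `d`. -/
def Homog (deg : ∀ n k, X.gens n k → ℕ) (d : ℕ) {n : ℕ} {k : ℕ+}
    (c : (X.cells n).carrier k) : Prop :=
  ∃ a : CellExpr K X.gens n k, X.HomogExpr deg d a ∧ X.cell a = c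

/-- `X` is a graded polygraph for the degrees `deg` of its generators: the source and the target
of every generator are homogeneous of the same degree as the generator. -/
def IsGrading (deg : ∀ n k, X.gens n k → ℕ) : Prop :=
  ∀ (n : ℕ) (k : ℕ+) (x : X.gens (n + 1) k),
    X.Homog deg (deg (n + 1) k x) (X.cell (X.s n k x)) ∧
      X.Homog deg (deg (n + 1) k x) (X.cell (X.t n k x))

/-- The part of positive degree of the presented operad, for the induced grading. -/
def positivePart (deg : ∀ n k, X.gens n k → ℕ) (k : ℕ+) : Submodule K (X.presented.carrier k) :=
  Submodule.span K {p | ∃ d, 0 < d ∧ ∃ c : (X.cells 0).carrier k, X.Homog deg d c ∧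
    X.proj.map k c = p}

end Polygraph

/-! ### Minimal resolutions -/

namespace Bimodule

variable {P : ShuffleOperad K}

/-- The part of `A` spanned by the left and right actions of the elements of `J`. -/
def actionSpan (A : Bimodule P) (J : ∀ k, Submodule K (P.carrier k)) (n : ℕ+) :
    Submodule K (A.carrier n) :=
  Submodule.span K
    ({a | ∃ (k l : ℕ+) (E : Shuf k l n) (x : P.carrier k) (b : A.carrier l), x ∈ J k ∧
        a = A.lact E x b} ∪
      {a | ∃ (k l : ℕ+) (E : Shuf k l n) (b : A.carrier k) (y : P.carrier l), y ∈ J l ∧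
        a = A.ract E b y})

/-- When `J` is the augmentation ideal of `P`, this is `A ⊗_P K`, where the left and right actions
of `J` on `K` vanish. -/
abbrev Reduction (A : Bimodule P) (J : ∀ k, Submodule K (P.carrier k)) (n : ℕ+) : Type u :=
  A.carrier n ⧸ A.actionSpan J n

theorem Hom.map_actionSpan {A B : Bimodule P} (f : Hom A B) (J : ∀ k, Submodule K (P.carrier k))
    (n : ℕ+) : A.actionSpan J n ≤ (B.actionSpan J n).comap (f.map n) := by
  refine Submodule.span_le.2 ?_
  rintro a (⟨k, l, E, x, b, hx, rfl⟩ | ⟨k, l, E, b, y, hy, rfl⟩)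
  · exact Submodule.subset_span (Or.inl ⟨k, l, E, x, f.map l b, hx, f.map_lact E x b⟩)
  · exact Submodule.subset_span (Or.inr ⟨k, l, E, f.map k b, y, hy, f.map_ract E b y⟩)

/-- The map `f ⊗_P K`. -/
def Hom.reduction {A B : Bimodule P} (f : Hom A B) (J : ∀ k, Submodule K (P.carrier k)) (n : ℕ+) :
    A.Reduction J n →ₗ[K] B.Reduction J n :=
  (A.actionSpan J n).mapQ (B.actionSpan J n) (f.map n) (f.map_actionSpan J n)

/-- The complex of bimodules `⋯ → A 2 → A 1 → A 0`, with augmentation `A 0 → M`, is a minimal free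
resolution of `M`, with respect to the augmentation ideal `J` of `P`. -/
structure IsMinimalFreeResolution (J : ∀ k, Submodule K (P.carrier k)) (A : ℕ → Bimodule P)
    (d : ∀ n, Hom (A (n + 1)) (A n)) (M : Bimodule P) (π : Hom (A 0) M) : Prop where
  free : ∀ n, (A n).IsFree
  surjective : ∀ k, Function.Surjective (π.map k)
  exact_zero : ∀ k, Function.Exact ((d 0).map k) (π.map k)
  exact_succ : ∀ n k, Function.Exact ((d (n + 1)).map k) ((d n).map k)
  minimal : ∀ n k, (d n).reduction J k = 0

end Bimodule

end ShuffleOp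

/-! The bracket turns cells into chains. It is a derivation along the projection of cells onto `P`,
it kills identities, and `bracketBoundary_bracket` extends `δ[A] = [s(A)] - [t(A)]` from generators
to all cells. Every chain of dimension `n + 1` is `[f]` for an `(n+1)`-cell with `t(f) = 0`
(`exists_bracket_eq`), so that a cycle is such an `f` with `[s(f)] = 0`. If `s(f) = 0`, then `f` is
parallel to `0`, acyclicity gives a cell `F` from `f` to `0`, and `[f] = δ[F]`. Exactness is thus a
question of how much of `s(f)` is remembered by its bracket.

Dimension at least 2. The exchange relation says that `(a - 1_{t(a)}) ∘ (b - 1_{s(b)}) = 0`, with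
source and target taken in dimension 0, and the same with `s` and `t` swapped. Hence the cells with
zero source and target in dimension 0 form a bimodule over `P` (`nullBimodule`). The map `c ↦ c -
1_{t(c)}` is a derivation with values in it, so it factors through the bracket
(`unbracket_bracket`): a cell with zero target and zero bracket is zero.

Dimensions 0 and 1. This argument fails, because `c - 1_{t(c)}` need not be null for a 1-cell. One
chooses a linear section `σ` of the projection from 0-cells to `P`, and, linearly, 1-cells from the
elements of its kernel to `0`. Every 0-cell `f` is then given 1-cells from `f(σa) - σ(f̄(a))` to
`0`, for all choices of arguments `a` in `P`. Such families of 1-cells compose along `f(g(σa)) →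
f(σ(ḡ(a))) → σ(f̄(ḡ(a)))`; with the 0-cells they form an operad (`liftOperad`) whose parallel axiom
is the exchange relation, so the lifts chosen on generators extend to all of the free operad of
0-cells. Multilinear families with values in an operad under `P` form a `P`-bimodule
(`famBimodule`); maps into it from the free bimodules show that the bracket of the lift of a 0-cell
depends only on the bracket of that 0-cell, and that the defect of a 1-cell, its difference with the
lift of its boundary, depends only on the bracket of the 1-cell. Evaluated on units, this gives
`exists_src_eq_of_bracket_eq_zero` (the source of `f` is removed by subtracting a 1-cell with zero
bracket) and `eq_zero_of_mem_nullCells_of_bracket_eq_zero`.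

Lowest terms. No acyclicity is needed there. The cokernel of `δ_0` carries the derivation `d` of `P`
induced by the bracket. In the extension `leafBimodule` of this cokernel by elements of `P` with a
marked input, the marked unit satisfies `(ε | x) - ∑ x ∘_i ε = d x`, so a chain killed by `δ_{-1}`
vanishes in the cokernel of `δ_0`.

Minimality is a count of weights: in a boundary the generators weigh less than the whole, so each of
them sits in a context of positive weight.

Simultaneous composition in a shuffle operad is handled by labelling inputs with natural numbers;
grafting then becomes one bilinear operation `mul p` for each label `p`. -/

namespace ShuffleOp

variable {K : Type u} [Field K]

/-! ### Labelled elements -/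

namespace Shuf

/-- The base condition recovers the grafting position from the two embeddings. -/
theorem ext_of_embeddings {k l n : ℕ+} {E E' : Shuf k l n} (hr : E.root = E'.root)
    (hl : E.leaf = E'.leaf) : E = E' := by
  have hp : E.pos = E'.pos := by
    apply E.root.injective
    rw [← E.base, hl, E'.base, hr]
  cases E
  cases E'
  simp only at hr hl hp
  subst hr hl hp
  rfl

/-- The least input of the upper element sits at the grafting position, hence not before the first
input of the root. Grafting therefore never changes the least label. -/
theorem root_zero {k l n : ℕ+} (E : Shuf k l n) : E.root ⟨0, k.pos⟩ = ⟨0, n.pos⟩ := by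
  have h0 : ∀ {m : ℕ+} (x : Fin m), (⟨0, m.pos⟩ : Fin m) ≤ x := fun x => Nat.zero_le _
  refine le_antisymm ?_ (h0 _)
  rcases E.cover ⟨0, n.pos⟩ with ⟨a, ha⟩ | ⟨b, hb⟩
  · rw [← ha]; exact E.root.monotone (h0 a)
  · rw [← hb]
    refine le_trans (E.root.monotone (h0 E.pos)) ?_
    rw [← E.base]
    exact E.leaf.monotone (h0 b)

theorem root_eq_leaf {k l n : ℕ+} (E : Shuf k l n) {a : Fin k} {b : Fin l}
    (h : E.root a = E.leaf b) : a = E.pos ∧ b = ⟨0, l.pos⟩ := by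
  have ha := E.inter a b h
  refine ⟨ha, E.leaf.injective ?_⟩
  rw [E.base, ← h, ha]

end Shuf

/-- Finite nonempty sets of labels, described by their increasing enumerations. -/
abbrev Labels : Type := Σ k : ℕ+, Fin k ↪o ℕ

namespace Labels

/-- The set of labels. -/
def range (i : Labels) : Set ℕ := Set.range i.2

/-- The least label. -/
def min (i : Labels) : ℕ := i.2 ⟨0, i.1.pos⟩

theorem min_mem (i : Labels) : i.min ∈ i.range := ⟨_, rfl⟩

theorem min_le (i : Labels) {x : ℕ} (h : x ∈ i.range) : i.min ≤ x := by
  obtain ⟨a, rfl⟩ := h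
  exact i.2.monotone (Nat.zero_le _)

/-- Label sets are honest finite subsets of `ℕ`, so unions formed along different bracketings can be
identified. -/
theorem ext_range {i j : Labels} (h : i.range = j.range) : i = j := by
  obtain ⟨k, m⟩ := i
  obtain ⟨l, m'⟩ := j
  have hc : (k : ℕ) = l := by
    have h1 := Set.ncard_range_of_injective m.injective
    have h2 := Set.ncard_range_of_injective m'.injective
    simp only [range] at h
    rw [h, h2] at h1
    simpa using h1.symm
  obtain rfl := PNat.coe_inj.1 hc
  have : m = m' := by
    apply (OrderEmbedding.range_inj).1 h
  rw [this]

theorem exists_union (i j : Labels) : ∃ u : Labels, u.range = i.range ∪ j.range := by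
  classical
  let S : Finset ℕ := (Set.finite_range i.2).toFinset ∪ (Set.finite_range j.2).toFinset
  have hS : (S : Set ℕ) = i.range ∪ j.range := by simp [S, range]
  have hne : S.Nonempty := ⟨i.min, by
    have : i.min ∈ (S : Set ℕ) := by rw [hS]; exact Or.inl i.min_mem
    exact this⟩
  exact ⟨⟨⟨S.card, hne.card_pos⟩, S.orderEmbOfFin rfl⟩,
    (Finset.range_orderEmbOfFin S rfl).trans hS⟩

/-- The union of two sets of labels. -/
noncomputable def union (i j : Labels) : Labels := (exists_union i j).choose

theorem range_union (i j : Labels) : (union i j).range = i.range ∪ j.range :=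
  (exists_union i j).choose_spec

/-- An element labelled by `j` may be attached to the input `p` of an element labelled by `i`. -/
structure Compat (i j : Labels) (p : ℕ) : Prop where
  mem : p ∈ i.range
  min : j.min = p
  inter : ∀ x ∈ i.range, x ∈ j.range → x = p

theorem exists_factor {k n : ℕ+} (m : Fin n ↪o ℕ) (μ : Fin k ↪o ℕ) (h : ∀ i, ∃ j, m j = μ i) :
    ∃ r : Fin k ↪o Fin n, r.trans m = μ := by
  choose r hr using h
  refine ⟨OrderEmbedding.ofStrictMono r (fun a b hab => ?_), ?_⟩
  · rw [← m.lt_iff_lt, hr, hr]; exact μ.strictMono hab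
  · ext a; exact hr a

/-- Once inputs are labelled, compatibility of two label sets carries the same information as a
shuffle; `compat_of_shuf` is the converse. All elementary compositions thus become a single partial
operation for each label. -/
theorem Compat.exists_shuf {i j u : Labels} {p : ℕ} (h : Compat i j p)
    (hu : u.range = i.range ∪ j.range) :
    ∃ E : Shuf i.1 j.1 u.1, E.root.trans u.2 = i.2 ∧ E.leaf.trans u.2 = j.2 := by
  obtain ⟨r, hr⟩ := exists_factor u.2 i.2
    (fun a => by have : i.2 a ∈ u.range := by rw [hu]; exact Or.inl ⟨a, rfl⟩
                 exact this)
  obtain ⟨l, hl⟩ := exists_factor u.2 j.2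
    (fun a => by have : j.2 a ∈ u.range := by rw [hu]; exact Or.inr ⟨a, rfl⟩
                 exact this)
  have hr' : ∀ a, u.2 (r a) = i.2 a := fun a => by rw [← hr]; rfl
  have hl' : ∀ b, u.2 (l b) = j.2 b := fun b => by rw [← hl]; rfl
  obtain ⟨a, ha⟩ := h.mem
  refine ⟨⟨a, r, l, ?_, ?_, ?_⟩, hr, hl⟩
  · apply u.2.injective
    rw [hr', hl', ha]; exact h.min
  · intro c b hcb
    apply i.2.injective
    rw [ha]
    refine h.inter _ ⟨c, rfl⟩ ⟨b, ?_⟩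
    rw [← hr', ← hl', hcb]
  · intro c
    have : u.2 c ∈ i.range ∪ j.range := by rw [← hu]; exact ⟨c, rfl⟩
    rcases this with ⟨a, ha⟩ | ⟨b, hb⟩
    · exact Or.inl ⟨a, u.2.injective (by rw [hr', ha])⟩
    · exact Or.inr ⟨b, u.2.injective (by rw [hl', hb])⟩

theorem range_of_shuf {k l n : ℕ+} (E : Shuf k l n) (m : Fin n ↪o ℕ) :
    range ⟨n, m⟩ = range ⟨k, E.root.trans m⟩ ∪ range ⟨l, E.leaf.trans m⟩ := by
  ext x
  constructor
  · rintro ⟨c, rfl⟩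
    rcases E.cover c with ⟨a, rfl⟩ | ⟨b, rfl⟩
    · exact Or.inl ⟨a, rfl⟩
    · exact Or.inr ⟨b, rfl⟩
  · rintro (⟨a, rfl⟩ | ⟨b, rfl⟩)
    · exact ⟨E.root a, rfl⟩
    · exact ⟨E.leaf b, rfl⟩

theorem compat_of_shuf {k l n : ℕ+} (E : Shuf k l n) (m : Fin n ↪o ℕ) :
    Compat ⟨k, E.root.trans m⟩ ⟨l, E.leaf.trans m⟩ (m (E.root E.pos)) where
  mem := ⟨E.pos, rfl⟩
  min := congrArg m E.base
  inter := by
    rintro x ⟨a, rfl⟩ ⟨b, hb⟩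
    have := (E.root_eq_leaf (m.injective hb.symm)).1
    rw [this]; rfl

theorem min_union {i j u : Labels} {p : ℕ} (h : Compat i j p)
    (hu : u.range = i.range ∪ j.range) : u.min = i.min := by
  apply le_antisymm
  · exact u.min_le (by rw [hu]; exact Or.inl i.min_mem)
  · have := u.min_mem
    rw [hu] at this
    rcases this with h' | h'
    · exact i.min_le h'
    · exact (i.min_le h.mem).trans (h.min ▸ j.min_le h')

end Labels

/-- The direct sum of the components of a collection, with inputs labelled by all finite sets of
natural numbers. -/
abbrev Tot (V : ℕ+ → Type u) [∀ k, AddCommGroup (V k)] : Type u :=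
  DirectSum Labels (fun i => V i.1)

namespace Tot

section Map

variable {U V W : ℕ+ → Type u} [∀ k, AddCommGroup (U k)] [∀ k, Module K (U k)]
  [∀ k, AddCommGroup (V k)] [∀ k, Module K (V k)] [∀ k, AddCommGroup (W k)] [∀ k, Module K (W k)]

open Classical in
/-- The element `x` with inputs labelled by `m`. -/
noncomputable def of {k : ℕ+} (m : Fin k ↪o ℕ) : V k →ₗ[K] Tot V :=
  DirectSum.lof K Labels (fun i => V i.1) ⟨k, m⟩

/-- The map of labelled elements induced by a map of collections. -/
noncomputable def map (f : ∀ k, V k →ₗ[K] W k) : Tot V →ₗ[K] Tot W :=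
  DirectSum.lmap (fun i : Labels => f i.1)

/-- The component of given labels. -/
def component {k : ℕ+} (m : Fin k ↪o ℕ) : Tot V →ₗ[K] V k :=
  DirectSum.component K Labels (fun i => V i.1) ⟨k, m⟩

theorem map_of (f : ∀ k, V k →ₗ[K] W k) {k : ℕ+} (m : Fin k ↪o ℕ) (x : V k) :
    map f (of (K := K) m x) = of (K := K) m (f k x) := by
  classical
  exact DirectSum.lmap_lof (R := K) (f := fun i : Labels => f i.1) ⟨k, m⟩ x

theorem component_of {k : ℕ+} (m : Fin k ↪o ℕ) (x : V k) :
    component (K := K) m (of (K := K) m x) = x := by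
  classical
  exact DirectSum.component.lof_self K (M := fun i : Labels => V i.1) ⟨k, m⟩ x

theorem component_map (f : ∀ k, V k →ₗ[K] W k) {k : ℕ+} (m : Fin k ↪o ℕ) (x : Tot V) :
    component (K := K) m (map f x) = f k (component (K := K) m x) := rfl

theorem ext_component {x y : Tot V}
    (h : ∀ (k : ℕ+) (m : Fin k ↪o ℕ), component (K := K) m x = component (K := K) m y) :
    x = y := by
  refine DFinsupp.ext (fun i => ?_)
  exact h i.1 i.2

theorem induction_of {motive : Tot V → Prop} (x : Tot V) (zero : motive 0)
    (of : ∀ (k : ℕ+) (m : Fin k ↪o ℕ) (x : V k), motive (of (K := K) m x))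
    (add : ∀ x y, motive x → motive y → motive (x + y)) : motive x := by
  classical
  exact DirectSum.induction_on x zero (fun i y => of i.1 i.2 y) add

open Classical in
/-- The projection onto the labelled elements with least label `p`. -/
noncomputable def low (p : ℕ) : Tot V →ₗ[K] Tot V :=
  DirectSum.lmap (fun i : Labels => if i.min = p then LinearMap.id else 0)

open Classical in
theorem component_low (p : ℕ) {k : ℕ+} (m : Fin k ↪o ℕ) (x : Tot V) :
    component (K := K) m (low (K := K) p x) =
      if m ⟨0, k.pos⟩ = p then component (K := K) m x else 0 := by
  change (if m ⟨0, k.pos⟩ = p then (LinearMap.id : V k →ₗ[K] V k) else 0) (x ⟨k, m⟩) = _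
  split_ifs <;> rfl

open Classical in
theorem low_of (p : ℕ) {k : ℕ+} (m : Fin k ↪o ℕ) (x : V k) :
    low (K := K) p (of (K := K) m x) =
      if m ⟨0, k.pos⟩ = p then of (K := K) m x else 0 := by
  refine (DirectSum.lmap_lof (R := K) _ _ _).trans ?_
  by_cases h : m ⟨0, k.pos⟩ = p
  · have h' : Labels.min ⟨k, m⟩ = p := h
    rw [if_pos h, if_pos h']; rfl
  · have h' : ¬ Labels.min ⟨k, m⟩ = p := h
    rw [if_neg h, if_neg h', LinearMap.zero_apply, map_zero]

theorem low_low (p : ℕ) (x : Tot V) : low (K := K) p (low (K := K) p x) = low (K := K) p x := by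
  refine ext_component (K := K) (fun k m => ?_)
  simp only [component_low]
  split_ifs <;> rfl

theorem low_map (p : ℕ) (f : ∀ k, V k →ₗ[K] W k) (x : Tot V) :
    low (K := K) p (map f x) = map f (low (K := K) p x) := by
  refine ext_component (K := K) (fun k m => ?_)
  simp only [component_low, component_map]
  split_ifs
  · rfl
  · exact (map_zero (f k)).symm

end Map

section Graft

variable (P : ShuffleOperad K)

open Classical in
/-- The composite of labelled elements, on components. -/
noncomputable def graftComp (p : ℕ) (i j : Labels) :
    P.carrier i.1 →ₗ[K] P.carrier j.1 →ₗ[K] Tot P.carrier :=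
  if h : Labels.Compat i j p then
    (P.comp (h.exists_shuf (Labels.range_union i j)).choose).compr₂
      (of (K := K) (Labels.union i j).2)
  else 0

open Classical in
/-- The composite of labelled elements at the input labelled by `p`. It vanishes unless `p` is
the least label of the second element and the only label common to both. -/
noncomputable def mul (p : ℕ) : Tot P.carrier →ₗ[K] Tot P.carrier →ₗ[K] Tot P.carrier :=
  DirectSum.toModule K Labels _ (fun i => LinearMap.flip
    (DirectSum.toModule K Labels _ (fun j => (graftComp P p i j).flip)))

theorem mul_of_of (p : ℕ) {k l : ℕ+} (m : Fin k ↪o ℕ) (m' : Fin l ↪o ℕ) (x : P.carrier k)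
    (y : P.carrier l) :
    mul P p (of (K := K) m x) (of (K := K) m' y) = graftComp P p ⟨k, m⟩ ⟨l, m'⟩ x y := by
  simp only [mul, of]
  rw [DirectSum.toModule_lof, LinearMap.flip_apply, DirectSum.toModule_lof, LinearMap.flip_apply]

theorem mul_of_not_compat {p : ℕ} {k l : ℕ+} {m : Fin k ↪o ℕ} {m' : Fin l ↪o ℕ}
    (h : ¬ Labels.Compat ⟨k, m⟩ ⟨l, m'⟩ p) (x : P.carrier k) (y : P.carrier l) :
    mul P p (of (K := K) m x) (of (K := K) m' y) = 0 := by
  rw [mul_of_of, graftComp, dif_neg h]; rfl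

/-- `graftComp` chooses a union and a shuffle; a labelled composite depends on the labels of its
factors only, so these choices do not matter. -/
theorem of_comp_unique {k l n n' : ℕ+} {E : Shuf k l n} {E' : Shuf k l n'} {m : Fin n ↪o ℕ}
    {m' : Fin n' ↪o ℕ} (hr : E.root.trans m = E'.root.trans m')
    (hl : E.leaf.trans m = E'.leaf.trans m') (x : P.carrier k) (y : P.carrier l) :
    of (K := K) m (P.comp E x y) = of (K := K) m' (P.comp E' x y) := by
  have h : (⟨n, m⟩ : Labels) = ⟨n', m'⟩ := by
    apply Labels.ext_range
    rw [Labels.range_of_shuf E, Labels.range_of_shuf E', hr, hl]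
  cases h
  have e : E = E' := by
    apply Shuf.ext_of_embeddings
    · ext a; exact congrArg Fin.val (m.injective (DFunLike.congr_fun hr a))
    · ext a; exact congrArg Fin.val (m.injective (DFunLike.congr_fun hl a))
  rw [e]

theorem mul_of {k l n : ℕ+} (E : Shuf k l n) (m : Fin n ↪o ℕ) (x : P.carrier k)
    (y : P.carrier l) :
    mul P (m (E.root E.pos)) (of (K := K) (E.root.trans m) x) (of (K := K) (E.leaf.trans m) y) =
      of (K := K) m (P.comp E x y) := by
  have h := Labels.compat_of_shuf E m
  rw [mul_of_of, graftComp, dif_pos h]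
  have hE := (h.exists_shuf (Labels.range_union _ _)).choose_spec
  exact of_comp_unique P hE.1 hE.2 x y

/-- The union `u` is left free so that the two sides of an associativity law can be computed over
the same label set. -/
theorem mul_of_compat {p : ℕ} {i j u : Labels} (h : Labels.Compat i j p)
    (hu : u.range = i.range ∪ j.range) :
    ∃ E : Shuf i.1 j.1 u.1, (∀ a, u.2 (E.root a) = i.2 a) ∧ (∀ b, u.2 (E.leaf b) = j.2 b) ∧
      i.2 E.pos = p ∧ ∀ x y, mul P p (of (K := K) i.2 x) (of (K := K) j.2 y) =
        of (K := K) u.2 (P.comp E x y) := by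
  obtain ⟨E, hr, hl⟩ := h.exists_shuf hu
  have hr' : ∀ a, u.2 (E.root a) = i.2 a := fun a => by rw [← hr]; rfl
  have hl' : ∀ b, u.2 (E.leaf b) = j.2 b := fun b => by rw [← hl]; rfl
  have hp : i.2 E.pos = p := by
    rw [← hr', ← E.base, hl']; exact h.min
  refine ⟨E, hr', hl', hp, fun x y => ?_⟩
  rw [← mul_of P E u.2, hr, hl, hr', hp]

end Graft

end Tot
end ShuffleOp

/-! ### Associativity, units and naturality of grafting of labelled elements. -/

namespace ShuffleOp

variable {K : Type u} [Field K]

namespace Labels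

theorem Compat.parallel {i j l u v : Labels} {p q : ℕ} (hpq : p ≠ q) (hq : q ∈ i.range)
    (hu : u.range = i.range ∪ j.range) (hv : v.range = i.range ∪ l.range)
    (h : Compat i j p) (h' : Compat u l q) : Compat i l q ∧ Compat v j p := by
  refine ⟨⟨hq, h'.min, fun x hx hx' => h'.inter x (by rw [hu]; exact Or.inl hx) hx'⟩,
    ⟨by rw [hv]; exact Or.inl h.mem, h.min, fun x hx hx' => ?_⟩⟩
  rw [hv] at hx
  rcases hx with hx | hx
  · exact h.inter x hx hx'
  -- A label common to `j` and `l` would be `q`, which belongs to `i`, and would therefore be `p` as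
  -- well.
  · have := h'.inter x (by rw [hu]; exact Or.inr hx') hx
    subst this
    exact absurd (h.inter x hq hx').symm hpq

theorem Compat.nested {i j l u v : Labels} {p q : ℕ} (hq : q ∈ j.range)
    (hu : u.range = i.range ∪ j.range) (hv : v.range = j.range ∪ l.range) :
    (Compat i j p ∧ Compat u l q) ↔ (Compat j l q ∧ Compat i v p) := by
  constructor
  · rintro ⟨h, h'⟩
    have h1 : Compat j l q :=
      ⟨hq, h'.min, fun x hx hx' => h'.inter x (by rw [hu]; exact Or.inr hx) hx'⟩
    refine ⟨h1, ⟨h.mem, (min_union h1 hv).trans h.min, fun x hx hx' => ?_⟩⟩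
    rw [hv] at hx'
    rcases hx' with hx' | hx'
    · exact h.inter x hx hx'
    · have := h'.inter x (by rw [hu]; exact Or.inl hx) hx'
      subst this
      exact h.inter x hx hq
  · rintro ⟨h, h'⟩
    have hm : j.min = p := (min_union h hv).symm.trans h'.min
    refine ⟨⟨h'.mem, hm, fun x hx hx' => h'.inter x hx (by rw [hv]; exact Or.inl hx')⟩,
      ⟨by rw [hu]; exact Or.inr hq, h.min, fun x hx hx' => ?_⟩⟩
    rw [hu] at hx
    rcases hx with hx | hx
    · have e := h'.inter x hx (by rw [hv]; exact Or.inr hx')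
      -- Here `x` lies in both `i` and `l`, so `x = p = min j ≤ q`, while `q = min l ≤ x`.
      apply le_antisymm
      · rw [e, ← hm]; exact j.min_le hq
      · rw [← h.min]; exact l.min_le hx'
    · exact h.inter x hx hx'

end Labels

namespace Tot

variable (P : ShuffleOperad K)

theorem mul_mul_of_not_compat {i j l u : Labels} {p q : ℕ} (hu : u.range = i.range ∪ j.range)
    (h : ¬ (Labels.Compat i j p ∧ Labels.Compat u l q)) (x : P.carrier i.1) (y : P.carrier j.1)
    (z : P.carrier l.1) :
    mul P q (mul P p (of (K := K) i.2 x) (of (K := K) j.2 y)) (of (K := K) l.2 z) = 0 := by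
  by_cases h1 : Labels.Compat i j p
  · obtain ⟨E, -, -, -, hE⟩ := mul_of_compat P h1 hu
    rw [hE]
    exact mul_of_not_compat P (fun h2 => h ⟨h1, h2⟩) _ _
  · rw [mul_of_not_compat P h1, map_zero, LinearMap.zero_apply]

theorem mul_of_mul_of_not_compat {i j l v : Labels} {p q : ℕ} (hv : v.range = j.range ∪ l.range)
    (h : ¬ (Labels.Compat j l q ∧ Labels.Compat i v p)) (x : P.carrier i.1) (y : P.carrier j.1)
    (z : P.carrier l.1) :
    mul P p (of (K := K) i.2 x) (mul P q (of (K := K) j.2 y) (of (K := K) l.2 z)) = 0 := by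
  by_cases h1 : Labels.Compat j l q
  · obtain ⟨E, -, -, -, hE⟩ := mul_of_compat P h1 hv
    rw [hE]
    exact mul_of_not_compat P (fun h2 => h ⟨h1, h2⟩) _ _
  · rw [mul_of_not_compat P h1, map_zero]

/-- Either both iterated composites are defined and the four shuffles satisfy `Parallel`, or neither
is defined and both sides are zero. Having both labels on `i` ensures that definedness is symmetric
in the two branches. -/
theorem mul_parallel_of {i j l : Labels} {p q : ℕ} (hpq : p ≠ q) (hp : p ∈ i.range)
    (hq : q ∈ i.range) (x : P.carrier i.1) (y : P.carrier j.1) (z : P.carrier l.1) :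
    mul P q (mul P p (of (K := K) i.2 x) (of (K := K) j.2 y)) (of (K := K) l.2 z) =
      mul P p (mul P q (of (K := K) i.2 x) (of (K := K) l.2 z)) (of (K := K) j.2 y) := by
  have hu := Labels.range_union i j
  have hv := Labels.range_union i l
  by_cases h : Labels.Compat i j p ∧ Labels.Compat (Labels.union i j) l q
  · have h' := Labels.Compat.parallel hpq hq hu hv h.1 h.2
    have hU := Labels.range_union (Labels.union i j) l
    have hU' : (Labels.union (Labels.union i j) l).range =
        (Labels.union i l).range ∪ j.range := by
      rw [hU, hu, hv]
      exact Set.union_right_comm _ _ _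
    obtain ⟨E, Er, El, Ep, hE⟩ := mul_of_compat P h.1 hu
    obtain ⟨F, Fr, Fl, Fp, hF⟩ := mul_of_compat P h.2 hU
    obtain ⟨G, Gr, Gl, Gp, hG⟩ := mul_of_compat P h'.1 hv
    obtain ⟨H, Hr, Hl, Hp, hH⟩ := mul_of_compat P h'.2 hU'
    have key : Shuf.Parallel E F G H := by
      refine ⟨fun e => hpq ?_, ?_, ?_, fun a => ?_, fun b => ?_, fun c => ?_⟩
      · rw [← Ep, ← Gp, e]
      · apply (Labels.union i j).2.injective; rw [Fp, Er, Gp]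
      · apply (Labels.union i l).2.injective; rw [Hp, Gr, Ep]
      all_goals apply (Labels.union (Labels.union i j) l).2.injective
      · rw [Fr, Er, Hr, Gr]
      · rw [Fr, El, Hl]
      · rw [Fl, Hr, Gl]
    rw [hE, hF, hG, hH, P.parallel key]
  · rw [mul_mul_of_not_compat P hu h, mul_mul_of_not_compat P hv]
    intro h'
    exact h (Labels.Compat.parallel hpq.symm hp hv hu h'.1 h'.2)

/-- The same dichotomy: by `Labels.Compat.nested` the two bracketings are defined simultaneously. -/
theorem mul_nested_of {i j l : Labels} {p q : ℕ} (hq : q ∈ j.range) (x : P.carrier i.1)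
    (y : P.carrier j.1) (z : P.carrier l.1) :
    mul P q (mul P p (of (K := K) i.2 x) (of (K := K) j.2 y)) (of (K := K) l.2 z) =
      mul P p (of (K := K) i.2 x) (mul P q (of (K := K) j.2 y) (of (K := K) l.2 z)) := by
  have hu := Labels.range_union i j
  have hv := Labels.range_union j l
  by_cases h : Labels.Compat i j p ∧ Labels.Compat (Labels.union i j) l q
  · have h' := (Labels.Compat.nested hq hu hv).1 h
    have hU := Labels.range_union (Labels.union i j) l
    have hU' : (Labels.union (Labels.union i j) l).range =
        i.range ∪ (Labels.union j l).range := by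
      rw [hU, hu, hv]
      exact Set.union_assoc _ _ _
    obtain ⟨E, Er, El, Ep, hE⟩ := mul_of_compat P h.1 hu
    obtain ⟨F, Fr, Fl, Fp, hF⟩ := mul_of_compat P h.2 hU
    obtain ⟨F', Fr', Fl', Fp', hF'⟩ := mul_of_compat P h'.1 hv
    obtain ⟨E', Er', El', Ep', hE'⟩ := mul_of_compat P h'.2 hU'
    have key : Shuf.Nested E F F' E' := by
      refine ⟨?_, ?_, fun a => ?_, fun b => ?_, fun c => ?_⟩
      · apply (Labels.union i j).2.injective; rw [Fp, El, Fp']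
      · apply i.2.injective; rw [Ep, Ep']
      all_goals apply (Labels.union (Labels.union i j) l).2.injective
      · rw [Fr, Er, Er']
      · rw [Fr, El, El', Fr']
      · rw [Fl, El', Fl']
    rw [hE, hF, hF', hE', P.nested key]
  · rw [mul_mul_of_not_compat P hu h, mul_of_mul_of_not_compat P hv]
    exact fun h' => h ((Labels.Compat.nested hq hu hv).2 h')

/-- The span of the labelled elements whose labels contain `s`. -/
noncomputable def labelled (s : Set ℕ) : Submodule K (Tot P.carrier) :=
  Submodule.span K {a | ∃ (i : Labels) (x : P.carrier i.1), s ⊆ i.range ∧ a = of (K := K) i.2 x}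

variable {P}

theorem of_mem_labelled {s : Set ℕ} {k : ℕ+} (m : Fin k ↪o ℕ) (x : P.carrier k)
    (h : s ⊆ Labels.range ⟨k, m⟩) : of (K := K) m x ∈ labelled P s :=
  Submodule.subset_span ⟨⟨k, m⟩, x, h, rfl⟩

theorem labelled_mono {s s' : Set ℕ} (h : s ⊆ s') : labelled P s' ≤ labelled P s := by
  apply Submodule.span_mono
  rintro a ⟨i, x, hi, rfl⟩
  exact ⟨i, x, h.trans hi, rfl⟩

theorem labelled_induction {s : Set ℕ} {motive : ∀ a : Tot P.carrier, a ∈ labelled P s → Prop}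
    (zero : motive 0 (zero_mem _))
    (of : ∀ (i : Labels) (x : P.carrier i.1) (hi : s ⊆ i.range),
      motive (of (K := K) i.2 x) (of_mem_labelled i.2 x hi))
    (add : ∀ x y hx hy, motive x hx → motive y hy → motive (x + y) (add_mem hx hy))
    {a : Tot P.carrier} (ha : a ∈ labelled P s) : motive a ha := by
  -- Treating all multiples of `a` at once absorbs the scalar case of the span, since the generators
  -- are stable under scalars.
  have key : ∀ r : K, motive (r • a) (Submodule.smul_mem _ r ha) := by
    induction ha using Submodule.span_induction with
    | mem a h =>
      obtain ⟨i, x, hi, rfl⟩ := h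
      intro r
      simp only [← map_smul]
      exact of i (r • x) hi
    | zero => intro r; simpa only [smul_zero] using zero
    | add x y hx hy ihx ihy =>
      intro r
      simp only [smul_add]
      exact add _ _ _ _ (ihx r) (ihy r)
    | smul r x hx ih =>
      intro r'
      simp only [smul_smul]
      exact ih _
  simpa only [one_smul] using key 1

theorem tot_induction {motive : Tot P.carrier → Prop} (x : Tot P.carrier) (zero : motive 0)
    (of : ∀ (k : ℕ+) (m : Fin k ↪o ℕ) (x : P.carrier k), motive (of (K := K) m x))
    (add : ∀ x y, motive x → motive y → motive (x + y)) : motive x :=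
  induction_of (K := K) x zero of add

/-- The label `p` itself survives grafting, as the least label of the upper element; so iterated
graftings never lose the labels at which they take place. -/
theorem mul_mem_labelled {s : Set ℕ} {p : ℕ} {a : Tot P.carrier} (ha : a ∈ labelled P s)
    (b : Tot P.carrier) : mul P p a b ∈ labelled P s := by
  induction ha using labelled_induction with
  | zero => rw [map_zero]; exact zero_mem _
  | add x y _ _ hx hy => rw [map_add]; exact add_mem hx hy
  | of i x hi =>
    induction b using tot_induction with
    | zero => rw [map_zero]; exact zero_mem _
    | add x y hx hy => rw [map_add]; exact add_mem hx hy
    | of k m y =>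
      by_cases h : Labels.Compat i ⟨k, m⟩ p
      · have hu := Labels.range_union i ⟨k, m⟩
        obtain ⟨E, -, -, -, hE⟩ := mul_of_compat P h hu
        rw [hE]
        refine of_mem_labelled _ _ (hi.trans ?_)
        exact fun x hx => hu ▸ Or.inl hx
      · rw [mul_of_not_compat P h]; exact zero_mem _

theorem mul_parallel {p q : ℕ} (hpq : p ≠ q) {a : Tot P.carrier} (ha : a ∈ labelled P {p, q})
    (b c : Tot P.carrier) : mul P q (mul P p a b) c = mul P p (mul P q a c) b := by
  induction ha using labelled_induction with
  | zero => simp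
  | add x y _ _ hx hy => simp only [map_add, LinearMap.add_apply, hx, hy]
  | of i x hi =>
    induction b using tot_induction with
    | zero => simp
    | add x y hx hy => simp only [map_add, LinearMap.add_apply, hx, hy]
    | of k m y =>
      induction c using tot_induction with
      | zero => simp
      | add x y hx hy => simp only [map_add, LinearMap.add_apply, hx, hy]
      | of l m' z =>
        exact mul_parallel_of P (j := ⟨k, m⟩) (l := ⟨l, m'⟩) hpq (hi (by simp)) (hi (by simp)) x y z

theorem mul_nested {p q : ℕ} (a : Tot P.carrier) {b : Tot P.carrier} (hb : b ∈ labelled P {q})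
    (c : Tot P.carrier) : mul P q (mul P p a b) c = mul P p a (mul P q b c) := by
  induction hb using labelled_induction with
  | zero => simp
  | add x y _ _ hx hy => simp only [map_add, LinearMap.add_apply, hx, hy]
  | of i x hi =>
    induction a using tot_induction with
    | zero => simp
    | add x y hx hy => simp only [map_add, LinearMap.add_apply, hx, hy]
    | of k m y =>
      induction c using tot_induction with
      | zero => simp
      | add x y hx hy => simp only [map_add, hx, hy]
      | of l m' z =>
        exact mul_nested_of P (i := ⟨k, m⟩) (l := ⟨l, m'⟩) (hi (by simp)) y x z

variable (P)

/-- The set of labels reduced to `p`. -/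
def _root_.ShuffleOp.Labels.point (p : ℕ) : Fin ((1 : ℕ+) : ℕ) ↪o ℕ :=
  OrderEmbedding.ofStrictMono (fun _ => p) (fun a b h => by
    rw [Subsingleton.elim a b] at h; exact absurd h (lt_irrefl _))

/-- The unit labelled by `p`. -/
noncomputable def unit (p : ℕ) : Tot P.carrier := of (K := K) (Labels.point p) P.one

theorem unit_mem_labelled (p : ℕ) : unit P p ∈ labelled P {p} :=
  of_mem_labelled _ _ (by rintro x rfl; exact ⟨⟨0, PNat.pos 1⟩, rfl⟩)

variable {P}

theorem mul_unit {p : ℕ} {a : Tot P.carrier} (ha : a ∈ labelled P {p}) :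
    mul P p a (unit P p) = a := by
  induction ha using labelled_induction with
  | zero => simp
  | add x y _ _ hx hy => simp only [map_add, LinearMap.add_apply, hx, hy]
  | of i x hi =>
    obtain ⟨k, m⟩ := i
    obtain ⟨c, rfl⟩ := hi rfl
    have e := mul_of P (Shuf.onLeaf k c) m x P.one
    have hr : (Shuf.onLeaf k c).root.trans m = m := by ext; rfl
    have hl : (Shuf.onLeaf k c).leaf.trans m = Labels.point (m c) := by ext; rfl
    rw [P.comp_one, hr, hl] at e
    exact e

/-- Only elements of least label `p` can be attached to the unit labelled `p`, so the left unit acts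
as a projection and not as the identity. Associativity then gives `mul_low`. -/
theorem unit_mul (p : ℕ) (a : Tot P.carrier) : mul P p (unit P p) a = low (K := K) p a := by
  induction a using tot_induction with
  | zero => simp
  | add x y hx hy => simp only [map_add, hx, hy]
  | of k m x =>
    rw [low_of]
    split_ifs with h
    · subst h
      have e := mul_of P (Shuf.underRoot k) m P.one x
      have hr : (Shuf.underRoot k).root.trans m = Labels.point (m ⟨0, k.pos⟩) := by ext; rfl
      have hl : (Shuf.underRoot k).leaf.trans m = m := by ext; rfl
      rw [P.one_comp, hr, hl] at e
      exact e
    · exact mul_of_not_compat P (fun h' => h h'.min) _ _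

theorem mul_low {p : ℕ} {a : Tot P.carrier} (ha : a ∈ labelled P {p}) (b : Tot P.carrier) :
    mul P p a (low (K := K) p b) = mul P p a b := by
  rw [← unit_mul, ← mul_nested _ (unit_mem_labelled P p), mul_unit ha]

theorem map_mul {Q : ShuffleOperad K} (f : ShuffleOperad.Hom P Q) (p : ℕ) (a b : Tot P.carrier) :
    map f.map (mul P p a b) = mul Q p (map f.map a) (map f.map b) := by
  induction a using tot_induction with
  | zero => simp
  | add x y hx hy => simp only [map_add, LinearMap.add_apply, hx, hy]
  | of k m x =>
    induction b using tot_induction with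
    | zero => simp
    | add b c hb hc => simp only [map_add, hb, hc]
    | of l m' y =>
      rw [map_of, map_of]
      by_cases h : Labels.Compat ⟨k, m⟩ ⟨l, m'⟩ p
      · have hu := Labels.range_union ⟨k, m⟩ ⟨l, m'⟩
        obtain ⟨E, hr, hl⟩ := h.exists_shuf hu
        have e : ∀ (R : ShuffleOperad K) (x : R.carrier k) (y : R.carrier l),
            mul R p (of (K := K) m x) (of (K := K) m' y) =
              of (K := K) (Labels.union ⟨k, m⟩ ⟨l, m'⟩).2 (R.comp E x y) := by
          intro R x y
          have hp : (Labels.union ⟨k, m⟩ ⟨l, m'⟩).2 (E.root E.pos) = p := by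
            rw [← E.base, ← h.min]; exact DFunLike.congr_fun hl _
          rw [← mul_of, hp, hr, hl]
        rw [e, e, map_of, f.map_comp]
      · rw [mul_of_not_compat P h, mul_of_not_compat Q h, map_zero]

theorem map_unit {Q : ShuffleOperad K} (f : ShuffleOperad.Hom P Q) (p : ℕ) :
    map f.map (unit P p) = unit Q p := by
  rw [unit, map_of, f.map_one, unit]

end Tot
end ShuffleOp

/-! ### Simultaneous composition at all inputs of an element. -/

namespace ShuffleOp

variable {K : Type u} [Field K]

namespace Tot

open Function (update)

section Fill

variable (P : ShuffleOperad K)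

/-- The composite of a labelled element with the elements `a p`, for the labels `p` in a list. -/
noncomputable def fill (a : ℕ → Tot P.carrier) : List ℕ → Tot P.carrier →ₗ[K] Tot P.carrier
  | [] => LinearMap.id
  | p :: L => fill a L ∘ₗ (mul P p).flip (a p)

variable {P}

theorem fill_cons (a : ℕ → Tot P.carrier) (p : ℕ) (L : List ℕ) (t : Tot P.carrier) :
    fill P a (p :: L) t = fill P a L (mul P p t (a p)) := rfl

theorem fill_append (a : ℕ → Tot P.carrier) (L L' : List ℕ) (t : Tot P.carrier) :
    fill P a (L ++ L') t = fill P a L' (fill P a L t) := by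
  induction L generalizing t with
  | nil => rfl
  | cons p L ih => exact ih _

theorem fill_congr {a b : ℕ → Tot P.carrier} {L : List ℕ} (h : ∀ p ∈ L, a p = b p)
    (t : Tot P.carrier) : fill P a L t = fill P b L t := by
  induction L generalizing t with
  | nil => rfl
  | cons p L ih =>
    rw [fill_cons, fill_cons, h p (by simp), ih (fun q hq => h q (by simp [hq]))]

/-- Graftings at distinct labels of the root commute, so the order in which inputs are filled is
irrelevant. -/
theorem fill_perm {s : Set ℕ} {L L' : List ℕ} (h : L.Perm L') (a : ℕ → Tot P.carrier)
    (hL : L.Nodup) (hs : ∀ p ∈ L, p ∈ s) {t : Tot P.carrier} (ht : t ∈ labelled P s) :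
    fill P a L t = fill P a L' t := by
  induction h generalizing t with
  | nil => rfl
  | cons p _ ih =>
    exact ih (List.nodup_cons.1 hL).2 (fun q hq => hs q (by simp [hq])) (mul_mem_labelled ht _)
  | swap p q L =>
    simp only [fill_cons]
    have hne : q ≠ p := fun e => by simp [e] at hL
    rw [mul_parallel hne]
    refine labelled_mono ?_ ht
    rintro x (rfl | rfl)
    · exact hs _ (by simp)
    · exact hs _ (by simp)
  | trans h _ ih ih' =>
    rw [ih hL hs ht, ih' (h.nodup_iff.1 hL) (fun q hq => hs q (h.mem_iff.2 hq)) ht]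

theorem fill_mul_nested {s : Set ℕ} {L : List ℕ} (a : ℕ → Tot P.carrier) (hs : ∀ p ∈ L, p ∈ s)
    (p : ℕ) (x : Tot P.carrier) {y : Tot P.carrier} (hy : y ∈ labelled P s) :
    fill P a L (mul P p x y) = mul P p x (fill P a L y) := by
  induction L generalizing y with
  | nil => rfl
  | cons q L ih =>
    rw [fill_cons, fill_cons, mul_nested, ih (fun q hq => hs q (by simp [hq]))
      (mul_mem_labelled hy _)]
    exact labelled_mono (by rintro _ rfl; exact hs _ (by simp)) hy

theorem fill_mul_parallel {s : Set ℕ} {L : List ℕ} (a : ℕ → Tot P.carrier) (hs : ∀ p ∈ L, p ∈ s)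
    {p : ℕ} (hp : p ∈ s) (hpL : p ∉ L) {x : Tot P.carrier} (hx : x ∈ labelled P s)
    (y : Tot P.carrier) : fill P a L (mul P p x y) = mul P p (fill P a L x) y := by
  induction L generalizing x with
  | nil => rfl
  | cons q L ih =>
    rw [fill_cons, fill_cons, mul_parallel, ih (fun q hq => hs q (by simp [hq]))
      (fun h => hpL (by simp [h])) (mul_mem_labelled hx _)]
    · rintro rfl; simp at hpL
    · refine labelled_mono ?_ hx
      rintro z (rfl | rfl)
      · exact hp
      · exact hs _ (by simp)

theorem map_fill {Q : ShuffleOperad K} (f : ShuffleOperad.Hom P Q) (a : ℕ → Tot P.carrier)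
    (L : List ℕ) (t : Tot P.carrier) :
    map f.map (fill P a L t) = fill Q (fun p => map f.map (a p)) L (map f.map t) := by
  induction L generalizing t with
  | nil => rfl
  | cons p L ih => rw [fill_cons, fill_cons, ih, map_mul]

variable (P)

/-- The composite of an element, with inputs labelled by `m`, with the labelled elements `a p`. -/
noncomputable def act {k : ℕ+} (m : Fin k ↪o ℕ) (a : ℕ → Tot P.carrier) :
    P.carrier k →ₗ[K] Tot P.carrier :=
  fill P a (List.ofFn m) ∘ₗ of (K := K) m

variable {P}

theorem nodup_labels {k : ℕ+} (m : Fin k ↪o ℕ) : (List.ofFn m).Nodup :=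
  List.nodup_ofFn.2 m.injective

/-- Filling the chosen input last makes the linearity in its argument visible; `act_update` is the
form in which this is used. -/
theorem act_eq_mul {k : ℕ+} (m : Fin k ↪o ℕ) (i : Fin k) (a : ℕ → Tot P.carrier)
    (x : P.carrier k) :
    act P m a x = mul P (m i) (fill P a ((List.ofFn m).erase (m i)) (of (K := K) m x)) (a (m i)) := by
  have h : (List.ofFn m).Perm ((List.ofFn m).erase (m i) ++ [m i]) :=
    (List.perm_cons_erase (by simp)).trans (List.perm_append_singleton _ _).symm
  refine (fill_perm (s := Labels.range ⟨k, m⟩) h a (nodup_labels m) ?_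
    (of_mem_labelled m x le_rfl)).trans ?_
  · intro p hp
    exact (List.mem_ofFn' _ _).1 hp
  · rw [fill_append]; rfl

theorem notMem_erase_label {k : ℕ+} (m : Fin k ↪o ℕ) (i : Fin k) :
    m i ∉ (List.ofFn m).erase (m i) :=
  (nodup_labels m).not_mem_erase

theorem fill_update {L : List ℕ} {p : ℕ} (h : p ∉ L) (a : ℕ → Tot P.carrier)
    (x t : Tot P.carrier) : fill P (update a p x) L t = fill P a L t := by
  refine fill_congr (fun q hq => ?_) t
  rw [Function.update_of_ne]
  rintro rfl
  exact h hq

theorem act_update {k : ℕ+} (m : Fin k ↪o ℕ) (i : Fin k) (a : ℕ → Tot P.carrier)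
    (x : P.carrier k) (b : Tot P.carrier) :
    act P m (update a (m i) b) x =
      mul P (m i) (fill P a ((List.ofFn m).erase (m i)) (of (K := K) m x)) b := by
  rw [act_eq_mul m i, fill_update (notMem_erase_label m i), Function.update_self]

theorem act_congr {k : ℕ+} (m : Fin k ↪o ℕ) {a b : ℕ → Tot P.carrier}
    (h : ∀ i, a (m i) = b (m i)) (x : P.carrier k) : act P m a x = act P m b x := by
  refine fill_congr (fun p hp => ?_) _
  obtain ⟨i, rfl⟩ := (List.mem_ofFn' _ _).1 hp
  exact h i

/-- The projection is left composition with a unit, which moves past the filling of the inputs by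
associativity. -/
theorem low_act {k : ℕ+} (m : Fin k ↪o ℕ) (a : ℕ → Tot P.carrier) (x : P.carrier k) :
    low (K := K) (m ⟨0, k.pos⟩) (act P m a x) = act P m a x := by
  classical
  rw [← unit_mul]
  refine (fill_mul_nested (s := Labels.range ⟨k, m⟩) a (fun p hp => (List.mem_ofFn' _ _).1 hp) _ _
    (of_mem_labelled m x le_rfl)).symm.trans ?_
  rw [unit_mul, low_of, if_pos rfl]
  rfl

theorem fill_low {s : Set ℕ} {L : List ℕ} (a : ℕ → Tot P.carrier) (hs : ∀ p ∈ L, p ∈ s)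
    {t : Tot P.carrier} (ht : t ∈ labelled P s) :
    fill P (fun p => low (K := K) p (a p)) L t = fill P a L t := by
  induction L generalizing t with
  | nil => rfl
  | cons q L ih =>
    rw [fill_cons, fill_cons, mul_low, ih (fun q hq => hs q (by simp [hq]))
      (mul_mem_labelled ht _)]
    exact labelled_mono (by rintro _ rfl; exact hs _ (by simp)) ht

theorem act_low {k : ℕ+} (m : Fin k ↪o ℕ) (a : ℕ → Tot P.carrier) (x : P.carrier k) :
    act P m (fun p => low (K := K) p (a p)) x = act P m a x :=
  fill_low (s := Labels.range ⟨k, m⟩) a (fun _ hp => (List.mem_ofFn' _ _).1 hp)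
    (of_mem_labelled m x le_rfl)

theorem act_unit {k : ℕ+} (m : Fin k ↪o ℕ) (x : P.carrier k) :
    act P m (unit P) x = of (K := K) m x := by
  have key : ∀ (L : List ℕ) (_ : ∀ p ∈ L, p ∈ Labels.range ⟨k, m⟩),
      fill P (unit P) L (of (K := K) m x) = of (K := K) m x := by
    intro L
    induction L with
    | nil => intro _; rfl
    | cons q L ih =>
      intro hs
      rw [fill_cons, mul_unit, ih (fun q hq => hs q (by simp [hq]))]
      exact of_mem_labelled _ _ (by rintro _ rfl; exact hs _ (by simp))
  exact key _ (fun _ hp => (List.mem_ofFn' _ _).1 hp)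

theorem map_act {Q : ShuffleOperad K} (f : ShuffleOperad.Hom P Q) {k : ℕ+} (m : Fin k ↪o ℕ)
    (a : ℕ → Tot P.carrier) (x : P.carrier k) :
    map f.map (act P m a x) = act Q m (fun p => map f.map (a p)) (f.map k x) := by
  rw [act, LinearMap.comp_apply, map_fill, map_of]; rfl

theorem act_one (m : Fin ((1 : ℕ+) : ℕ) ↪o ℕ) (a : ℕ → Tot P.carrier) :
    act P m a P.one = low (K := K) (m ⟨0, PNat.pos 1⟩) (a (m ⟨0, PNat.pos 1⟩)) := by
  rw [act_eq_mul m ⟨0, PNat.pos 1⟩, ← unit_mul]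
  have h : (List.ofFn m).erase (m ⟨0, PNat.pos 1⟩) = [] := by
    apply List.eq_nil_iff_forall_not_mem.2
    intro p hp
    have h1 := (nodup_labels m).mem_erase_iff.1 hp
    obtain ⟨i, rfl⟩ := (List.mem_ofFn' _ _).1 h1.2
    exact h1.1 (congrArg m (Subsingleton.elim _ _))
  have hm : m = Labels.point (m ⟨0, PNat.pos 1⟩) := by
    ext i
    exact congrArg m (Subsingleton.elim _ _)
  rw [h, unit, ← hm]
  rfl

/-- Filling the inputs of `y` first goes inside `y` by nested associativity; the remaining inputs of
`x` are then filled past `y` by parallel associativity. The label of the grafting position is shared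
by both elements and is counted with `y`. -/
theorem act_comp {k l n : ℕ+} (E : Shuf k l n) (m : Fin n ↪o ℕ) (a : ℕ → Tot P.carrier)
    (x : P.carrier k) (y : P.carrier l) :
    act P m a (P.comp E x y) = act P (E.root.trans m)
      (update a (m (E.root E.pos)) (act P (E.leaf.trans m) a y)) x := by
  set p := m (E.root E.pos) with hp
  set r := (List.ofFn (E.root.trans m)).erase p with hr
  have hpr : p ∉ r := notMem_erase_label (E.root.trans m) E.pos
  have mem_leaf : ∀ q, q ∈ List.ofFn (E.leaf.trans m) ↔ ∃ b, m (E.leaf b) = q := fun q =>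
    List.mem_ofFn' _ _
  have mem_r : ∀ q, q ∈ r ↔ q ≠ p ∧ ∃ b, m (E.root b) = q := fun q => by
    rw [hr, (nodup_labels _).mem_erase_iff]
    exact and_congr_right fun _ => List.mem_ofFn' _ _
  have hd : ∀ q ∈ List.ofFn (E.leaf.trans m), q ∉ r := by
    intro q hq hq'
    obtain ⟨b, rfl⟩ := (mem_leaf _).1 hq
    obtain ⟨hne, c, hc⟩ := (mem_r _).1 hq'
    apply hne
    rw [← hc, hp, (E.root_eq_leaf (m.injective hc)).1]
  have hperm : (List.ofFn m).Perm (List.ofFn (E.leaf.trans m) ++ r) := by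
    rw [List.perm_ext_iff_of_nodup (nodup_labels m)]
    · intro q
      rw [List.mem_append, mem_leaf, mem_r]
      constructor
      · intro hq
        obtain ⟨c, rfl⟩ := (List.mem_ofFn' _ _).1 hq
        rcases E.cover c with ⟨d, rfl⟩ | ⟨b, rfl⟩
        · by_cases h : d = E.pos
          · left
            exact ⟨⟨0, l.pos⟩, by rw [E.base, h]⟩
          · exact Or.inr ⟨fun e => h (E.root.injective (m.injective e)), d, rfl⟩
        · exact Or.inl ⟨b, rfl⟩
      · rintro (⟨b, rfl⟩ | ⟨_, b, rfl⟩) <;> simp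
    · exact List.nodup_append'.2 ⟨nodup_labels _, (nodup_labels _).erase _,
        fun q hq hq' => hd q hq hq'⟩
  have h1 : act P m a (P.comp E x y) = fill P a (List.ofFn (E.leaf.trans m) ++ r)
      (of (K := K) m (P.comp E x y)) :=
    fill_perm (s := Labels.range ⟨n, m⟩) hperm a (nodup_labels m)
      (fun p hp => (List.mem_ofFn' _ _).1 hp) (of_mem_labelled m _ le_rfl)
  have h2 := act_update (E.root.trans m) E.pos a x (act P (E.leaf.trans m) a y)
  refine h1.trans (Eq.trans ?_ h2.symm)
  rw [fill_append, ← mul_of, fill_mul_nested (s := Labels.range ⟨l, E.leaf.trans m⟩) a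
    (fun q hq => (List.mem_ofFn' _ _).1 hq) _ _ (of_mem_labelled _ _ le_rfl)]
  refine fill_mul_parallel (s := Labels.range ⟨k, E.root.trans m⟩) a
    (fun q hq => ((mem_r q).1 hq).2) ⟨E.pos, rfl⟩ hpr (of_mem_labelled _ _ le_rfl) _

end Fill

end Tot
end ShuffleOp

namespace ShuffleOp

variable {K : Type u} [Field K]

/-! ### Families of labelled elements -/

namespace Tot

open Function (update)

section Fam

set_option linter.unusedSectionVars false

variable {S U V W : ℕ+ → Type u} [∀ k, AddCommGroup (S k)] [∀ k, Module K (S k)]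
  [∀ k, AddCommGroup (U k)] [∀ k, Module K (U k)]
  [∀ k, AddCommGroup (V k)] [∀ k, Module K (V k)] [∀ k, AddCommGroup (W k)] [∀ k, Module K (W k)]

/-- Functions of labelled elements, for all labellings of `k` inputs. -/
abbrev Fam (U W : ℕ+ → Type u) [∀ k, AddCommGroup (U k)] [∀ k, AddCommGroup (W k)] (k : ℕ+) :
    Type u :=
  (Fin k ↪o ℕ) → (ℕ → Tot U) → Tot W

/-- The families of multilinear functions of the elements at the given labels, which depend only
on their components of least label the given one, and take values of least label the first. -/
structure IsFam (K : Type u) [Field K] [∀ k, Module K (U k)] [∀ k, Module K (W k)] {k : ℕ+}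
    (φ : Fam U W k) : Prop where
  add : ∀ m i a x y,
    φ m (update a (m i) (x + y)) = φ m (update a (m i) x) + φ m (update a (m i) y)
  smul : ∀ m i a (r : K) x, φ m (update a (m i) (r • x)) = r • φ m (update a (m i) x)
  congr : ∀ m {a b}, (∀ i, a (m i) = b (m i)) → φ m a = φ m b
  low_val : ∀ m a, low (K := K) (m ⟨0, k.pos⟩) (φ m a) = φ m a
  low_arg : ∀ m a, φ m (fun p => low (K := K) p (a p)) = φ m a

theorem IsFam.sub {k : ℕ+} {φ : Fam U W k} (h : IsFam K φ) (m : Fin k ↪o ℕ) (i : Fin k)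
    (a : ℕ → Tot U) (x y : Tot U) :
    φ m (update a (m i) (x - y)) = φ m (update a (m i) x) - φ m (update a (m i) y) := by
  rw [eq_sub_iff_add_eq, ← h.add, sub_add_cancel]

theorem IsFam.update_zero {k : ℕ+} {φ : Fam U W k} (h : IsFam K φ) (m : Fin k ↪o ℕ) (i : Fin k)
    (a : ℕ → Tot U) : φ m (update a (m i) 0) = 0 := by
  rw [← sub_self (0 : Tot U), h.sub, sub_self]

/-- The vector space of families. -/
def famSpace (K : Type u) [Field K] (U W : ℕ+ → Type u) [∀ k, AddCommGroup (U k)]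
    [∀ k, Module K (U k)] [∀ k, AddCommGroup (W k)] [∀ k, Module K (W k)] (k : ℕ+) :
    Submodule K (Fam U W k) where
  carrier := {φ | IsFam K φ}
  zero_mem' :=
    { add := fun _ _ _ _ _ => (add_zero _).symm
      smul := fun _ _ _ _ _ => (smul_zero _).symm
      congr := fun _ _ _ _ => rfl
      low_val := fun _ _ => map_zero _
      low_arg := fun _ _ => rfl }
  add_mem' := fun {φ ψ} h h' =>
    { add := fun m i a x y => by
        simp only [Pi.add_apply, h.add, h'.add]; abel
      smul := fun m i a r x => by
        simp only [Pi.add_apply, h.smul, h'.smul, smul_add]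
      congr := fun m a b e => by
        simp only [Pi.add_apply, h.congr m e, h'.congr m e]
      low_val := fun m a => by
        simp only [Pi.add_apply, map_add, h.low_val, h'.low_val]
      low_arg := fun m a => by
        simp only [Pi.add_apply, h.low_arg, h'.low_arg] }
  smul_mem' := fun r φ h =>
    { add := fun m i a x y => by
        simp only [Pi.smul_apply, h.add, smul_add]
      smul := fun m i a r' x => by
        simp only [Pi.smul_apply, h.smul, smul_comm r r']
      congr := fun m a b e => by
        simp only [Pi.smul_apply, h.congr m e]
      low_val := fun m a => by
        simp only [Pi.smul_apply, map_smul, h.low_val]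
      low_arg := fun m a => by
        simp only [Pi.smul_apply, h.low_arg] }

theorem IsFam.map {k : ℕ+} {φ : Fam U V k} (h : IsFam K φ) (f : ∀ k, V k →ₗ[K] W k) :
    IsFam K (fun m a => Tot.map f (φ m a)) where
  add m i a x y := by rw [h.add, map_add]
  smul m i a r x := by rw [h.smul, map_smul]
  congr m a b e := by rw [h.congr m e]
  low_val m a := by rw [low_map, h.low_val]
  low_arg m a := by rw [h.low_arg]

theorem update_comp {A B : Type*} (f : A → B) (a : ℕ → A) (p : ℕ) (x : A) :
    (fun q => f (update a p x q)) = update (fun q => f (a q)) p (f x) := by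
  ext q
  rcases eq_or_ne q p with rfl | h
  · simp
  · simp [h]

theorem IsFam.comap {k : ℕ+} {φ : Fam V W k} (h : IsFam K φ) (f : ∀ k, U k →ₗ[K] V k) :
    IsFam K (fun m (a : ℕ → Tot U) => φ m (fun p => Tot.map f (a p))) where
  add m i a x y := by
    simp only [update_comp, map_add]; exact h.add _ _ _ _ _
  smul m i a r x := by
    simp only [update_comp, map_smul]; exact h.smul _ _ _ _ _
  congr m a b e := h.congr m (fun i => by rw [e])
  low_val m a := h.low_val _ _
  low_arg m a := by
    simp only [← low_map]; exact h.low_arg _ _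

/-- The composite of families along a shuffle. -/
def graft {k l n : ℕ+} (E : Shuf k l n) (j : Tot U → Tot V) (f : Fam V W k) (g : Fam U V l) :
    Fam U W n := fun m a =>
  f (E.root.trans m) (update (fun p => j (a p)) (m (E.root E.pos)) (g (E.leaf.trans m) a))

/-- Each label of the composite is either a label of the inner family, seen by the outer one only
through the value plugged in at the grafting position, or a label of the outer family that the inner
one ignores. Linearity is checked in these two cases. -/
theorem IsFam.graft {k l n : ℕ+} (E : Shuf k l n) {j : Tot U →ₗ[K] Tot V}
    (hj : ∀ p x, low (K := K) p (j x) = j (low (K := K) p x)) {f : Fam V W k}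
    {g : Fam U V l} (hf : IsFam K f) (hg : IsFam K g) : IsFam K (Tot.graft E j f g) := by
  have leaf_ne : ∀ (m : Fin n ↪o ℕ) (b : Fin l) (i : Fin k),
      m (E.root i) ≠ m (E.root E.pos) → m (E.root i) ≠ m (E.leaf b) := by
    intro m b i h e
    exact h (by rw [(E.root_eq_leaf (m.injective e)).1])
  have leaf_case : ∀ (m : Fin n ↪o ℕ) (b : Fin l) (a : ℕ → Tot U) (x : Tot U),
      Tot.graft E j f g m (update a (m (E.leaf b)) x) = f (E.root.trans m)
        (update (fun p => j (a p)) (m (E.root E.pos))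
          (g (E.leaf.trans m) (update a (m (E.leaf b)) x))) := by
    intro m b a x
    apply hf.congr
    intro i
    change update _ _ _ (m (E.root i)) = update _ _ _ (m (E.root i))
    rcases eq_or_ne (m (E.root i)) (m (E.root E.pos)) with h | h
    · rw [h, Function.update_self, Function.update_self]
    · rw [Function.update_of_ne h, Function.update_of_ne h,
        Function.update_of_ne (leaf_ne m b i h)]
  have root_case : ∀ (m : Fin n ↪o ℕ) (i : Fin k), i ≠ E.pos → ∀ (a : ℕ → Tot U) (x : Tot U),
      Tot.graft E j f g m (update a (m (E.root i)) x) = f (E.root.trans m)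
        (update (update (fun p => j (a p)) (m (E.root E.pos)) (g (E.leaf.trans m) a))
          ((E.root.trans m) i) (j x)) := by
    intro m i hi a x
    have hne : m (E.root i) ≠ m (E.root E.pos) :=
      fun e => hi (E.root.injective (m.injective e))
    have e1 : g (E.leaf.trans m) (update a (m (E.root i)) x) = g (E.leaf.trans m) a := by
      apply hg.congr
      intro b
      exact Function.update_of_ne (leaf_ne m b i hne).symm _ _
    simp only [Tot.graft, e1, update_comp]
    rw [Function.update_comm hne]
    rfl
  have cover : ∀ c : Fin n, (∃ b, E.leaf b = c) ∨ ∃ i, i ≠ E.pos ∧ E.root i = c := by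
    intro c
    rcases E.cover c with ⟨i, rfl⟩ | ⟨b, rfl⟩
    · by_cases hi : i = E.pos
      · exact Or.inl ⟨⟨0, l.pos⟩, by rw [E.base, hi]⟩
      · exact Or.inr ⟨i, hi, rfl⟩
    · exact Or.inl ⟨b, rfl⟩
  refine ⟨?_, ?_, ?_, ?_, ?_⟩
  · intro m c a x y
    rcases cover c with ⟨b, rfl⟩ | ⟨i, hi, rfl⟩
    · simp only [leaf_case]
      rw [show m (E.leaf b) = (E.leaf.trans m) b from rfl, hg.add]
      exact hf.add _ E.pos _ _ _
    · simp only [root_case m i hi, map_add, hf.add]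
  · intro m c a r x
    rcases cover c with ⟨b, rfl⟩ | ⟨i, hi, rfl⟩
    · simp only [leaf_case]
      rw [show m (E.leaf b) = (E.leaf.trans m) b from rfl, hg.smul]
      exact hf.smul _ E.pos _ _ _
    · simp only [root_case m i hi, map_smul, hf.smul]
  · intro m a b e
    simp only [Tot.graft]
    rw [hg.congr (E.leaf.trans m) (fun i => e (E.leaf i))]
    apply hf.congr
    intro i
    change update _ _ _ (m (E.root i)) = update _ _ _ (m (E.root i))
    rcases eq_or_ne (m (E.root i)) (m (E.root E.pos)) with h | h
    · rw [h, Function.update_self, Function.update_self]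
    · rw [Function.update_of_ne h, Function.update_of_ne h, e]
  · intro m a
    have := hf.low_val (E.root.trans m) (update (fun p => j (a p)) (m (E.root E.pos))
      (g (E.leaf.trans m) a))
    rw [show (E.root.trans m) ⟨0, k.pos⟩ = m ⟨0, n.pos⟩ from congrArg m E.root_zero] at this
    exact this
  · intro m a
    simp only [Tot.graft, hg.low_arg, ← hj]
    rw [← hf.low_arg, ← hf.low_arg _ (update (fun p => j (a p)) _ _)]
    congr 1
    ext1 q
    rcases eq_or_ne q (m (E.root E.pos)) with rfl | h
    · simp
    · simp [h, low_low]

theorem graft_nested {k l m n q N : ℕ+} {E : Shuf k l n} {F : Shuf n m N} {F' : Shuf l m q}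
    {E' : Shuf k q N} (h : Shuf.Nested E F F' E') {j₁ : Tot S → Tot U} {j₂ : Tot U → Tot V}
    {j₃ : Tot S → Tot V} (hj : ∀ x, j₂ (j₁ x) = j₃ x) {f : Fam V W k} (hf : IsFam K f)
    (g : Fam U V l) (g' : Fam S U m) :
    graft F j₁ (graft E j₂ f g) g' = graft E' j₃ f (graft F' j₁ g g') := by
  funext M a
  have e1 : E.root.trans (F.root.trans M) = E'.root.trans M := by
    ext i; exact congrArg M (h.root_root i)
  have e2 : E.leaf.trans (F.root.trans M) = F'.root.trans (E'.leaf.trans M) := by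
    ext i; exact congrArg M (h.root_leaf i)
  have e3 : F.leaf.trans M = F'.leaf.trans (E'.leaf.trans M) := by
    ext i; exact congrArg M (h.leaf_leaf i)
  have e4 : F.root F.pos = E'.leaf (F'.root F'.pos) := by
    rw [← F.base, h.leaf_leaf, F'.base]
  have e5 : F.root (E.root E.pos) = E'.root E'.pos := by rw [h.root_root, h.pos_E]
  simp only [graft, e1, e2, e3]
  apply hf.congr
  intro i
  change update _ (M (F.root (E.root E.pos))) _ (M (E'.root i)) = update _ _ _ (M (E'.root i))
  rw [e5]
  rcases eq_or_ne (M (E'.root i)) (M (E'.root E'.pos)) with h' | h'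
  · rw [h', Function.update_self, Function.update_self, e4]
    rfl
  · rw [Function.update_of_ne h', Function.update_of_ne h', Function.update_of_ne, hj]
    rw [e4]
    intro e
    exact h' (by rw [(E'.root_eq_leaf (M.injective e)).1])

/-- A normal form of the double grafting in which the two branches appear as two updates at distinct
labels. The family `g` does not see the value of `g'`, which is placed at a label that is not one of
its own. -/
theorem graft_parallel_aux {k l m n n' N : ℕ+} {E : Shuf k l n} {F : Shuf n m N}
    {G : Shuf k m n'} {H : Shuf n' l N} (h : Shuf.Parallel E F G H) (j₁ : Tot S → Tot U)
    (j₂ : Tot U → Tot V) (f : Fam V W k) {g : Fam U V l} (hg : IsFam K g) (g' : Fam S U m)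
    (M : Fin N ↪o ℕ) (a : ℕ → Tot S) :
    graft F j₁ (graft E j₂ f g) g' M a = f (E.root.trans (F.root.trans M))
      (update (update (fun p => j₂ (j₁ (a p))) (M (F.root (E.root G.pos)))
        (j₂ (g' (F.leaf.trans M) a))) (M (F.root (E.root E.pos)))
        (g (H.leaf.trans M) (fun p => j₁ (a p)))) := by
  have e1 : E.leaf.trans (F.root.trans M) = H.leaf.trans M := by
    ext i; exact congrArg M (h.root_leaf i)
  have e2 : g (H.leaf.trans M) (update (fun p => j₁ (a p)) (M (F.root F.pos))
      (g' (F.leaf.trans M) a)) = g (H.leaf.trans M) (fun p => j₁ (a p)) := by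
    apply hg.congr
    intro b
    refine Function.update_of_ne ?_ _ _
    change M (H.leaf b) ≠ _
    rw [← h.root_leaf, h.pos_F]
    intro e
    have := E.root_eq_leaf (F.root.injective (M.injective e)).symm
    exact h.ne this.1.symm
  rw [h.pos_F] at e2
  simp only [graft, e1, update_comp, h.pos_F]
  rw [e2]
  rfl

/-- The two orders may pass through different intermediate collections, so each branch occurs in two
versions; `h1` and `h2` match these versions. -/
theorem graft_parallel {R : ℕ+ → Type u} [∀ k, AddCommGroup (R k)] [∀ k, Module K (R k)]
    {k l m n n' N : ℕ+} {E : Shuf k l n} {F : Shuf n m N} {G : Shuf k m n'}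
    {H : Shuf n' l N} (h : Shuf.Parallel E F G H) {j₁ : Tot S → Tot U}
    {j₂ : Tot U → Tot V} {i₁ : Tot S → Tot R} {i₂ : Tot R → Tot V}
    (hj : ∀ x, j₂ (j₁ x) = i₂ (i₁ x)) (f : Fam V W k)
    {g : Fam U V l} {g₁ : Fam S U m} {g' : Fam S R l} {g₁' : Fam R V m} (hg : IsFam K g)
    (hg' : IsFam K g₁') (h1 : ∀ M a, j₂ (g₁ M a) = g₁' M (fun p => i₁ (a p)))
    (h2 : ∀ M a, i₂ (g' M a) = g M (fun p => j₁ (a p))) :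
    graft F j₁ (graft E j₂ f g) g₁ = graft H i₁ (graft G i₂ f g₁') g' := by
  funext M a
  rw [graft_parallel_aux h j₁ j₂ f hg, graft_parallel_aux h.symm i₁ i₂ f hg', h1, h2]
  have e1 : E.root.trans (F.root.trans M) = G.root.trans (H.root.trans M) := by
    ext i; exact congrArg M (h.root_root i)
  have hne : M (H.root (G.root G.pos)) ≠ M (H.root (G.root E.pos)) := fun e =>
    h.ne (G.root.injective (H.root.injective (M.injective e))).symm
  rw [e1, h.root_root, h.root_root, Function.update_comm hne]
  simp only [hj]

end Fam

section Act

variable (P : ShuffleOperad K)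

/-- The family of the composites of an element with labelled elements. -/
noncomputable def actFam {k : ℕ+} (x : P.carrier k) : Fam P.carrier P.carrier k :=
  fun m a => act P m a x

variable {P}

theorem isFam_act {k : ℕ+} (x : P.carrier k) : IsFam K (actFam P x) where
  add m i a y z := by simp only [actFam, act_update, map_add]
  smul m i a r y := by simp only [actFam, act_update, map_smul]
  congr m a b h := act_congr m h x
  low_val m a := low_act m a x
  low_arg m a := act_low m a x

theorem order_embedding_eq_refl {n : ℕ} (e : Fin n ↪o Fin n) : e = RelEmbedding.refl _ := by
  apply (OrderEmbedding.range_inj).1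
  rw [(Finite.surjective_of_injective e.injective).range_eq]
  exact Set.range_id.symm

/-- The unit acts by a projection `low`, which the condition `low_val` absorbs. In the same way
`low_arg` is what makes `graft_one_right` true. -/
theorem graft_one_left {S : ℕ+ → Type u} [∀ k, AddCommGroup (S k)] [∀ k, Module K (S k)]
    {k : ℕ+} (E : Shuf 1 k k) (j : Tot S → Tot P.carrier) {φ : Fam S P.carrier k}
    (hφ : IsFam K φ) : graft E j (actFam P P.one) φ = φ := by
  funext m a
  have hl : E.leaf.trans m = m := by
    rw [order_embedding_eq_refl E.leaf]; rfl
  rw [graft, actFam, act_one, hl]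
  have h0 : (E.root.trans m) ⟨0, PNat.pos 1⟩ = m (E.root E.pos) :=
    congrArg (fun i => m (E.root i)) (Subsingleton.elim _ _)
  have h1 : m (E.root E.pos) = m ⟨0, k.pos⟩ := by
    rw [← h0]; exact congrArg m E.root_zero
  rw [h0, Function.update_self, h1]
  exact hφ.low_val m a

theorem graft_one_right {W : ℕ+ → Type u} [∀ k, AddCommGroup (W k)] [∀ k, Module K (W k)]
    {k : ℕ+} (E : Shuf k 1 k) {φ : Fam P.carrier W k} (hφ : IsFam K φ) :
    graft E id φ (actFam P P.one) = φ := by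
  funext m a
  have hr : E.root.trans m = m := by
    rw [order_embedding_eq_refl E.root]; rfl
  rw [graft, actFam, act_one, hr]
  have h0 : (E.leaf.trans m) ⟨0, PNat.pos 1⟩ = m (E.root E.pos) := congrArg m E.base
  rw [h0, ← hφ.low_arg, ← hφ.low_arg m a]
  refine congrArg (φ m) (funext fun q => ?_)
  rcases eq_or_ne q (m (E.root E.pos)) with rfl | h
  · simp [low_low]
  · simp [h]

theorem actFam_comp {k l n : ℕ+} (E : Shuf k l n) (x : P.carrier k) (y : P.carrier l) :
    actFam P (P.comp E x y) = graft E id (actFam P x) (actFam P y) := by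
  funext m a
  exact act_comp E m a x y

end Act

end Tot

/-! ### The coinduced bimodule of multilinear families. -/

section Coinduced

open Tot

variable {P O : ShuffleOperad K} (ι : ShuffleOperad.Hom P O)

/-- The families of functions of labelled elements of `P` with labelled elements of `O` as values,
where `P` acts on the left through `O` and on the right on the arguments. -/
noncomputable def famBimodule : Bimodule P where
  carrier k := famSpace K P.carrier O.carrier k
  lact {k l n} E := LinearMap.mk₂ K
    (fun x φ => ⟨graft E (map ι.map) (actFam O (ι.map k x)) φ.1, (isFam_act _).graft E (fun p x => low_map p _ x) φ.2⟩)
    (fun x x' φ => by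
      ext1; funext m a
      simp only [graft, actFam, map_add]; rfl)
    (fun r x φ => by
      ext1; funext m a
      simp only [graft, actFam, map_smul]; rfl)
    (fun x φ ψ => by
      ext1; funext m a
      exact (isFam_act _).add (E.root.trans m) E.pos _ _ _)
    (fun r x φ => by
      ext1; funext m a
      exact (isFam_act _).smul (E.root.trans m) E.pos _ _ _)
  ract {k l n} E := LinearMap.mk₂ K
    (fun φ y => ⟨graft E LinearMap.id φ.1 (actFam P y),
      φ.2.graft E (fun _ _ => rfl) (isFam_act y)⟩)
    (fun φ ψ y => rfl)
    (fun r φ y => rfl)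
    (fun φ y y' => by
      ext1; funext m a
      simp only [graft, actFam, map_add]
      exact φ.2.add (E.root.trans m) E.pos _ _ _)
    (fun r φ y => by
      ext1; funext m a
      simp only [graft, actFam, map_smul]
      exact φ.2.smul (E.root.trans m) E.pos _ _ _)
  one_lact {k} E φ := by
    ext1
    change graft E (map ι.map) (actFam O (ι.map 1 P.one)) φ.1 = φ.1
    rw [ι.map_one]
    exact graft_one_left E _ φ.2
  ract_one {k} E φ := by
    ext1
    exact graft_one_right E φ.2
  nested_left h x y φ := by
    ext1
    change graft _ (map ι.map) (actFam O (ι.map _ (P.comp _ x y))) φ.1 =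
      graft _ (map ι.map) (actFam O (ι.map _ x)) (graft _ (map ι.map) (actFam O (ι.map _ y)) φ.1)
    rw [ι.map_comp, actFam_comp]
    exact graft_nested h (fun _ => rfl) (isFam_act _) _ _
  nested_mid h x φ y := by
    ext1
    exact graft_nested h (fun _ => rfl) (isFam_act _) φ.1 _
  nested_right h φ x y := by
    ext1
    change _ = graft _ LinearMap.id φ.1 (actFam P (P.comp _ x y))
    rw [actFam_comp]
    exact graft_nested h (fun _ => rfl) φ.2 _ _
  parallel_root h φ x y := by
    ext1
    exact graft_parallel h (fun _ => rfl) φ.1 (isFam_act x) (isFam_act y) (fun _ _ => rfl)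
      (fun _ _ => rfl)
  parallel_leaf {k l m n n' N} {E F G H} h x φ y := by
    ext1
    change graft F LinearMap.id (graft E (map ι.map) (actFam O (ι.map _ x)) φ.1) (actFam P y) =
      graft H (map ι.map) (actFam O (ι.map _ (P.comp G x y))) φ.1
    rw [ι.map_comp, actFam_comp]
    have hφ : IsFam K φ.1 := φ.2
    -- Acting by `y` on arguments in `P` and then including in `O` equals acting by `ι y` on the
    -- included arguments; this is `map_act`.
    exact graft_parallel h (j₁ := id) (j₂ := map ι.map) (i₁ := map ι.map) (i₂ := id) (g := φ.1) (g' := φ.1)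
      (fun _ => rfl) _ hφ (isFam_act _) (fun M a => map_act ι M a y) (fun _ _ => rfl)

end Coinduced
end ShuffleOp

namespace ShuffleOp

variable {K : Type u} [Field K]

/-! ### Free bimodules and semidirect products -/

namespace freeBimodule

variable {P : ShuffleOperad K} {Y : ℕ+ → Type u}

theorem induction {motive : ∀ k, (freeBimodule P Y).carrier k → Prop}
    (gen : ∀ k (y : Y k), motive k (gen P y))
    (lact : ∀ {k l n : ℕ+} (E : Shuf k l n) (x : P.carrier k) a, motive l a →
      motive n ((freeBimodule P Y).lact E x a))
    (ract : ∀ {k l n : ℕ+} (E : Shuf k l n) a (y : P.carrier l), motive k a →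
      motive n ((freeBimodule P Y).ract E a y))
    (zero : ∀ k, motive k 0)
    (add : ∀ k a b, motive k a → motive k b → motive k (a + b))
    (smul : ∀ k (r : K) a, motive k a → motive k (r • a)) {k : ℕ+}
    (a : (freeBimodule P Y).carrier k) : motive k a := by
  obtain ⟨a, rfl⟩ := (BiExpr.cong P Y k).cls_surjective a
  induction a with
  | gen y => exact gen _ y
  | lact E x a ih => exact lact E x _ ih
  | ract E a y ih => exact ract E _ y ih
  | zero => exact zero _
  | add a b iha ihb => exact add _ _ _ iha ihb
  | smul r a ih => exact smul _ r _ ih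

theorem hom_ext {B : Bimodule P} {f g : Bimodule.Hom (freeBimodule P Y) B}
    (h : ∀ k (y : Y k), f.map k (gen P y) = g.map k (gen P y)) {k : ℕ+}
    (a : (freeBimodule P Y).carrier k) : f.map k a = g.map k a := by
  induction a using induction with
  | gen k y => exact h k y
  | lact E x a ih => rw [f.map_lact, g.map_lact, ih]
  | ract E a y ih => rw [f.map_ract, g.map_ract, ih]
  | zero => rw [map_zero, map_zero]
  | add k a b iha ihb => rw [map_add, map_add, iha, ihb]
  | smul k r a ih => rw [map_smul, map_smul, ih]

theorem isFree (P : ShuffleOperad K) (Y : ℕ+ → Type u) : (freeBimodule P Y).IsFree := by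
  refine ⟨Y, fun _ y => gen P y, fun k => ?_⟩
  have h : ∀ a, (lift (B := freeBimodule P Y) (fun _ y => gen P y)).map k a = a := fun a =>
    hom_ext (f := lift (B := freeBimodule P Y) (fun _ y => gen P y))
      (g := ⟨fun _ => LinearMap.id, fun _ _ _ => rfl, fun _ _ _ => rfl⟩) (fun _ _ => rfl) a
  exact ⟨fun a b hab => by rw [← h a, ← h b, hab], fun a => ⟨a, h a⟩⟩

end freeBimodule

namespace ShuffleOperad

/-- The composite of morphisms of operads. -/
def Hom.comp {P Q R : ShuffleOperad K} (g : Hom Q R) (f : Hom P Q) : Hom P R where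
  map k := g.map k ∘ₗ f.map k
  map_one := by rw [LinearMap.comp_apply, f.map_one, g.map_one]
  map_comp E x y := by simp only [LinearMap.comp_apply, f.map_comp, g.map_comp]

/-- The identity of an operad. -/
def Hom.id (P : ShuffleOperad K) : Hom P P where
  map _ := LinearMap.id
  map_one := rfl
  map_comp _ _ _ := rfl

/-- The square-zero extension of `F` by a bimodule over `P`, for a morphism from `F` to `P`. -/
def semidirect {F P : ShuffleOperad K} (π : Hom F P) (M : Bimodule P) : ShuffleOperad K where
  carrier k := F.carrier k × M.carrier k
  one := (F.one, 0)
  comp E := LinearMap.mk₂ K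
    (fun x y => (F.comp E x.1 y.1, M.ract E x.2 (π.map _ y.1) + M.lact E (π.map _ x.1) y.2))
    (fun x x' y => by
      ext <;> simp only [Prod.fst_add, Prod.snd_add, map_add, LinearMap.add_apply]
      abel)
    (fun r x y => by
      ext <;> simp only [Prod.smul_fst, Prod.smul_snd, map_smul, LinearMap.smul_apply, smul_add])
    (fun x y y' => by
      ext <;> simp only [Prod.fst_add, Prod.snd_add, map_add]
      abel)
    (fun r x y => by
      ext <;> simp only [Prod.smul_fst, Prod.smul_snd, map_smul, smul_add])
  comp_one E x := by
    simp only [LinearMap.mk₂_apply, F.comp_one, π.map_one, M.ract_one, map_zero, add_zero]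
  one_comp E x := by
    simp only [LinearMap.mk₂_apply, F.one_comp, π.map_one, M.one_lact, map_zero,
      LinearMap.zero_apply, zero_add]
  nested h x y z := by
    simp only [LinearMap.mk₂_apply, F.nested h, π.map_comp, map_add, LinearMap.add_apply]
    rw [M.nested_right h, M.nested_mid h, M.nested_left h, add_assoc]
  parallel h x y z := by
    simp only [LinearMap.mk₂_apply, F.parallel h, π.map_comp, map_add, LinearMap.add_apply]
    rw [M.parallel_root h, M.parallel_leaf h, ← M.parallel_leaf h.symm, add_assoc,
      add_assoc, add_comm (M.lact _ _ _)]

/-- The inclusion of an operad into a square-zero extension. -/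
def semidirectInl {F P : ShuffleOperad K} (π : Hom F P) (M : Bimodule P) :
    Hom F (semidirect π M) where
  map k := LinearMap.inl K (F.carrier k) (M.carrier k)
  map_one := rfl
  map_comp E x y := by
    refine Prod.ext rfl ?_
    change (0 : M.carrier _) = M.ract E 0 _ + M.lact E _ 0
    rw [map_zero, map_zero, LinearMap.zero_apply, add_zero]

/-- The projection of a square-zero extension. -/
def semidirectFst {F P : ShuffleOperad K} (π : Hom F P) (M : Bimodule P) :
    Hom (semidirect π M) F where
  map k := LinearMap.fst K (F.carrier k) (M.carrier k)
  map_one := rfl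
  map_comp _ _ _ := rfl

/-- The morphism of square-zero extensions induced by a morphism of operads. -/
def semidirectMap {F P : ShuffleOperad K} (π : Hom F P) (M : Bimodule P) :
    Hom (semidirect π M) (semidirect (Hom.id P) M) where
  map k := LinearMap.prodMap (π.map k) LinearMap.id
  map_one := Prod.ext π.map_one rfl
  map_comp E x y := Prod.ext (π.map_comp E x.1 y.1) rfl

end ShuffleOperad

/-! ### Iterated sources, targets and identities -/

namespace Polygraph

open CellExpr ShuffleOperad

variable (X : Polygraph K)

theorem cell_surjective {n : ℕ} {k : ℕ+} (c : (X.cells n).carrier k) :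
    ∃ a : CellExpr K X.gens n k, X.cell a = c :=
  (cong X.s X.t n k).cls_surjective c

/-- Since the dimension is a variable, identities are described by a heterogeneous equality; the
versions for dimension `0` and for successors remove it. -/
theorem cells_induction {n : ℕ} {motive : ∀ k, (X.cells n).carrier k → Prop}
    (gen : ∀ k (x : X.gens n k), motive k (X.cell (gen x)))
    (ident : ∀ k (a : CellExpr K X.gens n k) (n' : ℕ) (_ : n = n' + 1)
      (c : CellExpr K X.gens n' k), HEq a (ident c) → motive k (X.cell a))
    (one : motive 1 (X.cells n).one)
    (comp : ∀ {k l m : ℕ+} (E : Shuf k l m) a b, motive k a → motive l b →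
      motive m ((X.cells n).comp E a b))
    (zero : ∀ k, motive k 0)
    (add : ∀ k a b, motive k a → motive k b → motive k (a + b))
    (smul : ∀ k (r : K) a, motive k a → motive k (r • a)) {k : ℕ+}
    (c : (X.cells n).carrier k) : motive k c := by
  obtain ⟨a, rfl⟩ := X.cell_surjective c
  induction a with
  | gen x => exact gen _ x
  | ident a _ => exact ident _ _ _ rfl a HEq.rfl
  | one => exact one
  | comp E a b iha ihb =>
    exact comp E _ _ (iha gen ident one comp zero add smul) (ihb gen ident one comp zero add smul)
  | zero => exact zero _
  | add a b iha ihb =>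
    exact add _ _ _ (iha gen ident one comp zero add smul) (ihb gen ident one comp zero add smul)
  | smul r a ih => exact smul _ r _ (ih gen ident one comp zero add smul)

theorem cells_zero_induction {motive : ∀ k, (X.cells 0).carrier k → Prop}
    (gen : ∀ k (x : X.gens 0 k), motive k (X.cell (gen x)))
    (one : motive 1 (X.cells 0).one)
    (comp : ∀ {k l m : ℕ+} (E : Shuf k l m) a b, motive k a → motive l b →
      motive m ((X.cells 0).comp E a b))
    (zero : ∀ k, motive k 0)
    (add : ∀ k a b, motive k a → motive k b → motive k (a + b))
    (smul : ∀ k (r : K) a, motive k a → motive k (r • a)) {k : ℕ+}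
    (c : (X.cells 0).carrier k) : motive k c :=
  X.cells_induction gen (fun _ _ _ h => absurd h (by omega)) one comp zero add smul c

/-- The identities of `n`-cells. -/
def identHom (n : ℕ) : Hom (X.cells n) (X.cells (n + 1)) where
  map k := (cong X.s X.t n k).lift (fun a => X.cell (ident a))
    (fun a b => LinearCongruence.sound _ (Rel.ident_add a b))
    (fun r a => LinearCongruence.sound _ (Rel.ident_smul r a))
    (fun h => LinearCongruence.sound _ (Rel.ident_congr h))
  map_one := LinearCongruence.sound _ Rel.ident_one
  map_comp E := by
    rintro ⟨a⟩ ⟨b⟩; exact LinearCongruence.sound _ (Rel.ident_comp E a b)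

theorem cells_succ_induction {n : ℕ} {motive : ∀ k, (X.cells (n + 1)).carrier k → Prop}
    (gen : ∀ k (x : X.gens (n + 1) k), motive k (X.cell (gen x)))
    (ident : ∀ k (c : (X.cells n).carrier k), motive k ((X.identHom n).map k c))
    (one : motive 1 (X.cells (n + 1)).one)
    (comp : ∀ {k l m : ℕ+} (E : Shuf k l m) a b, motive k a → motive l b →
      motive m ((X.cells (n + 1)).comp E a b))
    (zero : ∀ k, motive k 0)
    (add : ∀ k a b, motive k a → motive k b → motive k (a + b))
    (smul : ∀ k (r : K) a, motive k a → motive k (r • a)) {k : ℕ+}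
    (c : (X.cells (n + 1)).carrier k) : motive k c := by
  refine X.cells_induction gen ?_ one comp zero add smul c
  intro k a n' h c hc
  obtain rfl : n = n' := by omega
  obtain rfl := eq_of_heq hc
  exact ident k (X.cell c)

theorem src_ident {n : ℕ} {k : ℕ+} (c : (X.cells n).carrier k) :
    (X.src n).map k ((X.identHom n).map k c) = c := by
  obtain ⟨a, rfl⟩ := X.cell_surjective c
  rfl

theorem tgt_ident {n : ℕ} {k : ℕ+} (c : (X.cells n).carrier k) :
    (X.tgt n).map k ((X.identHom n).map k c) = c := by
  obtain ⟨a, rfl⟩ := X.cell_surjective c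
  rfl

theorem src_src {n : ℕ} {k : ℕ+} (c : (X.cells (n + 2)).carrier k) :
    (X.src n).map k ((X.src (n + 1)).map k c) = (X.src n).map k ((X.tgt (n + 1)).map k c) := by
  obtain ⟨a, rfl⟩ := X.cell_surjective c
  exact LinearCongruence.sound _ (X.globular _ X.ss a)

theorem tgt_src {n : ℕ} {k : ℕ+} (c : (X.cells (n + 2)).carrier k) :
    (X.tgt n).map k ((X.src (n + 1)).map k c) = (X.tgt n).map k ((X.tgt (n + 1)).map k c) := by
  obtain ⟨a, rfl⟩ := X.cell_surjective c
  exact LinearCongruence.sound _ (X.globular _ X.tt a)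

/-- The iterated source in dimension `0`. -/
def srcIter : ∀ n, Hom (X.cells n) (X.cells 0)
  | 0 => Hom.id _
  | n + 1 => (srcIter n).comp (X.src n)

/-- The iterated target in dimension `0`. -/
def tgtIter : ∀ n, Hom (X.cells n) (X.cells 0)
  | 0 => Hom.id _
  | n + 1 => (tgtIter n).comp (X.tgt n)

/-- The iterated identities of `0`-cells. -/
def identIterHom : ∀ n, Hom (X.cells 0) (X.cells n)
  | 0 => Hom.id _
  | n + 1 => (X.identHom n).comp (identIterHom n)

theorem srcIter_succ_tgt (n : ℕ) {k : ℕ+} (c : (X.cells (n + 2)).carrier k) :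
    (X.srcIter (n + 1)).map k ((X.tgt (n + 1)).map k c) = (X.srcIter (n + 2)).map k c := by
  change (X.srcIter n).map k ((X.src n).map k _) = (X.srcIter n).map k ((X.src n).map k _)
  rw [src_src]

theorem srcIter_identIter (n : ℕ) {k : ℕ+} (c : (X.cells 0).carrier k) :
    (X.srcIter n).map k ((X.identIterHom n).map k c) = c := by
  induction n with
  | zero => rfl
  | succ n ih =>
    change (X.srcIter n).map k ((X.src n).map k ((X.identHom n).map k _)) = c
    rw [src_ident, ih]

theorem tgtIter_identIter (n : ℕ) {k : ℕ+} (c : (X.cells 0).carrier k) :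
    (X.tgtIter n).map k ((X.identIterHom n).map k c) = c := by
  induction n with
  | zero => rfl
  | succ n ih =>
    change (X.tgtIter n).map k ((X.tgt n).map k ((X.identHom n).map k _)) = c
    rw [tgt_ident, ih]

/-! ### The exchange relations -/

theorem cell_identIter (d : ℕ) {k : ℕ+} (a : CellExpr K X.gens 0 k) :
    X.cell (identIter d a) = (X.identIterHom (0 + d)).map k (X.cell a) := by
  induction d with
  | zero => rfl
  | succ d ih => exact congrArg ((X.identHom (0 + d)).map k) ih

theorem cell_bdIter_src (d : ℕ) {k : ℕ+} (a : CellExpr K X.gens (0 + d) k) :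
    X.cell (bdIter X.s d a) = (X.srcIter (0 + d)).map k (X.cell a) := by
  induction d with
  | zero => rfl
  | succ d ih => exact ih (bd X.s a)

theorem cell_bdIter_tgt (d : ℕ) {k : ℕ+} (a : CellExpr K X.gens (0 + d) k) :
    X.cell (bdIter X.t d a) = (X.tgtIter (0 + d)).map k (X.cell a) := by
  induction d with
  | zero => rfl
  | succ d ih => exact ih (bd X.t a)

theorem cell_star (d : ℕ) {k : ℕ+} (a b : CellExpr K X.gens (0 + d) k) :
    X.cell (star X.t d a b) = X.cell a -
      (X.identIterHom (0 + d)).map k ((X.tgtIter (0 + d)).map k (X.cell a)) + X.cell b := by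
  rw [← cell_bdIter_tgt, ← cell_identIter, sub_eq_add_neg, ← neg_one_smul K]
  rfl

theorem exchange (n : ℕ) {k l m : ℕ+} (E : Shuf k l m) {a b : (X.cells n).carrier k}
    {a' b' : (X.cells n).carrier l} (h : (X.tgtIter n).map k a = (X.srcIter n).map k b)
    (h' : (X.tgtIter n).map l a' = (X.srcIter n).map l b') :
    (X.cells n).comp E (a - (X.identIterHom n).map k ((X.tgtIter n).map k a) + b)
        (a' - (X.identIterHom n).map l ((X.tgtIter n).map l a') + b') =
      (X.cells n).comp E a a' - (X.identIterHom n).map m ((X.tgtIter n).map m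
        ((X.cells n).comp E a a')) + (X.cells n).comp E b b' := by
  cases n with
  | zero =>
    -- In dimension `0` source, target and identities are all the identity map, and the relation is
    -- trivial.
    change (X.cells 0).comp E (a - a + b) (a' - a' + b') =
      (X.cells 0).comp E a a' - (X.cells 0).comp E a a' + (X.cells 0).comp E b b'
    simp only [sub_self, zero_add]
  | succ n =>
    obtain ⟨d, rfl⟩ : ∃ d, n = 0 + d := ⟨n, (Nat.zero_add n).symm⟩
    obtain ⟨a, rfl⟩ := X.cell_surjective a
    obtain ⟨b, rfl⟩ := X.cell_surjective b
    obtain ⟨a', rfl⟩ := X.cell_surjective a'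
    obtain ⟨b', rfl⟩ := X.cell_surjective b'
    have e : ∀ {k : ℕ+} (a b : CellExpr K X.gens (0 + (d + 1)) k),
        (X.tgtIter (0 + (d + 1))).map k (X.cell a) = (X.srcIter (0 + (d + 1))).map k (X.cell b) →
        X.Eqv (bdIter X.t (d + 1) a) (bdIter X.s (d + 1) b) := by
      intro k a b h
      rw [← cell_bdIter_tgt, ← cell_bdIter_src] at h
      exact (cong X.s X.t 0 k).exact h
    have key := LinearCongruence.sound (cong X.s X.t _ _)
      (Rel.exchange d E a b a' b' (e a b h) (e a' b' h'))
    have s1 := X.cell_star (d + 1) a b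
    have s2 := X.cell_star (d + 1) a' b'
    have s3 := X.cell_star (d + 1) (CellExpr.comp E a a') (CellExpr.comp E b b')
    have key' : (X.cells _).comp E (X.cell (star X.t (d + 1) a b))
      (X.cell (star X.t (d + 1) a' b')) = X.cell (star X.t (d + 1) (CellExpr.comp E a a')
        (CellExpr.comp E b b')) := key
    rw [s1, s2, s3] at key'
    exact key'

/-- The linear form of exchange. Applied to the 0-composable pairs `(a, 1_{t(a)})` and `(1_{s(b)},
b)`, exchange expands `a ∘ b` by moving along `a` first and along `b` second; `comp_sub_src_sub_tgt`
comes from the other order. -/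
theorem comp_sub_tgt_sub_src (n : ℕ) {k l m : ℕ+} (E : Shuf k l m) (a : (X.cells n).carrier k)
    (b : (X.cells n).carrier l) :
    (X.cells n).comp E (a - (X.identIterHom n).map k ((X.tgtIter n).map k a))
      (b - (X.identIterHom n).map l ((X.srcIter n).map l b)) = 0 := by
  have h := X.exchange n E (a := a) (b := (X.identIterHom n).map k ((X.tgtIter n).map k a))
    (a' := (X.identIterHom n).map l ((X.srcIter n).map l b)) (b' := b)
    (X.srcIter_identIter n _).symm (X.tgtIter_identIter n _)
  rw [Hom.map_comp, Hom.map_comp, tgtIter_identIter, sub_add_cancel, sub_self, zero_add] at h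
  simp only [map_sub, LinearMap.sub_apply]
  rw [h]
  abel

theorem comp_sub_src_sub_tgt (n : ℕ) {k l m : ℕ+} (E : Shuf k l m) (a : (X.cells n).carrier k)
    (b : (X.cells n).carrier l) :
    (X.cells n).comp E (a - (X.identIterHom n).map k ((X.srcIter n).map k a))
      (b - (X.identIterHom n).map l ((X.tgtIter n).map l b)) = 0 := by
  have h := X.exchange n E (a := (X.identIterHom n).map k ((X.srcIter n).map k a)) (b := a)
    (a' := b) (b' := (X.identIterHom n).map l ((X.tgtIter n).map l b))
    (X.tgtIter_identIter n _) (X.srcIter_identIter n _).symm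
  rw [Hom.map_comp, Hom.map_comp, tgtIter_identIter, sub_add_cancel, sub_self, zero_add] at h
  simp only [map_sub, LinearMap.sub_apply]
  rw [h]
  abel

end Polygraph
end ShuffleOp

/-! ### The presented operad, the bracket as a derivation, and the bimodule of null cells. -/

namespace ShuffleOp

variable {K : Type u} [Field K]

namespace Polygraph

open CellExpr ShuffleOperad

variable (X : Polygraph K)

/-! ### The presented operad -/

theorem proj_surjective (k : ℕ+) : Function.Surjective (X.proj.map k) :=
  Submodule.mkQ_surjective _

theorem proj_src {k : ℕ+} (c : (X.cells 1).carrier k) :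
    X.proj.map k ((X.src 0).map k c) = X.proj.map k ((X.tgt 0).map k c) :=
  coequalizer_condition (X.src 0) (X.tgt 0) k c

/-- The boundaries `s(c) - t(c)` already form an ideal, because a 1-cell can be composed with the
identities of 0-cells. -/
theorem exists_of_proj_eq_zero {k : ℕ+} {u : (X.cells 0).carrier k} (h : X.proj.map k u = 0) :
    ∃ c : (X.cells 1).carrier k, (X.src 0).map k c - (X.tgt 0).map k c = u := by
  have h' : (X.cells 0).IdealMem (eqRel (X.src 0) (X.tgt 0)) u :=
    (Submodule.Quotient.mk_eq_zero ((X.cells 0).ideal (eqRel (X.src 0) (X.tgt 0)) k)).1 h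
  clear h
  induction h' with
  | of h =>
    obtain ⟨c, rfl⟩ := h
    exact ⟨c, rfl⟩
  | zero => exact ⟨0, by rw [map_zero, map_zero, sub_zero]⟩
  | add _ _ ih ih' =>
    obtain ⟨c, rfl⟩ := ih
    obtain ⟨c', rfl⟩ := ih'
    exact ⟨c + c', by rw [map_add, map_add]; abel⟩
  | smul r _ ih =>
    obtain ⟨c, rfl⟩ := ih
    exact ⟨r • c, by rw [map_smul, map_smul, smul_sub]⟩
  | left E x _ ih =>
    obtain ⟨c, rfl⟩ := ih
    refine ⟨(X.cells 1).comp E ((X.identHom 0).map _ x) c, ?_⟩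
    rw [Hom.map_comp, Hom.map_comp, src_ident, tgt_ident, map_sub]
  | right E y _ ih =>
    obtain ⟨c, rfl⟩ := ih
    refine ⟨(X.cells 1).comp E c ((X.identHom 0).map _ y), ?_⟩
    rw [Hom.map_comp, Hom.map_comp, src_ident, tgt_ident, map_sub, LinearMap.sub_apply]

/-- The projection of `n`-cells onto the presented operad. -/
def barHom (n : ℕ) : Hom (X.cells n) X.presented := X.proj.comp (X.srcIter n)

theorem barHom_cell {n : ℕ} {k : ℕ+} (a : CellExpr K X.gens n k) :
    (X.barHom n).map k (X.cell a) = X.bar a := by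
  induction n with
  | zero => rfl
  | succ n ih => exact ih (bd X.s a)

theorem barHom_src {n : ℕ} {k : ℕ+} (c : (X.cells (n + 1)).carrier k) :
    (X.barHom n).map k ((X.src n).map k c) = (X.barHom (n + 1)).map k c := rfl

theorem barHom_tgt {n : ℕ} {k : ℕ+} (c : (X.cells (n + 1)).carrier k) :
    (X.barHom n).map k ((X.tgt n).map k c) = (X.barHom (n + 1)).map k c := by
  obtain ⟨a, rfl⟩ := X.cell_surjective c
  refine (X.barHom_cell (bd X.t a)).trans ?_
  rw [X.bar_tgt, ← barHom_cell]
  rfl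

theorem barHom_identIter (n : ℕ) {k : ℕ+} (c : (X.cells 0).carrier k) :
    (X.barHom n).map k ((X.identIterHom n).map k c) = X.proj.map k c :=
  congrArg (X.proj.map k) (X.srcIter_identIter n c)

/-! ### Brackets -/

theorem bracket_comp {n : ℕ} {k l m : ℕ+} (E : Shuf k l m) (a : (X.cells n).carrier k)
    (b : (X.cells n).carrier l) :
    X.bracket n m ((X.cells n).comp E a b) =
      (freeBimodule X.presented (X.gens n)).ract E (X.bracket n k a) ((X.barHom n).map l b) +
        (freeBimodule X.presented (X.gens n)).lact E ((X.barHom n).map k a)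
          (X.bracket n l b) := by
  obtain ⟨a, rfl⟩ := X.cell_surjective a
  obtain ⟨b, rfl⟩ := X.cell_surjective b
  rw [barHom_cell, barHom_cell]
  rfl

theorem bracket_one (n : ℕ) : X.bracket n 1 (X.cells n).one = 0 := rfl

theorem bracket_ident {n : ℕ} {k : ℕ+} (c : (X.cells n).carrier k) :
    X.bracket (n + 1) k ((X.identHom n).map k c) = 0 := by
  obtain ⟨a, rfl⟩ := X.cell_surjective c
  rfl

theorem bracket_identIter (n : ℕ) {k : ℕ+} (c : (X.cells 0).carrier k) :
    X.bracket (n + 1) k ((X.identIterHom (n + 1)).map k c) = 0 := X.bracket_ident _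

/-- The boundary morphism between the free bimodules on generators of positive chain degree. -/
def bracketBoundary (n : ℕ) : Bimodule.Hom (freeBimodule X.presented (X.gens (n + 1)))
    (freeBimodule X.presented (X.gens n)) := X.boundary (n + 1)

/-- Both sides are derivations along the same projection to `P`, since the source and the target of
a cell have the same image there. They agree on generators and vanish on identities. -/
theorem bracketBoundary_bracket {n : ℕ} {k : ℕ+} (c : (X.cells (n + 1)).carrier k) :
    (X.bracketBoundary n).map k (X.bracket (n + 1) k c) =
      X.bracket n k ((X.src n).map k c) - X.bracket n k ((X.tgt n).map k c) := by
  induction c using X.cells_succ_induction with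
  | gen k x => rfl
  | ident k c => rw [bracket_ident, map_zero, src_ident, tgt_ident, sub_self]
  | one => rw [bracket_one, map_zero, Hom.map_one, Hom.map_one, sub_self]
  | comp E a b iha ihb =>
    rw [bracket_comp, map_add, Bimodule.Hom.map_lact, Bimodule.Hom.map_ract, iha, ihb,
      Hom.map_comp, Hom.map_comp, bracket_comp, bracket_comp, barHom_src, barHom_src,
      barHom_tgt, barHom_tgt, map_sub, map_sub, LinearMap.sub_apply]
    abel
  | zero k => simp only [map_zero, sub_zero]
  | add k a b iha ihb => simp only [map_add, iha, ihb]; abel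
  | smul k r a ih => simp only [map_smul, ih, smul_sub]

/-- The coefficients in `P` of a chain are represented by 0-cells. Subtracting the identity of the
target then normalizes the target without changing the bracket. -/
theorem exists_bracket_eq (n : ℕ) {k : ℕ+}
    (a : (freeBimodule X.presented (X.gens (n + 1))).carrier k) :
    ∃ c : (X.cells (n + 1)).carrier k, X.bracket (n + 1) k c = a ∧ (X.tgt n).map k c = 0 := by
  have key : ∃ c : (X.cells (n + 1)).carrier k, X.bracket (n + 1) k c = a := by
    induction a using freeBimodule.induction with
    | gen k x => exact ⟨X.cell (gen x), rfl⟩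
    | lact E x a ih =>
      obtain ⟨c, rfl⟩ := ih
      obtain ⟨u, rfl⟩ := X.proj_surjective _ x
      refine ⟨(X.cells _).comp E ((X.identIterHom (n + 1)).map _ u) c, ?_⟩
      rw [bracket_comp, bracket_identIter, barHom_identIter, map_zero, LinearMap.zero_apply,
        zero_add]
    | ract E a y ih =>
      obtain ⟨c, rfl⟩ := ih
      obtain ⟨u, rfl⟩ := X.proj_surjective _ y
      refine ⟨(X.cells _).comp E c ((X.identIterHom (n + 1)).map _ u), ?_⟩
      rw [bracket_comp, bracket_identIter, barHom_identIter, map_zero, add_zero]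
    | zero k => exact ⟨0, map_zero _⟩
    | add k a b iha ihb =>
      obtain ⟨c, rfl⟩ := iha
      obtain ⟨c', rfl⟩ := ihb
      exact ⟨c + c', map_add _ _ _⟩
    | smul k r a ih =>
      obtain ⟨c, rfl⟩ := ih
      exact ⟨r • c, map_smul _ _ _⟩
  obtain ⟨c, hc⟩ := key
  refine ⟨c - (X.identHom n).map k ((X.tgt n).map k c), ?_, ?_⟩
  · rw [map_sub, bracket_ident, sub_zero, hc]
  · rw [map_sub, tgt_ident, sub_self]

/-! ### Cells with trivial boundary in dimension zero -/

/-- The identities of `1`-cells in dimension `n + 1`. -/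
def identIterHom₁ : ∀ n, Hom (X.cells 1) (X.cells (n + 1))
  | 0 => Hom.id _
  | n + 1 => (X.identHom (n + 1)).comp (identIterHom₁ n)

theorem srcIter_identIter₁ (n : ℕ) {k : ℕ+} (c : (X.cells 1).carrier k) :
    (X.srcIter (n + 1)).map k ((X.identIterHom₁ n).map k c) = (X.src 0).map k c := by
  induction n with
  | zero => rfl
  | succ n ih =>
    change (X.srcIter (n + 1)).map k ((X.src (n + 1)).map k ((X.identHom (n + 1)).map k _)) = _
    rw [src_ident, ih]

theorem tgtIter_identIter₁ (n : ℕ) {k : ℕ+} (c : (X.cells 1).carrier k) :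
    (X.tgtIter (n + 1)).map k ((X.identIterHom₁ n).map k c) = (X.tgt 0).map k c := by
  induction n with
  | zero => rfl
  | succ n ih =>
    change (X.tgtIter (n + 1)).map k ((X.tgt (n + 1)).map k ((X.identHom (n + 1)).map k _)) = _
    rw [tgt_ident, ih]

/-- The cells whose source and target in dimension `0` vanish. -/
def nullCells (n : ℕ) (k : ℕ+) : Submodule K ((X.cells n).carrier k) :=
  LinearMap.ker ((X.srcIter n).map k) ⊓ LinearMap.ker ((X.tgtIter n).map k)

variable {X}

/-- For a null `z` the corrections in the exchange relations disappear: `z ∘ b` depends on `b` only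
through its source in dimension `0`, and equally only through its target. -/
theorem comp_null {n : ℕ} {k l m : ℕ+} (E : Shuf k l m) {z : (X.cells n).carrier k}
    (hz : z ∈ X.nullCells n k) (b : (X.cells n).carrier l) :
    (X.cells n).comp E z b =
      (X.cells n).comp E z ((X.identIterHom n).map l ((X.srcIter n).map l b)) := by
  have h := X.comp_sub_tgt_sub_src n E z b
  rw [hz.2, map_zero, sub_zero, map_sub, sub_eq_zero] at h
  exact h

theorem comp_null' {n : ℕ} {k l m : ℕ+} (E : Shuf k l m) {z : (X.cells n).carrier k}
    (hz : z ∈ X.nullCells n k) (b : (X.cells n).carrier l) :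
    (X.cells n).comp E z b =
      (X.cells n).comp E z ((X.identIterHom n).map l ((X.tgtIter n).map l b)) := by
  have h := X.comp_sub_src_sub_tgt n E z b
  rw [hz.1, map_zero, sub_zero, map_sub, sub_eq_zero] at h
  exact h

theorem null_comp {n : ℕ} {k l m : ℕ+} (E : Shuf k l m) (b : (X.cells n).carrier k)
    {z : (X.cells n).carrier l} (hz : z ∈ X.nullCells n l) :
    (X.cells n).comp E b z =
      (X.cells n).comp E ((X.identIterHom n).map k ((X.srcIter n).map k b)) z := by
  have h := X.comp_sub_src_sub_tgt n E b z
  rw [hz.2, map_zero, sub_zero, map_sub, LinearMap.sub_apply, sub_eq_zero] at h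
  exact h

theorem null_comp' {n : ℕ} {k l m : ℕ+} (E : Shuf k l m) (b : (X.cells n).carrier k)
    {z : (X.cells n).carrier l} (hz : z ∈ X.nullCells n l) :
    (X.cells n).comp E b z =
      (X.cells n).comp E ((X.identIterHom n).map k ((X.tgtIter n).map k b)) z := by
  have h := X.comp_sub_tgt_sub_src n E b z
  rw [hz.1, map_zero, sub_zero, map_sub, LinearMap.sub_apply, sub_eq_zero] at h
  exact h

/-- A 1-cell `c`, seen as an iterated identity, gives the same composite with `z` through its source
and through its target. Hence the action of 0-cells on null cells descends to `P`. -/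
theorem comp_null_of_proj_eq_zero {n : ℕ} {k l m : ℕ+} (E : Shuf k l m)
    {z : (X.cells (n + 1)).carrier k} (hz : z ∈ X.nullCells (n + 1) k)
    {u : (X.cells 0).carrier l} (hu : X.proj.map l u = 0) :
    (X.cells (n + 1)).comp E z ((X.identIterHom (n + 1)).map l u) = 0 := by
  obtain ⟨c, rfl⟩ := X.exists_of_proj_eq_zero hu
  rw [← X.srcIter_identIter₁ n, ← X.tgtIter_identIter₁ n, map_sub, map_sub, ← comp_null E hz,
    ← comp_null' E hz, sub_self]

theorem null_comp_of_proj_eq_zero {n : ℕ} {k l m : ℕ+} (E : Shuf k l m)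
    {z : (X.cells (n + 1)).carrier l} (hz : z ∈ X.nullCells (n + 1) l)
    {u : (X.cells 0).carrier k} (hu : X.proj.map k u = 0) :
    (X.cells (n + 1)).comp E ((X.identIterHom (n + 1)).map k u) z = 0 := by
  obtain ⟨c, rfl⟩ := X.exists_of_proj_eq_zero hu
  rw [← X.srcIter_identIter₁ n, ← X.tgtIter_identIter₁ n, map_sub, map_sub, LinearMap.sub_apply,
    ← null_comp E _ hz, ← null_comp' E _ hz, sub_self]

theorem comp_mem_nullCells_left {n : ℕ} {k l m : ℕ+} (E : Shuf k l m)
    {z : (X.cells n).carrier k} (hz : z ∈ X.nullCells n k) (b : (X.cells n).carrier l) :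
    (X.cells n).comp E z b ∈ X.nullCells n m := by
  constructor <;> refine LinearMap.mem_ker.2 ?_
  · rw [Hom.map_comp, hz.1, map_zero, LinearMap.zero_apply]
  · rw [Hom.map_comp, hz.2, map_zero, LinearMap.zero_apply]

theorem comp_mem_nullCells_right {n : ℕ} {k l m : ℕ+} (E : Shuf k l m)
    (b : (X.cells n).carrier k) {z : (X.cells n).carrier l} (hz : z ∈ X.nullCells n l) :
    (X.cells n).comp E b z ∈ X.nullCells n m := by
  constructor <;> refine LinearMap.mem_ker.2 ?_
  · rw [Hom.map_comp, hz.1, map_zero]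
  · rw [Hom.map_comp, hz.2, map_zero]

variable (X)

/-- The left action of `0`-cells on null cells. -/
def nullLact (n : ℕ) {k l m : ℕ+} (E : Shuf k l m) :
    (X.cells 0).carrier k →ₗ[K] X.nullCells (n + 1) l →ₗ[K] X.nullCells (n + 1) m :=
  LinearMap.mk₂ K
    (fun u z => ⟨(X.cells (n + 1)).comp E ((X.identIterHom (n + 1)).map k u) z,
      comp_mem_nullCells_right E _ z.2⟩)
    (fun u u' z => by ext1; simp)
    (fun r u z => by ext1; simp)
    (fun u z z' => by ext1; simp)
    (fun r u z => by ext1; simp)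

/-- The right action of `0`-cells on null cells. -/
def nullRact (n : ℕ) {k l m : ℕ+} (E : Shuf k l m) :
    (X.cells 0).carrier l →ₗ[K] X.nullCells (n + 1) k →ₗ[K] X.nullCells (n + 1) m :=
  LinearMap.mk₂ K
    (fun u z => ⟨(X.cells (n + 1)).comp E z ((X.identIterHom (n + 1)).map l u),
      comp_mem_nullCells_left E z.2 _⟩)
    (fun u u' z => by ext1; simp)
    (fun r u z => by ext1; simp)
    (fun u z z' => by ext1; simp)
    (fun r u z => by ext1; simp)

/-- A linear map on the presented operad, defined on `0`-cells. -/
def presentedLift {k : ℕ+} {M : Type u} [AddCommGroup M] [Module K M]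
    (f : (X.cells 0).carrier k →ₗ[K] M) (h : ∀ u, X.proj.map k u = 0 → f u = 0) :
    X.presented.carrier k →ₗ[K] M :=
  Submodule.liftQ ((X.cells 0).ideal (eqRel (X.src 0) (X.tgt 0)) k) f (fun u hu =>
    h u ((Submodule.Quotient.mk_eq_zero ((X.cells 0).ideal (eqRel (X.src 0) (X.tgt 0)) k)).2 hu))

/-- The null `(n+1)`-cells, as a bimodule over the presented operad. -/
def nullBimodule (n : ℕ) : Bimodule X.presented where
  carrier k := X.nullCells (n + 1) k
  lact {k l m} E := X.presentedLift (X.nullLact n E) (fun u hu => by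
    ext z; exact null_comp_of_proj_eq_zero E z.2 hu)
  ract {k l m} E := (X.presentedLift (X.nullRact n E) (fun u hu => by
    ext z; exact comp_null_of_proj_eq_zero E z.2 hu)).flip
  one_lact {k} E z := by
    ext1
    change (X.cells (n + 1)).comp E ((X.identIterHom (n + 1)).map 1 (X.cells 0).one) z.1 = z.1
    rw [Hom.map_one, one_comp]
  ract_one {k} E z := by
    ext1
    change (X.cells (n + 1)).comp E z.1 ((X.identIterHom (n + 1)).map 1 (X.cells 0).one) = z.1
    rw [Hom.map_one, comp_one]
  nested_left {k l m n' q N E F F' E'} h x y z := by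
    obtain ⟨u, rfl⟩ := X.proj_surjective _ x
    obtain ⟨v, rfl⟩ := X.proj_surjective _ y
    ext1
    change (X.cells (n + 1)).comp F ((X.identIterHom (n + 1)).map _ ((X.cells 0).comp E u v)) z.1 =
      (X.cells (n + 1)).comp E' ((X.identIterHom (n + 1)).map _ u)
        ((X.cells (n + 1)).comp F' ((X.identIterHom (n + 1)).map _ v) z.1)
    rw [Hom.map_comp, ShuffleOperad.nested _ h]
  nested_mid h x z y := by
    obtain ⟨u, rfl⟩ := X.proj_surjective _ x
    obtain ⟨v, rfl⟩ := X.proj_surjective _ y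
    ext1
    exact ShuffleOperad.nested _ h _ _ _
  nested_right {k l m n' q N E F F' E'} h z x y := by
    obtain ⟨u, rfl⟩ := X.proj_surjective _ x
    obtain ⟨v, rfl⟩ := X.proj_surjective _ y
    ext1
    change _ = (X.cells (n + 1)).comp E' z.1
      ((X.identIterHom (n + 1)).map _ ((X.cells 0).comp F' u v))
    rw [Hom.map_comp]
    exact ShuffleOperad.nested _ h _ _ _
  parallel_root h z x y := by
    obtain ⟨u, rfl⟩ := X.proj_surjective _ x
    obtain ⟨v, rfl⟩ := X.proj_surjective _ y
    ext1
    exact ShuffleOperad.parallel _ h _ _ _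
  parallel_leaf {k l m n₁ n₂ N E F G H} h x z y := by
    obtain ⟨u, rfl⟩ := X.proj_surjective _ x
    obtain ⟨v, rfl⟩ := X.proj_surjective _ y
    ext1
    change _ = (X.cells (n + 1)).comp H
      ((X.identIterHom (n + 1)).map _ ((X.cells 0).comp G u v)) z.1
    rw [Hom.map_comp]
    exact ShuffleOperad.parallel _ h _ _ _

/-- The cell underlying an element of the bimodule of null cells. -/
def nullVal (n : ℕ) (k : ℕ+) :
    (X.nullBimodule n).carrier k →ₗ[K] (X.cells (n + 1)).carrier k :=
  (X.nullCells (n + 1) k).subtype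

theorem nullVal_injective (n : ℕ) (k : ℕ+) : Function.Injective (X.nullVal n k) :=
  Subtype.val_injective

theorem nullVal_mem {n : ℕ} {k : ℕ+} (z : (X.nullBimodule n).carrier k) :
    X.nullVal n k z ∈ X.nullCells (n + 1) k := z.2

theorem nullVal_lact {n : ℕ} {k l m : ℕ+} (E : Shuf k l m) (b : (X.cells (n + 1)).carrier k)
    (z : (X.nullBimodule n).carrier l) :
    X.nullVal n m ((X.nullBimodule n).lact E ((X.barHom (n + 1)).map k b) z) =
      (X.cells (n + 1)).comp E b (X.nullVal n l z) := by
  rw [null_comp E b (X.nullVal_mem z)]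
  rfl

theorem nullVal_ract {n : ℕ} {k l m : ℕ+} (E : Shuf k l m) (z : (X.nullBimodule n).carrier k)
    (b : (X.cells (n + 1)).carrier l) :
    X.nullVal n m ((X.nullBimodule n).ract E z ((X.barHom (n + 1)).map l b)) =
      (X.cells (n + 1)).comp E (X.nullVal n k z) b := by
  rw [comp_null E (X.nullVal_mem z)]
  rfl

/-- By globularity the target determines the iterated boundaries in dimension `0`. For a 1-cell
nothing forces the source to vanish, which is why dimensions 0 and 1 need another argument. -/
theorem mem_nullCells_of_tgt_eq_zero {n : ℕ} {k : ℕ+} {c : (X.cells (n + 2)).carrier k}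
    (h : (X.tgt (n + 1)).map k c = 0) : c ∈ X.nullCells (n + 2) k := by
  constructor <;> refine LinearMap.mem_ker.2 ?_
  · rw [← srcIter_succ_tgt, h, map_zero]
  · change (X.tgtIter (n + 1)).map k ((X.tgt (n + 1)).map k c) = 0
    rw [h, map_zero]

/-- The difference of a cell of dimension at least `2` with the identity of its target. -/
def subTgt (n : ℕ) (k : ℕ+) :
    (X.cells (n + 2)).carrier k →ₗ[K] (X.nullBimodule (n + 1)).carrier k :=
  LinearMap.codRestrict (X.nullCells (n + 2) k)
    (LinearMap.id - (X.identHom (n + 1)).map k ∘ₗ (X.tgt (n + 1)).map k)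
    (fun c => X.mem_nullCells_of_tgt_eq_zero (by
      rw [LinearMap.sub_apply, LinearMap.comp_apply, map_sub, tgt_ident, LinearMap.id_apply,
        sub_self]))

theorem nullVal_subTgt {n : ℕ} {k : ℕ+} (c : (X.cells (n + 2)).carrier k) :
    X.nullVal (n + 1) k (X.subTgt n k c) =
      c - (X.identHom (n + 1)).map k ((X.tgt (n + 1)).map k c) := rfl

/-- The morphism which sends a generator to its difference with the identity of its target. -/
def unbracket (n : ℕ) :
    Bimodule.Hom (freeBimodule X.presented (X.gens (n + 2))) (X.nullBimodule (n + 1)) :=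
  freeBimodule.lift (B := X.nullBimodule (n + 1)) (fun k x => X.subTgt n k (X.cell (gen x)))

/-- The operator `c ↦ c - 1_{t(c)}` is a derivation with values in null cells, and a derivation that
vanishes on identities is determined on generators. So a cell can be recovered from its target and
its bracket. -/
theorem unbracket_bracket {n : ℕ} {k : ℕ+} (c : (X.cells (n + 2)).carrier k) :
    (X.unbracket n).map k (X.bracket (n + 2) k c) = X.subTgt n k c := by
  induction c using X.cells_succ_induction with
  | gen k x => rfl
  | ident k c =>
    apply X.nullVal_injective
    rw [bracket_ident, map_zero, map_zero, nullVal_subTgt, tgt_ident, sub_self]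
  | one =>
    apply X.nullVal_injective
    rw [bracket_one, map_zero, map_zero, nullVal_subTgt, Hom.map_one, Hom.map_one, sub_self]
  | comp E a b iha ihb =>
    have e := X.nullVal_lact E ((X.identHom (n + 1)).map _ ((X.tgt (n + 1)).map _ a))
      (X.subTgt n _ b)
    rw [← barHom_src, src_ident, barHom_tgt] at e
    apply X.nullVal_injective
    rw [bracket_comp, map_add, Bimodule.Hom.map_lact, Bimodule.Hom.map_ract, iha, ihb, map_add,
      nullVal_ract, e]
    simp only [nullVal_subTgt, Hom.map_comp, map_sub, LinearMap.sub_apply]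
    abel
  | zero k => simp only [map_zero]
  | add k a b iha ihb => simp only [map_add, iha, ihb]
  | smul k r a ih => simp only [map_smul, ih]

theorem eq_zero_of_bracket_eq_zero {n : ℕ} {k : ℕ+} {c : (X.cells (n + 2)).carrier k}
    (ht : (X.tgt (n + 1)).map k c = 0) (h : X.bracket (n + 2) k c = 0) : c = 0 := by
  have e := congrArg (X.nullVal (n + 1) k) (X.unbracket_bracket c)
  rw [h, map_zero, map_zero, nullVal_subTgt, ht, map_zero, sub_zero] at e
  exact e.symm

end Polygraph
end ShuffleOp

/-! ### Split presentations and lifts of 0-cells to families of 1-cells. -/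

namespace ShuffleOp

variable {K : Type u} [Field K]

namespace Tot

open Function (update)

theorem map_map_eq_self {U V : ℕ+ → Type u} [∀ k, AddCommGroup (U k)] [∀ k, Module K (U k)]
    [∀ k, AddCommGroup (V k)] [∀ k, Module K (V k)]
    {g : ∀ k, V k →ₗ[K] U k} {f : ∀ k, U k →ₗ[K] V k} (h : ∀ k x, g k (f k x) = x) (x : Tot U) :
    map g (map f x) = x :=
  ext_component (K := K) (fun k m => h k (component (K := K) m x))

theorem map_map_eq_self_of_map_eq_zero {U V W : ℕ+ → Type u} [∀ k, AddCommGroup (U k)]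
    [∀ k, Module K (U k)] [∀ k, AddCommGroup (V k)] [∀ k, Module K (V k)]
    [∀ k, AddCommGroup (W k)] [∀ k, Module K (W k)]
    {g : ∀ k, V k →ₗ[K] U k} {f : ∀ k, U k →ₗ[K] V k} {π : ∀ k, U k →ₗ[K] W k}
    (h : ∀ k x, π k x = 0 → g k (f k x) = x) {x : Tot U} (hx : map π x = 0) :
    map g (map f x) = x :=
  ext_component (K := K) (fun k m => h k _ (congrArg (component (K := K) m) hx))

theorem map_map_eq_zero {U V W : ℕ+ → Type u} [∀ k, AddCommGroup (U k)]
    [∀ k, Module K (U k)] [∀ k, AddCommGroup (V k)] [∀ k, Module K (V k)]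
    [∀ k, AddCommGroup (W k)] [∀ k, Module K (W k)]
    {g : ∀ k, V k →ₗ[K] W k} {f : ∀ k, U k →ₗ[K] V k} (h : ∀ k x, g k (f k x) = 0) (x : Tot U) :
    map g (map f x) = 0 :=
  ext_component (K := K) (fun k m => h k (component (K := K) m x))

variable {P : ShuffleOperad K}

theorem fill_eq_zero {a : ℕ → Tot P.carrier} {L : List ℕ} {p : ℕ} (hp : p ∈ L) (ha : a p = 0)
    (t : Tot P.carrier) : fill P a L t = 0 := by
  induction L generalizing t with
  | nil => simp at hp
  | cons q L ih =>
    rw [fill_cons]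
    rcases List.mem_cons.1 hp with rfl | hp
    · rw [ha, map_zero, map_zero]
    · exact ih hp _

theorem act_update_sub {k : ℕ+} (m : Fin k ↪o ℕ) (i : Fin k) (a : ℕ → Tot P.carrier)
    (x : P.carrier k) (b c : Tot P.carrier) :
    act P m (update a (m i) (b - c)) x = act P m (update a (m i) b) x - act P m (update a (m i) c) x :=
  (isFam_act x).sub m i a b c

theorem act_update_zero {k : ℕ+} (m : Fin k ↪o ℕ) (i : Fin k) (a : ℕ → Tot P.carrier)
    (x : P.carrier k) : act P m (update a (m i) 0) x = 0 :=
  (isFam_act x).update_zero m i a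

theorem map_graft {k l n : ℕ+} {U : ℕ+ → Type u} [∀ k, AddCommGroup (U k)] [∀ k, Module K (U k)]
    {O : ShuffleOperad K} (E : Shuf k l n) (β : ShuffleOperad.Hom P O) {j : Tot U → Tot P.carrier}
    {j' : Tot U → Tot O.carrier} (hj : ∀ x, map β.map (j x) = j' x) (x : P.carrier k)
    (g : Fam U P.carrier l) (m : Fin n ↪o ℕ) (a : ℕ → Tot U) :
    map β.map (graft E j (actFam P x) g m a) =
      graft E j' (actFam O (β.map k x)) (fun m a => map β.map (g m a)) m a := by
  simp only [graft, actFam, map_act, update_comp, hj]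

end Tot

/-! ### Operads with linearly split presentations -/

/-- A presentation of the operad `P` by an operad `F` of `0`-cells and an operad `C` of `1`-cells,
which satisfies the exchange relation, together with linear sections of the projection and of the
boundary. -/
structure SplitPresentation (P F C : ShuffleOperad K) where
  src : ShuffleOperad.Hom C F
  tgt : ShuffleOperad.Hom C F
  ident : ShuffleOperad.Hom F C
  proj : ShuffleOperad.Hom F P
  src_ident : ∀ k x, src.map k (ident.map k x) = x
  tgt_ident : ∀ k x, tgt.map k (ident.map k x) = x
  proj_src : ∀ k x, proj.map k (src.map k x) = proj.map k (tgt.map k x)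
  comp_eq_zero : ∀ {k l n : ℕ+} (E : Shuf k l n) x y, src.map k x = 0 → tgt.map l y = 0 →
    C.comp E x y = 0
  comp_eq_zero' : ∀ {k l n : ℕ+} (E : Shuf k l n) x y, tgt.map k x = 0 → src.map l y = 0 →
    C.comp E x y = 0
  sec : ∀ k, P.carrier k →ₗ[K] F.carrier k
  proj_sec : ∀ k x, proj.map k (sec k x) = x
  sec_one : sec 1 P.one = F.one
  cell : ∀ k, F.carrier k →ₗ[K] C.carrier k
  src_cell : ∀ k x, proj.map k x = 0 → src.map k (cell k x) = x
  tgt_cell : ∀ k x, tgt.map k (cell k x) = 0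

namespace SplitPresentation

open Tot ShuffleOperad
open Function (update)

variable {P F C : ShuffleOperad K} (D : SplitPresentation P F C)

theorem mul_eq_zero (p : ℕ) {a b : Tot C.carrier} (ha : map D.src.map a = 0)
    (hb : map D.tgt.map b = 0) : mul C p a b = 0 := by
  -- The vanishing of a boundary does not pass to the summands used in the induction. Subtracting
  -- identities enforces it on every summand, and changes nothing under `ha` and `hb`.
  have key : ∀ a b : Tot C.carrier, mul C p (a - map D.ident.map (map D.src.map a))
      (b - map D.ident.map (map D.tgt.map b)) = 0 := by
    intro a b
    induction a using tot_induction with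
    | zero => simp
    | add x y hx hy =>
      simp only [map_add, add_sub_add_comm, LinearMap.add_apply, hx, hy, add_zero]
    | of k m x =>
      induction b using tot_induction with
      | zero => simp
      | add x y hx hy => simp only [map_add, add_sub_add_comm, hx, hy, add_zero]
      | of l m' y =>
        simp only [map_of, ← map_sub]
        by_cases h : Labels.Compat ⟨k, m⟩ ⟨l, m'⟩ p
        · obtain ⟨E, -, -, -, hE⟩ := mul_of_compat C h (Labels.range_union _ _)
          rw [hE, D.comp_eq_zero, map_zero]
          · rw [map_sub, D.src_ident, sub_self]
          · rw [map_sub, D.tgt_ident, sub_self]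
        · exact mul_of_not_compat C h _ _
  have h := key a b
  rwa [ha, hb, map_zero, sub_zero, sub_zero] at h

theorem mul_eq_zero' (p : ℕ) {a b : Tot C.carrier} (ha : map D.tgt.map a = 0)
    (hb : map D.src.map b = 0) : mul C p a b = 0 := by
  have key : ∀ a b : Tot C.carrier, mul C p (a - map D.ident.map (map D.tgt.map a))
      (b - map D.ident.map (map D.src.map b)) = 0 := by
    intro a b
    induction a using tot_induction with
    | zero => simp
    | add x y hx hy =>
      simp only [map_add, add_sub_add_comm, LinearMap.add_apply, hx, hy, add_zero]
    | of k m x =>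
      induction b using tot_induction with
      | zero => simp
      | add x y hx hy => simp only [map_add, add_sub_add_comm, hx, hy, add_zero]
      | of l m' y =>
        simp only [map_of, ← map_sub]
        by_cases h : Labels.Compat ⟨k, m⟩ ⟨l, m'⟩ p
        · obtain ⟨E, -, -, -, hE⟩ := mul_of_compat C h (Labels.range_union _ _)
          rw [hE, D.comp_eq_zero', map_zero]
          · rw [map_sub, D.tgt_ident, sub_self]
          · rw [map_sub, D.src_ident, sub_self]
        · exact mul_of_not_compat C h _ _
  have h := key a b
  rwa [ha, hb, map_zero, sub_zero, sub_zero] at h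

theorem act_update_eq_zero {k : ℕ+} (m : Fin k ↪o ℕ) (i : Fin k) (a : ℕ → Tot C.carrier)
    {x : C.carrier k} {v : Tot C.carrier} (hx : D.src.map k x = 0) (hv : map D.tgt.map v = 0) :
    act C m (update a (m i) v) x = 0 := by
  rw [act_update]
  refine D.mul_eq_zero _ ?_ hv
  rw [map_fill, map_of, hx, map_zero, map_zero]

theorem act_update_eq_zero' {k : ℕ+} (m : Fin k ↪o ℕ) (i : Fin k) (a : ℕ → Tot C.carrier)
    {x : C.carrier k} {v : Tot C.carrier} (hx : D.tgt.map k x = 0) (hv : map D.src.map v = 0) :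
    act C m (update a (m i) v) x = 0 := by
  rw [act_update]
  refine D.mul_eq_zero' _ ?_ hv
  rw [map_fill, map_of, hx, map_zero, map_zero]

/-- Once `v` is filled in, the composite has source zero, and composing it with the element `w` of
target zero gives zero. -/
theorem act_update_update_eq_zero {k : ℕ+} (m : Fin k ↪o ℕ) {i j : Fin k} (h : i ≠ j)
    (a : ℕ → Tot C.carrier) (x : C.carrier k) {v w : Tot C.carrier} (hv : map D.src.map v = 0)
    (hw : map D.tgt.map w = 0) : act C m (update (update a (m i) v) (m j) w) x = 0 := by
  rw [act_update]
  refine D.mul_eq_zero _ ?_ hw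
  have hij : m i ≠ m j := fun e => h (m.injective e)
  rw [map_fill]
  refine fill_eq_zero (p := m i) ?_ (by rw [Function.update_self, hv]) _
  exact (List.mem_erase_of_ne hij).2 ((List.mem_ofFn' _ _).2 ⟨i, rfl⟩)

/-- Both sides are equal to the composite with `v` and `w` at the two inputs. This is the
interchange of two independent rewriting steps. -/
theorem act_ident_src {k : ℕ+} (m : Fin k ↪o ℕ) {i j : Fin k} (h : i ≠ j)
    (a : ℕ → Tot C.carrier) (x : C.carrier k) {v w : Tot C.carrier} (hv : map D.tgt.map v = 0)
    (hw : map D.tgt.map w = 0) :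
    act C m (update (update a (m i) (map D.ident.map (map D.src.map v))) (m j) w) x =
      act C m (update (update a (m i) v) (m j) (map D.ident.map (map D.src.map w))) x := by
  have hij : m i ≠ m j := fun e => h (m.injective e)
  have s_sub : ∀ v : Tot C.carrier,
      map D.src.map (v - map D.ident.map (map D.src.map v)) = 0 := fun v => by
    rw [map_sub, map_map_eq_self D.src_ident, sub_self]
  have e1 := D.act_update_update_eq_zero m h a x (s_sub v) hw
  have e2 := D.act_update_update_eq_zero m h.symm a x (s_sub w) hv
  rw [Function.update_comm hij, act_update_sub, sub_eq_zero] at e1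
  rw [Function.update_comm hij.symm, act_update_sub, sub_eq_zero] at e2
  rw [Function.update_comm hij, ← e1, Function.update_comm hij.symm, ← e2,
    Function.update_comm hij]

/-- The inclusion of `P` into `C`, through the chosen representatives. -/
noncomputable def rep : Tot P.carrier →ₗ[K] Tot C.carrier :=
  map D.ident.map ∘ₗ map D.sec

theorem low_rep (p : ℕ) (x : Tot P.carrier) :
    low (K := K) p (D.rep x) = D.rep (low (K := K) p x) := by
  rw [rep, LinearMap.comp_apply, low_map, low_map]; rfl

/-- The families of cells of source `f(σ a) - σ(f̄ a)` and target `0`. -/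
structure IsLift {k : ℕ+} (f : F.carrier k) (φ : Fam P.carrier C.carrier k) : Prop where
  src : ∀ m a, map D.src.map (φ m a) =
    act F m (fun p => map D.sec (a p)) f - map D.sec (act P m a (D.proj.map k f))
  tgt : ∀ m a, map D.tgt.map (φ m a) = 0

/-- The pairs of a `0`-cell and of a family of cells that relate its composites with the chosen
representatives to the representatives of the composites. -/
def lifts (k : ℕ+) : Submodule K (F.carrier k × famSpace K P.carrier C.carrier k) where
  carrier := {x | D.IsLift x.1 x.2.1}
  zero_mem' :=
    { src := fun m a => by
        change map D.src.map 0 = act F m _ 0 - map D.sec (act P m a (D.proj.map k 0))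
        simp only [map_zero, sub_zero]
      tgt := fun _ _ => map_zero _ }
  add_mem' := fun {x y} hx hy =>
    { src := fun m a => by
        change map D.src.map (x.2.1 m a + y.2.1 m a) =
          act F m _ (x.1 + y.1) - map D.sec (act P m a (D.proj.map k (x.1 + y.1)))
        simp only [map_add, hx.src, hy.src]; abel
      tgt := fun m a => by
        change map D.tgt.map (x.2.1 m a + y.2.1 m a) = 0
        rw [map_add, hx.tgt, hy.tgt, add_zero] }
  smul_mem' := fun r x hx =>
    { src := fun m a => by
        change map D.src.map (r • x.2.1 m a) =
          act F m _ (r • x.1) - map D.sec (act P m a (D.proj.map k (r • x.1)))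
        simp only [map_smul, hx.src, smul_sub]
      tgt := fun m a => by
        change map D.tgt.map (r • x.2.1 m a) = 0
        rw [map_smul, hx.tgt, smul_zero] }

/-- The family of a composite. -/
noncomputable def compFam {k l n : ℕ+} (E : Shuf k l n)
    (x : F.carrier k × famSpace K P.carrier C.carrier k)
    (y : F.carrier l × famSpace K P.carrier C.carrier l) : famSpace K P.carrier C.carrier n :=
  ⟨graft E D.rep (actFam C (D.ident.map k x.1)) y.2.1 +
      graft E LinearMap.id x.2.1 (actFam P (D.proj.map l y.1)),
    (famSpace K P.carrier C.carrier n).add_mem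
      ((isFam_act _).graft E D.low_rep y.2.2)
      (x.2.2.graft E (fun _ _ => rfl) (isFam_act _))⟩

/-- The sources telescope along `f(g(σa)) → f(σ(ḡ(a))) → σ(f̄(ḡ(a)))`, where `f` is `x.1` and `g` is
`y.1`. -/
theorem isLift_compFam {k l n : ℕ+} (E : Shuf k l n)
    {x : F.carrier k × famSpace K P.carrier C.carrier k}
    {y : F.carrier l × famSpace K P.carrier C.carrier l} (hx : D.IsLift x.1 x.2.1)
    (hy : D.IsLift y.1 y.2.1) : D.IsLift (F.comp E x.1 y.1) (D.compFam E x y).1 where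
  src m a := by
    change map D.src.map (act C _ (update _ _ _) _ + x.2.1 _ (update _ _ _)) = _
    rw [map_add, map_act, hx.src, D.src_ident, act_comp, D.proj.map_comp, act_comp,
      update_comp, update_comp, hy.src]
    have h : (fun p => map D.src.map (D.rep (a p))) = fun p => map D.sec (a p) := by
      funext p; exact map_map_eq_self D.src_ident _
    have e := act_update_sub (E.root.trans m) E.pos (fun p => map D.sec (a p)) x.1
      (act F (E.leaf.trans m) (fun p => map D.sec (a p)) y.1)
      (map D.sec (act P (E.leaf.trans m) a (D.proj.map l y.1)))
    rw [h]
    refine (congrArg (· + _) e).trans ?_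
    simp only [LinearMap.id_apply]
    exact sub_add_sub_cancel _ _ _
  tgt m a := by
    change map D.tgt.map (act C _ (update _ _ _) _ + x.2.1 _ (update _ _ _)) = _
    rw [map_add, hx.tgt, add_zero, map_act, update_comp, hy.tgt]
    exact act_update_zero (E.root.trans m) E.pos _ _

theorem compFam_one {k : ℕ+} (E : Shuf k 1 k)
    (x : F.carrier k × famSpace K P.carrier C.carrier k) :
    D.compFam E x (F.one, 0) = x.2 := by
  ext1
  change graft E D.rep (actFam C _) 0 + graft E id x.2.1 (actFam P (D.proj.map 1 F.one)) = x.2.1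
  rw [D.proj.map_one, graft_one_right E x.2.2]
  have h : graft E D.rep (actFam C (D.ident.map k x.1)) (0 : Fam P.carrier C.carrier 1) = 0 := by
    funext m a
    exact act_update_zero (E.root.trans m) E.pos _ _
  rw [h, zero_add]

theorem one_compFam {k : ℕ+} (E : Shuf 1 k k)
    (y : F.carrier k × famSpace K P.carrier C.carrier k) :
    D.compFam E (F.one, 0) y = y.2 := by
  ext1
  change graft E D.rep (actFam C (D.ident.map 1 F.one)) y.2.1 + graft E id 0 _ = y.2.1
  rw [D.ident.map_one, graft_one_left E _ y.2.2]
  exact add_zero _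

theorem compFam_nested {k l m n q N : ℕ+} {E : Shuf k l n} {F₁ : Shuf n m N} {F' : Shuf l m q}
    {E' : Shuf k q N} (h : Shuf.Nested E F₁ F' E')
    (x : F.carrier k × famSpace K P.carrier C.carrier k)
    (y : F.carrier l × famSpace K P.carrier C.carrier l)
    (z : F.carrier m × famSpace K P.carrier C.carrier m) :
    D.compFam F₁ (F.comp E x.1 y.1, D.compFam E x y) z =
      D.compFam E' x (F.comp F' y.1 z.1, D.compFam F' y z) := by
  ext1
  have e1 := graft_nested h (j₁ := D.rep) (j₂ := id) (j₃ := D.rep) (fun _ => rfl)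
    (isFam_act (D.ident.map k x.1)) (actFam C (D.ident.map l y.1)) z.2.1
  have e2 := graft_nested h (j₁ := id) (j₂ := D.rep) (j₃ := D.rep) (fun _ => rfl)
    (isFam_act (D.ident.map k x.1)) y.2.1 (actFam P (D.proj.map m z.1))
  have e3 := graft_nested h (j₁ := id) (j₂ := id) (j₃ := id) (fun _ => rfl)
    x.2.2 (actFam P (D.proj.map l y.1)) (actFam P (D.proj.map m z.1))
  change graft F₁ D.rep (actFam C (D.ident.map n (F.comp E x.1 y.1))) z.2.1 +
      (graft F₁ id (graft E D.rep (actFam C (D.ident.map k x.1)) y.2.1) _ +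
        graft F₁ id (graft E id x.2.1 (actFam P (D.proj.map l y.1))) _) =
    graft E' D.rep (actFam C (D.ident.map k x.1))
      (graft F' D.rep (actFam C (D.ident.map l y.1)) z.2.1 +
        graft F' id y.2.1 (actFam P (D.proj.map m z.1))) +
      graft E' id x.2.1 (actFam P (D.proj.map q (F.comp F' y.1 z.1)))
  rw [D.ident.map_comp, D.proj.map_comp, actFam_comp, actFam_comp, e1, e2, e3, ← add_assoc]
  congr 1
  funext M a
  exact ((isFam_act (D.ident.map k x.1)).add (E'.root.trans M) E'.pos _ _ _).symm

/-- Two branches can be normalized in either order, and the results agree only by exchange. The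
conditions `hy` and `hz` enter here, whereas `compFam_nested` is purely formal. -/
theorem compFam_parallel {k l m n n' N : ℕ+} {E : Shuf k l n} {F₁ : Shuf n m N} {G : Shuf k m n'}
    {H : Shuf n' l N} (h : Shuf.Parallel E F₁ G H)
    (x : F.carrier k × famSpace K P.carrier C.carrier k)
    {y : F.carrier l × famSpace K P.carrier C.carrier l}
    {z : F.carrier m × famSpace K P.carrier C.carrier m} (hy : D.IsLift y.1 y.2.1)
    (hz : D.IsLift z.1 z.2.1) :
    D.compFam F₁ (F.comp E x.1 y.1, D.compFam E x y) z =
      D.compFam H (F.comp G x.1 z.1, D.compFam G x z) y := by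
  ext1
  have e3 := graft_parallel h (j₁ := id) (j₂ := id) (i₁ := id) (i₂ := id)
    (g₁ := actFam P (D.proj.map m z.1)) (g' := actFam P (D.proj.map l y.1)) (fun _ => rfl)
    x.2.1 (isFam_act (D.proj.map l y.1)) (isFam_act (D.proj.map m z.1)) (fun _ _ => rfl)
    (fun _ _ => rfl)
  change graft F₁ D.rep (actFam C (D.ident.map n (F.comp E x.1 y.1))) z.2.1 +
      (graft F₁ id (graft E D.rep (actFam C (D.ident.map k x.1)) y.2.1)
        (actFam P (D.proj.map m z.1)) +
        graft F₁ id (graft E id x.2.1 (actFam P (D.proj.map l y.1))) _) =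
    graft H D.rep (actFam C (D.ident.map n' (F.comp G x.1 z.1))) y.2.1 +
      (graft H id (graft G D.rep (actFam C (D.ident.map k x.1)) z.2.1)
        (actFam P (D.proj.map l y.1)) +
        graft H id (graft G id x.2.1 (actFam P (D.proj.map m z.1))) _)
  rw [D.ident.map_comp, D.ident.map_comp, actFam_comp, actFam_comp, e3, ← add_assoc, ← add_assoc]
  congr 1
  funext M a
  have d1 := graft_parallel_aux h D.rep id (actFam C (D.ident.map k x.1))
    (isFam_act (D.ident.map l y.1)) z.2.1 M a
  have d2 := graft_parallel_aux h id D.rep (actFam C (D.ident.map k x.1))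
    y.2.2 (actFam P (D.proj.map m z.1)) M a
  have d3 := graft_parallel_aux h.symm D.rep id (actFam C (D.ident.map k x.1))
    (isFam_act (D.ident.map m z.1)) y.2.1 M a
  have d4 := graft_parallel_aux h.symm id D.rep (actFam C (D.ident.map k x.1))
    z.2.2 (actFam P (D.proj.map l y.1)) M a
  have hroot : G.root.trans (H.root.trans M) = E.root.trans (F₁.root.trans M) := by
    ext i; exact congrArg M (h.root_root i).symm
  simp only [Pi.add_apply]
  rw [d1, d2, d3, d4, hroot]
  simp only [← h.root_root, id, actFam]
  set μ : Fin k ↪o ℕ := E.root.trans (F₁.root.trans M) with hμ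
  have hpos : ∀ i, M (F₁.root (E.root i)) = μ i := fun _ => rfl
  simp only [hpos]
  have hne : μ E.pos ≠ μ G.pos := fun e => h.ne (μ.injective e)
  -- The identity of the source of a lift is the difference between a branch filled with
  -- representatives and the representative of its image. Hence `act_ident_src` becomes the equality
  -- of the four remaining terms.
  have src_eq : ∀ {l' : ℕ+} {y : F.carrier l' × famSpace K P.carrier C.carrier l'}
      (_ : D.IsLift y.1 y.2.1) (μ' : Fin l' ↪o ℕ),
      act C μ' (fun p => D.rep (a p)) (D.ident.map l' y.1) -
        D.rep (act P μ' a (D.proj.map l' y.1)) =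
      map D.ident.map (map D.src.map (y.2.1 μ' a)) := by
    intro l' y hy μ'
    rw [hy.src, map_sub, map_act]
    rfl
  have key := D.act_ident_src μ h.ne (fun p => D.rep (a p)) (D.ident.map k x.1)
    (hy.tgt (H.leaf.trans M) a) (hz.tgt (F₁.leaf.trans M) a)
  rw [← src_eq hy, ← src_eq hz, Function.update_comm hne, act_update_sub, act_update_sub] at key
  have comm : ∀ v w : Tot C.carrier,
      update (update (fun p => D.rep (a p)) (μ E.pos) v) (μ G.pos) w =
        update (update (fun p => D.rep (a p)) (μ G.pos) w) (μ E.pos) v :=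
    fun v w => Function.update_comm (β := fun _ => Tot C.carrier) hne v w _
  rw [← comm (D.rep (act P (H.leaf.trans M) a (D.proj.map l y.1))) _,
    comm _ (D.rep (act P (F₁.leaf.trans M) a (D.proj.map m z.1))),
    sub_eq_sub_iff_add_eq_add] at key
  exact key

end SplitPresentation
end ShuffleOp

/-! ### The operad of lifts, freeness of the operad of 0-cells, and linear sections. -/

namespace ShuffleOp

variable {K : Type u} [Field K]

namespace SplitPresentation

open Tot ShuffleOperad
open Function (update)

variable {P F C : ShuffleOperad K} (D : SplitPresentation P F C)

/-- The operad of `0`-cells with families of cells which relate their composites with the chosen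
representatives to the representatives of the composites. -/
noncomputable def liftOperad : ShuffleOperad K where
  carrier k := D.lifts k
  one := ⟨(F.one, 0),
    { src := fun m a => by
        change map D.src.map 0 = act F m _ F.one - map D.sec (act P m a (D.proj.map 1 F.one))
        rw [map_zero, D.proj.map_one, act_one, act_one, low_map, sub_self]
      tgt := fun _ _ => map_zero _ }⟩
  comp E := LinearMap.mk₂ K
    (fun x y => ⟨(F.comp E x.1.1 y.1.1, D.compFam E x.1 y.1), D.isLift_compFam E x.2 y.2⟩)
    (fun x x' y => by
      refine Subtype.ext (Prod.ext ?_ (Subtype.ext (funext fun m => funext fun a => ?_)))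
      · exact LinearMap.map_add₂ _ _ _ _
      · change act C _ _ (D.ident.map _ (x.1.1 + x'.1.1)) + (x.1.2.1 _ _ + x'.1.2.1 _ _) =
          (act C _ _ _ + x.1.2.1 _ _) + (act C _ _ _ + x'.1.2.1 _ _)
        rw [map_add, map_add]
        exact add_add_add_comm _ _ _ _)
    (fun r x y => by
      refine Subtype.ext (Prod.ext ?_ (Subtype.ext (funext fun m => funext fun a => ?_)))
      · exact LinearMap.map_smul₂ _ _ _ _
      · change act C _ _ (D.ident.map _ (r • x.1.1)) + r • x.1.2.1 _ _ =
          r • (act C _ _ _ + x.1.2.1 _ _)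
        rw [map_smul, map_smul, smul_add])
    (fun x y y' => by
      refine Subtype.ext (Prod.ext ?_ (Subtype.ext (funext fun m => funext fun a => ?_)))
      · exact map_add _ _ _
      · have e1 := (isFam_act (D.ident.map _ x.1.1)).add (E.root.trans m) E.pos
          (fun p => D.rep (a p)) (y.1.2.1 (E.leaf.trans m) a) (y'.1.2.1 (E.leaf.trans m) a)
        have e2 := (x.1.2.2 : IsFam K x.1.2.1).add (E.root.trans m) E.pos a
          (act P (E.leaf.trans m) a (D.proj.map _ y.1.1))
          (act P (E.leaf.trans m) a (D.proj.map _ y'.1.1))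
        rw [← map_add, ← map_add] at e2
        exact (congrArg₂ (· + ·) e1 e2).trans (add_add_add_comm _ _ _ _))
    (fun r x y => by
      refine Subtype.ext (Prod.ext ?_ (Subtype.ext (funext fun m => funext fun a => ?_)))
      · exact map_smul _ _ _
      · have e1 := (isFam_act (D.ident.map _ x.1.1)).smul (E.root.trans m) E.pos
          (fun p => D.rep (a p)) r (y.1.2.1 (E.leaf.trans m) a)
        have e2 := (x.1.2.2 : IsFam K x.1.2.1).smul (E.root.trans m) E.pos a r
          (act P (E.leaf.trans m) a (D.proj.map _ y.1.1))
        rw [← map_smul, ← map_smul] at e2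
        exact (congrArg₂ (· + ·) e1 e2).trans (smul_add _ _ _).symm)
  comp_one E x := Subtype.ext (Prod.ext (F.comp_one E _) (D.compFam_one E _))
  one_comp E x := Subtype.ext (Prod.ext (F.one_comp E _) (D.one_compFam E _))
  nested h x y z := Subtype.ext (Prod.ext (F.nested h _ _ _) (D.compFam_nested h _ _ _))
  parallel h x y z :=
    Subtype.ext (Prod.ext (F.parallel h _ _ _) (D.compFam_parallel h _ y.2 z.2))

/-- The projection onto `0`-cells. -/
noncomputable def liftOperadFst : Hom D.liftOperad F where
  map k := LinearMap.fst K _ _ ∘ₗ (D.lifts k).subtype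
  map_one := rfl
  map_comp _ _ _ := rfl

/-- The chosen lift of a generator. -/
noncomputable def genFam {k : ℕ+} (x : F.carrier k) : famSpace K P.carrier C.carrier k :=
  ⟨fun m a => map D.cell (act F m (fun p => map D.sec (a p)) x -
      map D.sec (act P m a (D.proj.map k x))), by
    have h1 := ((isFam_act x).comap D.sec).map D.cell
    have h2 := ((isFam_act (D.proj.map k x)).map D.sec).map D.cell
    have h := (famSpace K P.carrier C.carrier k).sub_mem h1 h2
    refine cast (congrArg _ (funext fun m => funext fun a => ?_)) h
    exact (map_sub (map D.cell) _ _).symm⟩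

/-- The difference `f(σa) - σ(f̄(a))` is killed by the projection, so the chosen linear lifting of
the kernel applies to it. -/
theorem isLift_genFam {k : ℕ+} (x : F.carrier k) : D.IsLift x (D.genFam x).1 where
  src m a := by
    refine map_map_eq_self_of_map_eq_zero D.src_cell ?_
    rw [map_sub, map_act, map_map_eq_self D.proj_sec, sub_eq_zero]
    congr 2
    funext p
    exact map_map_eq_self D.proj_sec _
  tgt m a := map_map_eq_zero D.tgt_cell _

end SplitPresentation

namespace Polygraph

open CellExpr ShuffleOperad

variable (X : Polygraph K)

/-- The values of generators, given those of the generators of dimension `0`. -/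
def zeroVal {Q : ShuffleOperad K} (g : ∀ k, X.gens 0 k → Q.carrier k) :
    ∀ (n : ℕ) (k : ℕ+), X.gens n k → Q.carrier k
  | 0, k, x => g k x
  | _ + 1, _, _ => 0

/-- The value in an operad of an expression, given the values of the generators of dimension `0`. -/
def zeroEval {Q : ShuffleOperad K} (g : ∀ k, X.gens 0 k → Q.carrier k) :
    ∀ {n : ℕ} {k : ℕ+}, CellExpr K X.gens n k → Q.carrier k
  | _, _, gen x => X.zeroVal g _ _ x
  | _, _, ident a => zeroEval g a
  | _, _, CellExpr.one => Q.one
  | _, _, CellExpr.comp E a b => Q.comp E (zeroEval g a) (zeroEval g b)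
  | _, _, zero => 0
  | _, _, add a b => zeroEval g a + zeroEval g b
  | _, _, smul r a => r • zeroEval g a

/-- In dimension `0` only the axioms of shuffle operads are imposed, since the rules for identities
and exchange live in positive dimension; so 0-cells form a free operad. The dimension is kept
variable to allow induction on the relation. -/
theorem zeroEval_congr {Q : ShuffleOperad K} (g : ∀ k, X.gens 0 k → Q.carrier k) {n : ℕ} {k : ℕ+}
    {a b : CellExpr K X.gens n k} (h : X.Eqv a b) (hn : n = 0) :
    X.zeroEval g a = X.zeroEval g b := by
  induction h with
  | refl a => rfl
  | symm _ ih => exact (ih hn).symm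
  | trans _ _ ih ih' => exact (ih hn).trans (ih' hn)
  | add_congr _ _ ih ih' => simp only [zeroEval, ih hn, ih' hn]
  | smul_congr r _ ih => simp only [zeroEval, ih hn]
  | comp_congr E _ _ ih ih' => simp only [zeroEval, ih hn, ih' hn]
  | ident_congr => exact absurd hn (Nat.succ_ne_zero _)
  | add_assoc a b c => exact _root_.add_assoc _ _ _
  | add_comm a b => exact _root_.add_comm _ _
  | zero_add a => exact _root_.zero_add _
  | one_smul a => exact _root_.one_smul _ _
  | mul_smul r s a => exact SemigroupAction.mul_smul _ _ _
  | smul_add r a b => exact _root_.smul_add _ _ _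
  | add_smul r s a => exact _root_.add_smul _ _ _
  | zero_smul a => exact _root_.zero_smul _ _
  | comp_add_left E a a' b => exact LinearMap.map_add₂ _ _ _ _
  | comp_smul_left E r a b => exact LinearMap.map_smul₂ _ _ _ _
  | comp_add_right E a b b' => exact map_add _ _ _
  | comp_smul_right E r a b => exact map_smul _ _ _
  | comp_one E a => exact Q.comp_one E _
  | one_comp E a => exact Q.one_comp E _
  | nested h a b c => exact Q.nested h _ _ _
  | parallel h a b c => exact Q.parallel h _ _ _
  | ident_add a b => rfl
  | ident_smul r a => rfl
  | ident_one => rfl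
  | ident_comp E a b => rfl
  | exchange d => omega

/-- The morphism of operads on `0`-cells with given values on generators. -/
def zeroLift {Q : ShuffleOperad K} (g : ∀ k, X.gens 0 k → Q.carrier k) : Hom (X.cells 0) Q where
  map k := (cong X.s X.t 0 k).lift (fun a => X.zeroEval g a) (fun _ _ => rfl) (fun _ _ => rfl)
    (fun h => X.zeroEval_congr g h rfl)
  map_one := rfl
  map_comp E := by
    rintro ⟨a⟩ ⟨b⟩; rfl

theorem hom_zero_ext {Q : ShuffleOperad K} {f g : Hom (X.cells 0) Q}
    (h : ∀ k (x : X.gens 0 k), f.map k (X.cell (gen x)) = g.map k (X.cell (gen x))) {k : ℕ+}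
    (c : (X.cells 0).carrier k) : f.map k c = g.map k c := by
  induction c using X.cells_zero_induction with
  | gen k x => exact h k x
  | one => rw [f.map_one, g.map_one]
  | comp E a b iha ihb => rw [f.map_comp, g.map_comp, iha, ihb]
  | zero k => rw [map_zero, map_zero]
  | add k a b iha ihb => rw [map_add, map_add, iha, ihb]
  | smul k r a ih => rw [map_smul, map_smul, ih]

/-! ### Linear sections -/

theorem exists_sec (h : X.presented.one ≠ 0) :
    ∃ σ : ∀ k, X.presented.carrier k →ₗ[K] (X.cells 0).carrier k,
      (∀ k x, X.proj.map k (σ k x) = x) ∧ σ 1 X.presented.one = (X.cells 0).one := by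
  have h1 : ∀ k, ∃ σ : X.presented.carrier k →ₗ[K] (X.cells 0).carrier k,
      X.proj.map k ∘ₗ σ = LinearMap.id := fun k =>
    (X.proj.map k).exists_rightInverse_of_surjective
      (LinearMap.range_eq_top.2 (X.proj_surjective k))
  choose σ hσ using h1
  obtain ⟨ℓ, hℓ⟩ : ∃ ℓ : X.presented.carrier 1 →ₗ[K] K, ℓ X.presented.one = 1 := by
    obtain ⟨ℓ, hℓ⟩ := Module.Projective.exists_dual_ne_zero K h
    exact ⟨(ℓ X.presented.one)⁻¹ • ℓ, inv_mul_cancel₀ hℓ⟩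
  -- The section is corrected in arity `1` by a multiple of `1 - σ(1)`, which lies in the kernel of
  -- the projection; the functional `ℓ` takes the value `1` on the unit.
  refine ⟨Function.update σ 1 (σ 1 + LinearMap.toSpanSingleton K _
    ((X.cells 0).one - σ 1 X.presented.one) ∘ₗ ℓ), fun k x => ?_, ?_⟩
  · have hσ' : ∀ k x, X.proj.map k (σ k x) = x := fun k x => LinearMap.congr_fun (hσ k) x
    rcases eq_or_ne k 1 with rfl | hk
    · rw [Function.update_self, LinearMap.add_apply, map_add, hσ', LinearMap.comp_apply,
        LinearMap.toSpanSingleton_apply, map_smul, map_sub, hσ', X.proj.map_one, sub_self, smul_zero,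
        add_zero]
    · rw [Function.update_of_ne hk, hσ']
  · rw [Function.update_self, LinearMap.add_apply, LinearMap.comp_apply,
      LinearMap.toSpanSingleton_apply, hℓ, one_smul, add_sub_cancel]

/-- On 1-cells of target zero, the source map has a linear right inverse over its range, which
extends to all 0-cells. That range contains the kernel of the projection, because `s(c) - t(c)` is
the source of `c - 1_{t(c)}`. -/
theorem exists_cell (k : ℕ+) : ∃ τ : (X.cells 0).carrier k →ₗ[K] (X.cells 1).carrier k,
    (∀ x, X.proj.map k x = 0 → (X.src 0).map k (τ x) = x) ∧ ∀ x, (X.tgt 0).map k (τ x) = 0 := by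
  set f := (X.src 0).map k ∘ₗ (LinearMap.ker ((X.tgt 0).map k)).subtype with hf
  obtain ⟨g, hg⟩ := f.rangeRestrict.exists_rightInverse_of_surjective f.range_rangeRestrict
  obtain ⟨τ, hτ⟩ := g.exists_extend
  refine ⟨(LinearMap.ker ((X.tgt 0).map k)).subtype ∘ₗ τ, fun x hx => ?_, fun x => (τ x).2⟩
  obtain ⟨c, rfl⟩ := X.exists_of_proj_eq_zero hx
  have hmem : (X.src 0).map k c - (X.tgt 0).map k c ∈ LinearMap.range f :=
    ⟨⟨c - (X.identHom 0).map k ((X.tgt 0).map k c), by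
      rw [LinearMap.mem_ker, map_sub, tgt_ident, sub_self]⟩, by
      change (X.src 0).map k (c - (X.identHom 0).map k ((X.tgt 0).map k c)) = _
      rw [map_sub, src_ident]⟩
  have e1 : τ ((X.src 0).map k c - (X.tgt 0).map k c) = g ⟨_, hmem⟩ := LinearMap.congr_fun hτ ⟨_, hmem⟩
  have e2 := congrArg Subtype.val (LinearMap.congr_fun hg ⟨_, hmem⟩)
  rw [LinearMap.comp_apply, e1]
  exact e2

theorem exists_splitPresentation (h : X.presented.one ≠ 0) :
    ∃ D : SplitPresentation X.presented (X.cells 0) (X.cells 1),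
      D.src = X.src 0 ∧ D.tgt = X.tgt 0 ∧ D.ident = X.identHom 0 ∧ D.proj = X.proj := by
  obtain ⟨σ, hσ, hσ1⟩ := X.exists_sec h
  choose τ hτ hτ' using X.exists_cell
  refine ⟨
    { src := X.src 0
      tgt := X.tgt 0
      ident := X.identHom 0
      proj := X.proj
      src_ident := fun _ x => X.src_ident x
      tgt_ident := fun _ x => X.tgt_ident x
      proj_src := fun _ x => X.proj_src x
      comp_eq_zero := fun E x y hx hy => ?_
      comp_eq_zero' := fun E x y hx hy => ?_
      sec := σ
      proj_sec := hσ
      sec_one := hσ1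
      cell := τ
      src_cell := hτ
      tgt_cell := hτ' }, rfl, rfl, rfl, rfl⟩
  · have e := X.comp_sub_src_sub_tgt 1 E x y
    change (X.cells 1).comp E (x - (X.identHom 0).map _ ((X.src 0).map _ x))
      (y - (X.identHom 0).map _ ((X.tgt 0).map _ y)) = 0 at e
    rwa [hx, hy, map_zero, map_zero, sub_zero, sub_zero] at e
  · have e := X.comp_sub_tgt_sub_src 1 E x y
    change (X.cells 1).comp E (x - (X.identHom 0).map _ ((X.tgt 0).map _ x))
      (y - (X.identHom 0).map _ ((X.src 0).map _ y)) = 0 at e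
    rwa [hx, hy, map_zero, map_zero, sub_zero, sub_zero] at e

end Polygraph
end ShuffleOp

/-! ### Lifts of 0-cells and defects of 1-cells. -/

namespace ShuffleOp

variable {K : Type u} [Field K]

open Tot ShuffleOperad
open Function (update)

section FamVal

variable {P O : ShuffleOperad K} (ι : ShuffleOperad.Hom P O)

/-- The family underlying an element of the coinduced bimodule. -/
noncomputable def famVal (k : ℕ+) :
    (famBimodule ι).carrier k →ₗ[K] Fam P.carrier O.carrier k :=
  (famSpace K P.carrier O.carrier k).subtype

theorem famVal_lact {k l n : ℕ+} (E : Shuf k l n) (x : P.carrier k)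
    (φ : (famBimodule ι).carrier l) : famVal ι n ((famBimodule ι).lact E x φ) =
      graft E (Tot.map ι.map) (actFam O (ι.map k x)) (famVal ι l φ) := rfl

theorem famVal_ract {k l n : ℕ+} (E : Shuf k l n) (φ : (famBimodule ι).carrier k)
    (y : P.carrier l) : famVal ι n ((famBimodule ι).ract E φ y) =
      graft E id (famVal ι k φ) (actFam P y) := rfl

end FamVal

namespace SplitPresentation

variable {P F C : ShuffleOperad K} {D : SplitPresentation P F C}

/-- The family of cells that a morphism to the operad of lifts attaches to a `0`-cell. -/
noncomputable def fam (Φ : Hom F D.liftOperad) (k : ℕ+) :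
    F.carrier k →ₗ[K] Fam P.carrier C.carrier k :=
  (famSpace K P.carrier C.carrier k).subtype ∘ₗ LinearMap.snd K _ _ ∘ₗ (D.lifts k).subtype ∘ₗ
    Φ.map k

variable {Φ : Hom F D.liftOperad}

theorem isFam_fam {k : ℕ+} (x : F.carrier k) : IsFam K (fam Φ k x) := (Φ.map k x).1.2.2

theorem isLift_fam (hΦ : ∀ k x, D.liftOperadFst.map k (Φ.map k x) = x) {k : ℕ+}
    (x : F.carrier k) : D.IsLift x (fam Φ k x) := by
  have h : D.IsLift (D.liftOperadFst.map k (Φ.map k x)) (fam Φ k x) := (Φ.map k x).2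
  rwa [hΦ] at h

theorem fam_one : fam Φ 1 F.one = 0 := by
  change (Φ.map 1 F.one).1.2.1 = 0
  rw [Φ.map_one]
  rfl

theorem fam_comp (hΦ : ∀ k x, D.liftOperadFst.map k (Φ.map k x) = x) {k l n : ℕ+}
    (E : Shuf k l n) (x : F.carrier k) (y : F.carrier l) (m : Fin n ↪o ℕ)
    (a : ℕ → Tot P.carrier) :
    fam Φ n (F.comp E x y) m a =
      graft E D.rep (actFam C (D.ident.map k x)) (fam Φ l y) m a +
        graft E id (fam Φ k x) (actFam P (D.proj.map l y)) m a := by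
  change (Φ.map n (F.comp E x y)).1.2.1 m a = _
  rw [Φ.map_comp]
  change graft E D.rep (actFam C (D.ident.map k (D.liftOperadFst.map k (Φ.map k x)))) _ m a +
    graft E id _ (actFam P (D.proj.map l (D.liftOperadFst.map l (Φ.map l y)))) m a = _
  rw [hΦ, hΦ]
  rfl

/-- Evaluating a lift on units recovers the 0-cell itself. This is the purpose of the normalization
`sec_one`. -/
theorem src_fam_unit (hΦ : ∀ k x, D.liftOperadFst.map k (Φ.map k x) = x) {k : ℕ+}
    {x : F.carrier k} (hx : D.proj.map k x = 0) (m : Fin k ↪o ℕ) :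
    map D.src.map (fam Φ k x m (unit P)) = of (K := K) m x := by
  rw [(isLift_fam hΦ x).src, hx, map_zero, map_zero, sub_zero, ← act_unit m x]
  congr 2
  funext p
  rw [unit, map_of, D.sec_one]
  rfl

variable (Φ)

/-- The difference between the composites of the difference of a `1`-cell with the identity of its
target and the chosen lift of its boundary. -/
noncomputable def defect (k : ℕ+) : C.carrier k →ₗ[K] Fam P.carrier C.carrier k :=
  LinearMap.pi fun m => LinearMap.pi fun a =>
    act C m (fun p => D.rep (a p)) ∘ₗ (LinearMap.id - D.ident.map k ∘ₗ D.tgt.map k) -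
      (LinearMap.proj a ∘ₗ LinearMap.proj m) ∘ₗ fam Φ k ∘ₗ (D.src.map k - D.tgt.map k)

variable {Φ}

theorem defect_apply {k : ℕ+} (x : C.carrier k) (m : Fin k ↪o ℕ) (a : ℕ → Tot P.carrier) :
    defect Φ k x m a = act C m (fun p => D.rep (a p)) (x - D.ident.map k (D.tgt.map k x)) -
      fam Φ k (D.src.map k x - D.tgt.map k x) m a := rfl

theorem isFam_defect {k : ℕ+} (x : C.carrier k) : IsFam K (defect Φ k x) := by
  have h1 := ((isFam_act (x - D.ident.map k (D.tgt.map k x))).comap D.ident.map).comap D.sec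
  exact (famSpace K P.carrier C.carrier k).sub_mem h1
    (isFam_fam (Φ := Φ) (D.src.map k x - D.tgt.map k x))

/-- Source and target of a 1-cell have the same image in `P`, so the lift of their difference has no
term in `σ`, and both parts of the defect have the same source. -/
theorem src_defect (hΦ : ∀ k x, D.liftOperadFst.map k (Φ.map k x) = x) {k : ℕ+}
    (x : C.carrier k) (m : Fin k ↪o ℕ) (a : ℕ → Tot P.carrier) :
    map D.src.map (defect Φ k x m a) = 0 := by
  have h : (fun p => map D.src.map (D.rep (a p))) = fun p => map D.sec (a p) := by
    funext p; exact map_map_eq_self D.src_ident _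
  rw [defect_apply, map_sub, (isLift_fam hΦ _).src, map_act, map_sub (D.proj.map k), D.proj_src,
    sub_self, map_zero, map_zero, sub_zero, map_sub (D.src.map k), D.src_ident, h, sub_self]

theorem tgt_defect (hΦ : ∀ k x, D.liftOperadFst.map k (Φ.map k x) = x) {k : ℕ+}
    (x : C.carrier k) (m : Fin k ↪o ℕ) (a : ℕ → Tot P.carrier) :
    map D.tgt.map (defect Φ k x m a) = 0 := by
  rw [defect_apply, map_sub, (isLift_fam hΦ _).tgt, map_act, map_sub (D.tgt.map k), D.tgt_ident,
    sub_self, map_zero, sub_zero]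

theorem defect_ident {k : ℕ+} (x : F.carrier k) : defect Φ k (D.ident.map k x) = 0 := by
  funext m a
  rw [defect_apply, D.src_ident, D.tgt_ident, sub_self, sub_self, map_zero, map_zero]
  exact sub_zero _

/-- The defect obeys the same Leibniz rule as the bracket, which lets it factor through the bracket.
Both `x ∘ y - 1_{t(x ∘ y)}` and its boundary are split by moving along `x` first; what remains is to
replace `s(y)(σa)` by the representative of its image, and the lift `ψ` of `s(y)` pays for the
difference. -/
theorem defect_comp (hΦ : ∀ k x, D.liftOperadFst.map k (Φ.map k x) = x) {k l n : ℕ+}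
    (E : Shuf k l n) (x : C.carrier k) (y : C.carrier l) (m : Fin n ↪o ℕ)
    (a : ℕ → Tot P.carrier) :
    defect Φ n (C.comp E x y) m a =
      graft E id (defect Φ k x) (actFam P (D.proj.map l (D.src.map l y))) m a +
        graft E D.rep (actFam C (D.ident.map k (D.tgt.map k x))) (defect Φ l y) m a := by
  have h1 : C.comp E x y - D.ident.map n (D.tgt.map n (C.comp E x y)) =
      C.comp E (x - D.ident.map k (D.tgt.map k x)) (D.ident.map l (D.src.map l y)) +
        C.comp E (D.ident.map k (D.tgt.map k x)) (y - D.ident.map l (D.tgt.map l y)) := by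
    have h := D.comp_eq_zero' E (x - D.ident.map k (D.tgt.map k x))
      (y - D.ident.map l (D.src.map l y)) (by rw [map_sub, D.tgt_ident, sub_self])
      (by rw [map_sub, D.src_ident, sub_self])
    rw [map_sub (C.comp E _), sub_eq_zero] at h
    rw [← h, D.tgt.map_comp, D.ident.map_comp, map_sub, map_sub, LinearMap.sub_apply]
    abel
  have h2 : D.src.map n (C.comp E x y) - D.tgt.map n (C.comp E x y) =
      F.comp E (D.src.map k x - D.tgt.map k x) (D.src.map l y) +
        F.comp E (D.tgt.map k x) (D.src.map l y - D.tgt.map l y) := by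
    rw [D.src.map_comp, D.tgt.map_comp, map_sub, map_sub, LinearMap.sub_apply]
    abel
  have h3 : D.proj.map l (D.src.map l y - D.tgt.map l y) = 0 := by
    rw [map_sub, D.proj_src, sub_self]
  rw [defect_apply, h1, h2, map_add, map_add, Pi.add_apply, Pi.add_apply, act_comp, act_comp,
    fam_comp hΦ, fam_comp hΦ, h3]
  set X := x - D.ident.map k (D.tgt.map k x) with hX
  have sX : D.src.map k X = D.src.map k x - D.tgt.map k x := by
    rw [hX, map_sub, D.src_ident]
  have tX : D.tgt.map k X = 0 := by
    rw [hX, map_sub, D.tgt_ident, sub_self]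
  set μ : Fin k ↪o ℕ := E.root.trans m with hμ
  set ν : Fin l ↪o ℕ := E.leaf.trans m with hν
  have hp : m (E.root E.pos) = μ E.pos := rfl
  simp only [graft, actFam, ← hμ, ← hν, hp, id]
  have h4 : fam Φ k (D.tgt.map k x) μ (update a (μ E.pos) (act P ν a 0)) = 0 := by
    rw [map_zero]; exact (isFam_fam _).update_zero _ _ _
  set R := fun p => D.rep (a p) with hR
  set ψ := fam Φ l (D.src.map l y) ν a with hψ
  have tψ : map D.tgt.map ψ = 0 := (isLift_fam hΦ _).tgt _ _
  have h5 : map D.ident.map (map D.src.map ψ) = act C ν R (D.ident.map l (D.src.map l y)) -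
      D.rep (act P ν a (D.proj.map l (D.src.map l y))) := by
    rw [(isLift_fam hΦ _).src, map_sub, map_act]
    rfl
  -- Composition with `X`, whose target is zero, does not distinguish `ψ` from the identity of its
  -- source.
  have h6 := D.act_update_eq_zero' μ E.pos R (x := X)
    (v := ψ - map D.ident.map (map D.src.map ψ)) tX
    (by rw [map_sub, map_map_eq_self D.src_ident, sub_self])
  -- Since `ψ` has target zero, `X` may be replaced by the identity of its source; this is the term
  -- that occurs in the lift of the composite.
  have h7 := D.act_update_eq_zero μ E.pos R (x := X - D.ident.map k (D.src.map k X)) (v := ψ)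
    (by rw [map_sub, D.src_ident, sub_self]) tψ
  rw [h5, act_update_sub, act_update_sub] at h6
  rw [map_sub, sX] at h7
  rw [h4, defect_apply, defect_apply, act_update_sub, update_comp (fun z => D.rep z)]
  simp only [← hX, ← hR]
  rw [sub_eq_zero] at h6 h7
  rw [← h7, h6]
  abel

end SplitPresentation
end ShuffleOp

/-! ### What the bracket remembers of 0-cells and 1-cells. -/

namespace ShuffleOp

variable {K : Type u} [Field K]

namespace Polygraph

open CellExpr Tot ShuffleOperad SplitPresentation
open Function (update)

variable (X : Polygraph K)

/-- The morphism to the square-zero extension given by the bracket. -/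
def bracketHom (n : ℕ) : Hom (X.cells n)
    (semidirect (Hom.id X.presented) (freeBimodule X.presented (X.gens n))) where
  map k := LinearMap.prod ((X.barHom n).map k) (X.bracket n k)
  map_one := Prod.ext (X.barHom n).map_one (X.bracket_one n)
  map_comp E a b := Prod.ext ((X.barHom n).map_comp E a b) (X.bracket_comp E a b)

/-- Freeness of the operad of 0-cells extends the lifts chosen on generators. The result is a
section of the projection, since two morphisms that agree on generators are equal. -/
theorem exists_splitPresentation_lift (h : X.presented.one ≠ 0) :
    ∃ (D : SplitPresentation X.presented (X.cells 0) (X.cells 1))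
      (Φ : Hom (X.cells 0) D.liftOperad),
      D.src = X.src 0 ∧ D.tgt = X.tgt 0 ∧ D.ident = X.identHom 0 ∧ D.proj = X.proj ∧
        ∀ k x, D.liftOperadFst.map k (Φ.map k x) = x := by
  obtain ⟨D, h1, h2, h3, h4⟩ := X.exists_splitPresentation h
  refine ⟨D, X.zeroLift (fun k x => ⟨(X.cell (gen x), D.genFam (X.cell (gen x))),
    D.isLift_genFam _⟩), h1, h2, h3, h4, fun k x => ?_⟩
  exact X.hom_zero_ext (f := D.liftOperadFst.comp (X.zeroLift _)) (g := Hom.id _)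
    (fun _ _ => rfl) x

/-- A `0`-cell with trivial image and trivial bracket is the source of a `1`-cell with target `0`
and trivial bracket. -/
theorem exists_src_eq_of_bracket_eq_zero (h : X.presented.one ≠ 0) {k : ℕ+}
    {c : (X.cells 0).carrier k} (hc : X.proj.map k c = 0) (hb : X.bracket 0 k c = 0) :
    ∃ T : (X.cells 1).carrier k, (X.src 0).map k T = c ∧ (X.tgt 0).map k T = 0 ∧
      X.bracket 1 k T = 0 := by
  obtain ⟨D, Φ, hs, ht, hi, hp, hΦ⟩ := X.exists_splitPresentation_lift h
  set M := freeBimodule X.presented (X.gens 1)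
  set β := X.bracketHom 1 with hβ
  set ι := semidirectInl (Hom.id X.presented) M with hι
  let H : Bimodule.Hom (freeBimodule X.presented (X.gens 0)) (famBimodule ι) :=
    freeBimodule.lift (B := famBimodule ι) (fun k x =>
      ⟨_, (isFam_fam (Φ := Φ) (X.cell (gen x))).map β.map⟩)
  have hβι : ∀ k x, β.map k (D.ident.map k x) = ι.map k (D.proj.map k x) := by
    intro k x
    rw [hi, hp]
    exact Prod.ext (X.barHom_identIter 1 x) (X.bracket_ident x)
  -- Lifts of composites are given by `fam_comp`, which after the bracket is the Leibniz rule of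
  -- `famBimodule`. Hence the image of the lift depends only on the bracket of `c`.
  have key : ∀ (k : ℕ+) (c : (X.cells 0).carrier k) (m : Fin k ↪o ℕ)
      (a : ℕ → Tot X.presented.carrier),
      famVal ι k (H.map k (X.bracket 0 k c)) m a = map β.map (fam Φ k c m a) := by
    intro k c
    induction c using X.cells_zero_induction with
    | gen k x => intro m a; rfl
    | one =>
      intro m a
      rw [bracket_one, map_zero, map_zero, fam_one]
      exact (map_zero (map β.map)).symm
    | @comp k l n E x y ihx ihy =>
      intro m a
      have e1 := map_graft E β (j := D.rep) (j' := map ι.map) (fun z => ?_)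
        (D.ident.map k x) (fam Φ l y) m a
      · rw [bracket_comp, map_add, map_add, Bimodule.Hom.map_lact, Bimodule.Hom.map_ract,
          famVal_lact, famVal_ract, fam_comp hΦ, Pi.add_apply, Pi.add_apply, map_add, e1, hβι, hp, add_comm]
        refine congrArg₂ (· + ·) ?_ ?_
        · have e : famVal ι l (H.map l (X.bracket 0 l y)) = fun m a => map β.map (fam Φ l y m a) :=
            funext fun m => funext fun a => ihy m a
          rw [e]; rfl
        · exact ihx _ _
      · have e : D.rep z = map D.ident.map (map D.sec z) := rfl
        rw [e]
        refine ext_component (K := K) fun k m => ?_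
        change β.map k (D.ident.map k (D.sec k _)) = ι.map k _
        rw [hβι, D.proj_sec]
    | zero k =>
      intro m a
      rw [map_zero, map_zero, map_zero, map_zero]
      exact (map_zero (map β.map)).symm
    | add k x y ihx ihy =>
      intro m a
      rw [map_add, map_add, map_add, map_add, Pi.add_apply, Pi.add_apply, Pi.add_apply,
        Pi.add_apply, map_add, ihx, ihy]
    | smul k r x ih =>
      intro m a
      rw [map_smul, map_smul, map_smul, map_smul, Pi.smul_apply, Pi.smul_apply, Pi.smul_apply,
        Pi.smul_apply, map_smul, ih]
  set m : Fin k ↪o ℕ := Fin.valOrderEmb k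
  -- Evaluation on units gives one labelled 1-cell; any labelling of the inputs would serve.
  set z := fam Φ k c m (unit X.presented) with hz
  have h1 : map β.map z = 0 := by
    rw [hz, ← key, hb, map_zero, map_zero]; rfl
  have h2 : map D.src.map z = of (K := K) m c := src_fam_unit hΦ (by rw [hp, hc]) m
  have h3 : map D.tgt.map z = 0 := (isLift_fam hΦ c).tgt _ _
  refine ⟨component (K := K) m z, ?_, ?_, ?_⟩
  · rw [← hs, ← component_map, h2, component_of]
  · rw [← ht, ← component_map, h3, map_zero]
  · have e := congrArg (component (K := K) m) h1
    exact congrArg Prod.snd e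

/-- The morphism from the square-zero extension of `0`-cells by null cells to `1`-cells. -/
def nullExtension : Hom (semidirect X.proj (X.nullBimodule 0)) (X.cells 1) where
  map k := LinearMap.coprod ((X.identHom 0).map k) (X.nullVal 0 k)
  map_one := by
    change (X.identHom 0).map 1 (X.cells 0).one + X.nullVal 0 1 0 = _
    rw [map_zero, add_zero, Hom.map_one]
  map_comp {k l n} E x y := by
    change (X.identHom 0).map n ((X.cells 0).comp E x.1 y.1) +
      X.nullVal 0 n ((X.nullBimodule 0).ract E x.2 (X.proj.map l y.1) +
        (X.nullBimodule 0).lact E (X.proj.map k x.1) y.2) =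
      (X.cells 1).comp E ((X.identHom 0).map k x.1 + X.nullVal 0 k x.2)
        ((X.identHom 0).map l y.1 + X.nullVal 0 l y.2)
    have e : (X.cells 1).comp E (X.nullVal 0 k x.2) (X.nullVal 0 l y.2) = 0 := by
      have hx := X.nullVal_mem x.2
      have hy := X.nullVal_mem y.2
      -- The product of two null cells vanishes, so null cells do form a square-zero ideal.
      rw [comp_null E hx, hy.1, map_zero, map_zero]
    have e1 := X.nullVal_ract E x.2 ((X.identHom 0).map l y.1)
    have e2 := X.nullVal_lact E ((X.identHom 0).map k x.1) y.2
    rw [← barHom_src, src_ident] at e1 e2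
    rw [map_add (X.nullVal 0 n), map_add, map_add, LinearMap.add_apply, LinearMap.add_apply, e,
      Hom.map_comp]
    refine (congrArg₂ (fun u v => _ + (u + v)) e1 e2).trans ?_
    abel

/-- A `1`-cell with trivial source, target and bracket is trivial. -/
theorem eq_zero_of_mem_nullCells_of_bracket_eq_zero (h : X.presented.one ≠ 0) {k : ℕ+}
    {c : (X.cells 1).carrier k} (hcs : (X.src 0).map k c = 0) (hct : (X.tgt 0).map k c = 0)
    (hb : X.bracket 1 k c = 0) : c = 0 := by
  obtain ⟨D, Φ, hs, ht, hi, hp, hΦ⟩ := X.exists_splitPresentation_lift h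
  set M := X.nullBimodule 0 with hM
  set ι := semidirectInl (Hom.id X.presented) M with hι
  -- This retraction onto null cells is only linear, not compatible with composition; it will be
  -- applied only to values that are null.
  have hr : ∀ k, ∃ r : (X.cells 1).carrier k →ₗ[K] M.carrier k,
      r ∘ₗ X.nullVal 0 k = LinearMap.id := fun k =>
    (X.nullVal 0 k).exists_leftInverse_of_injective
      (LinearMap.ker_eq_bot.2 (X.nullVal_injective 0 k))
  choose r hr using hr
  have hr1 : ∀ k z, r k (X.nullVal 0 k z) = z := fun k z => LinearMap.congr_fun (hr k) z
  have hr2 : ∀ k z, (X.src 0).map k z = 0 → (X.tgt 0).map k z = 0 →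
      X.nullVal 0 k (r k z) = z := by
    intro k z h1 h2
    exact congrArg (X.nullVal 0 k) (hr1 k ⟨z, ⟨h1, h2⟩⟩)
  let lam : ∀ k, (X.cells 1).carrier k →ₗ[K] (semidirect (Hom.id X.presented) M).carrier k :=
    fun k => LinearMap.inr K (X.presented.carrier k) (M.carrier k) ∘ₗ r k
  -- On null arguments the map `lam` respects composition with identities. The composite is formed
  -- once in the square-zero extension of 0-cells by null cells, and compared with both sides
  -- through morphisms of operads.
  have act_lam : ∀ (k : ℕ+) (u : (X.cells 0).carrier k) (m : Fin k ↪o ℕ) (i : Fin k)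
      (a : ℕ → Tot X.presented.carrier) (z : Tot (X.cells 1).carrier),
      map D.src.map z = 0 → map D.tgt.map z = 0 →
      map lam (act (X.cells 1) m (update (fun p => D.rep (a p)) (m i) z) (D.ident.map k u)) =
        act (semidirect (Hom.id X.presented) M) m
          (update (fun p => map ι.map (a p)) (m i) (map lam z)) (ι.map k (X.proj.map k u)) := by
    intro k u m i a z hz1 hz2
    set O := semidirect X.proj M
    let inr : ∀ k, M.carrier k →ₗ[K] O.carrier k := fun k =>
      LinearMap.inr K ((X.cells 0).carrier k) (M.carrier k)
    set inl := semidirectInl X.proj M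
    set d := act O m (update (fun p => map inl.map (map D.sec (a p))) (m i) (map inr (map r z)))
      (inl.map k u) with hd
    have hj : map X.nullExtension.map d =
        act (X.cells 1) m (update (fun p => D.rep (a p)) (m i) z) (D.ident.map k u) := by
      rw [hd, map_act, update_comp]
      have e1 : X.nullExtension.map k (inl.map k u) = D.ident.map k u := by
        rw [hi]
        change (X.identHom 0).map k u + X.nullVal 0 k 0 = _
        rw [map_zero, add_zero]
      have e2 : map X.nullExtension.map (map inr (map r z)) = z := by
        refine ext_component (K := K) fun k m => ?_
        change (X.identHom 0).map k 0 + X.nullVal 0 k (r k (component (K := K) m z)) = _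
        rw [map_zero]
        refine (zero_add _).trans (hr2 k _ ?_ ?_)
        · rw [← hs, ← component_map, hz1, map_zero]
        · rw [← ht, ← component_map, hz2, map_zero]
      have e3 : ∀ x, map X.nullExtension.map (map inl.map (map D.sec x)) = D.rep x := by
        intro x
        have e : D.rep x = map D.ident.map (map D.sec x) := rfl
        rw [e, hi]
        refine ext_component (K := K) fun k m => ?_
        change (X.identHom 0).map k _ + X.nullVal 0 k 0 = _
        rw [map_zero, add_zero]
        rfl
      rw [e1, e2]
      simp only [e3]
    have hq : map (semidirectMap X.proj M).map d = act (semidirect (Hom.id X.presented) M) m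
          (update (fun p => map ι.map (a p)) (m i) (map lam z)) (ι.map k (X.proj.map k u)) := by
      rw [hd, map_act, update_comp]
      have e1 : (semidirectMap X.proj M).map k (inl.map k u) = ι.map k (X.proj.map k u) := rfl
      have e2 : map (semidirectMap X.proj M).map (map inr (map r z)) = map lam z := by
        refine ext_component (K := K) fun k m => ?_
        exact Prod.ext (map_zero (X.proj.map k)) rfl
      have e3 : ∀ x, map (semidirectMap X.proj M).map (map inl.map (map D.sec x)) =
          map ι.map x := by
        intro x
        refine ext_component (K := K) fun k m => ?_
        refine Prod.ext ?_ rfl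
        change X.proj.map k (D.sec k _) = _
        rw [← hp, D.proj_sec]
        rfl
      rw [e1, e2]
      simp only [e3]
    -- The 0-cell component of `d` is zero, so `d` is a purely null element and its two images
    -- correspond under `lam`.
    have hf : map (semidirectFst X.proj M).map d = 0 := by
      rw [hd, map_act, update_comp]
      have e2 : map (semidirectFst X.proj M).map (map inr (map r z)) = 0 :=
        map_map_eq_zero (fun _ _ => rfl) _
      rw [e2]
      exact act_update_zero m i _ _
    rw [← hj, ← hq]
    refine ext_component (K := K) fun k m => ?_
    have hf' := congrArg (component (K := K) m) hf
    change (component (K := K) m d).1 = 0 at hf'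
    change (0, r k ((X.identHom 0).map k (component (K := K) m d).1 +
      X.nullVal 0 k (component (K := K) m d).2)) =
        (X.proj.map k (component (K := K) m d).1, (component (K := K) m d).2)
    rw [hf', map_zero, map_zero, zero_add, hr1]
  let H : Bimodule.Hom (freeBimodule X.presented (X.gens 1)) (famBimodule ι) :=
    freeBimodule.lift (B := famBimodule ι) (fun k x =>
      ⟨_, (isFam_defect (Φ := Φ) (X.cell (gen x))).map lam⟩)
  -- By `defect_comp` and `act_lam`, the defect of a 1-cell is a function of its bracket.
  have key : ∀ (k : ℕ+) (c : (X.cells 1).carrier k) (m : Fin k ↪o ℕ)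
      (a : ℕ → Tot X.presented.carrier),
      famVal ι k (H.map k (X.bracket 1 k c)) m a = map lam (defect Φ k c m a) := by
    intro k c
    induction c using X.cells_succ_induction with
    | gen k x => intro m a; rfl
    | ident k x =>
      intro m a
      rw [bracket_ident, map_zero, map_zero, ← hi, defect_ident]
      exact (map_zero (map lam)).symm
    | one =>
      intro m a
      rw [bracket_one, map_zero, map_zero, ← D.ident.map_one, defect_ident]
      exact (map_zero (map lam)).symm
    | @comp k l n E x y ihx ihy =>
      intro m a
      rw [bracket_comp, map_add, map_add, Bimodule.Hom.map_lact, Bimodule.Hom.map_ract,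
        famVal_lact, famVal_ract, defect_comp hΦ, Pi.add_apply, Pi.add_apply, map_add]
      refine congrArg₂ (· + ·) ?_ ?_
      · rw [hs, hp]
        exact ihx _ _
      · refine Eq.trans ?_ (act_lam k (D.tgt.map k x) (E.root.trans m) E.pos a
          (defect Φ l y (E.leaf.trans m) a) (src_defect hΦ _ _ _) (tgt_defect hΦ _ _ _)).symm
        rw [← ihy, ht, ← barHom_tgt]
        rfl
    | zero k =>
      intro m a
      rw [map_zero, map_zero, map_zero, map_zero]
      exact (map_zero (map lam)).symm
    | add k x y ihx ihy =>
      intro m a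
      rw [map_add, map_add, map_add, map_add, Pi.add_apply, Pi.add_apply, Pi.add_apply,
        Pi.add_apply, map_add, ihx, ihy]
    | smul k r x ih =>
      intro m a
      rw [map_smul, map_smul, map_smul, map_smul, Pi.smul_apply, Pi.smul_apply, Pi.smul_apply,
        Pi.smul_apply, map_smul, ih]
  set m : Fin k ↪o ℕ := Fin.valOrderEmb k
  have e := key k c m (unit X.presented)
  have hrep : (fun p => D.rep (unit X.presented p)) = unit (X.cells 1) := by
    funext p
    change map D.ident.map (map D.sec (unit X.presented p)) = _
    rw [unit, map_of, D.sec_one]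
    exact map_unit D.ident p
  -- With zero source and target there is nothing to lift, so on units the defect is the cell `c`
  -- itself.
  rw [hb, map_zero, map_zero, defect_apply, hs, ht, hcs, hct, map_zero, sub_zero, sub_zero,
    map_zero, hrep, act_unit] at e
  have e' : (0 : Tot (semidirect (Hom.id X.presented) M).carrier) =
      map lam (of (K := K) m c) := by
    refine e.trans (congrArg (map lam) ?_)
    exact sub_zero _
  have e2 := congrArg (component (K := K) m) e'
  rw [map_of, component_of, map_zero] at e2
  have e3 : r k c = 0 := (congrArg Prod.snd e2).symm
  rw [← hr2 k c hcs hct, e3, map_zero]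

end Polygraph
end ShuffleOp

/-! ### The trivial bimodule, exactness at the unit term, and minimality. -/

namespace ShuffleOp

variable {K : Type u} [Field K]

/-! ### Elementary shuffles -/

namespace Shuf

theorem nested_underRoot {k l n : ℕ+} (E : Shuf k l n) :
    Nested (underRoot k) E E (underRoot n) where
  pos_F := rfl
  pos_E := rfl
  root_root _ := E.root_zero
  root_leaf _ := rfl
  leaf_leaf _ := rfl

theorem nested_onLeaf_leaf {k l n : ℕ+} (E : Shuf k l n) (b : Fin l) :
    Nested E (onLeaf n (E.leaf b)) (onLeaf l b) E where
  pos_F := rfl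
  pos_E := rfl
  root_root _ := rfl
  root_leaf _ := rfl
  leaf_leaf _ := rfl

theorem nested_onLeaf_pos {k l n : ℕ+} (E : Shuf k l n) :
    Nested (onLeaf k E.pos) E (underRoot l) E where
  pos_F := rfl
  pos_E := rfl
  root_root _ := rfl
  root_leaf _ := E.base.symm
  leaf_leaf _ := rfl

theorem parallel_onLeaf_root {k l n : ℕ+} (E : Shuf k l n) {a : Fin k} (h : a ≠ E.pos) :
    Parallel (onLeaf k a) E E (onLeaf n (E.root a)) where
  ne := h
  pos_F := rfl
  pos_H := rfl
  root_root _ := rfl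
  root_leaf _ := rfl
  leaf_root _ := rfl

/-- The inputs of a composite are those of the upper element and those of the root, except the one
at which the grafting takes place. -/
theorem sum_eq {k l n : ℕ+} (E : Shuf k l n) {M : Type*} [AddCommGroup M] (f : Fin n → M) :
    ∑ c, f c = ∑ b, f (E.leaf b) + (∑ a, f (E.root a) - f (E.root E.pos)) := by
  classical
  have h : (Finset.univ : Finset (Fin n)) = Finset.univ.map E.leaf.toEmbedding ∪
      (Finset.univ.erase E.pos).map E.root.toEmbedding := by
    ext c
    simp only [Finset.mem_univ, Finset.mem_union, Finset.mem_map, true_and, true_iff,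
      Finset.mem_erase, and_true]
    rcases E.cover c with ⟨a, rfl⟩ | ⟨b, rfl⟩
    · by_cases ha : a = E.pos
      · exact Or.inl ⟨⟨0, l.pos⟩, by rw [ha]; exact E.base⟩
      · exact Or.inr ⟨a, ha, rfl⟩
    · exact Or.inl ⟨b, rfl⟩
  have hd : Disjoint (Finset.univ.map E.leaf.toEmbedding)
      ((Finset.univ.erase E.pos).map E.root.toEmbedding) := by
    rw [Finset.disjoint_left]
    intro c hc hc'
    obtain ⟨b, -, rfl⟩ := Finset.mem_map.1 hc
    obtain ⟨a, ha, e⟩ := Finset.mem_map.1 hc'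
    exact (Finset.mem_erase.1 ha).1 (E.inter a b e)
  rw [h, Finset.sum_union hd, Finset.sum_map, Finset.sum_map]
  congr 1
  exact Finset.sum_erase_eq_sub (Finset.mem_univ _)

theorem eq_of_unit_left {l n : ℕ+} (E : Shuf 1 l n) : n = l := by
  have h : Function.Surjective E.leaf := fun c => by
    rcases E.cover c with ⟨a, rfl⟩ | h
    · exact ⟨⟨0, l.pos⟩, by rw [E.base, Subsingleton.elim a E.pos]⟩
    · exact h
  have e := Fintype.card_of_bijective ⟨E.leaf.injective, h⟩
  rw [Fintype.card_fin, Fintype.card_fin] at e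
  exact PNat.eq e.symm

theorem eq_of_unit_right {k n : ℕ+} (E : Shuf k 1 n) : n = k := by
  have h : Function.Surjective E.root := fun c => by
    rcases E.cover c with h | ⟨b, rfl⟩
    · exact h
    · exact ⟨E.pos, by rw [← E.base, Subsingleton.elim b ⟨0, PNat.pos 1⟩]⟩
  have e := Fintype.card_of_bijective ⟨E.root.injective, h⟩
  rw [Fintype.card_fin, Fintype.card_fin] at e
  exact PNat.eq e.symm

end Shuf

/-! ### The universal derivation to the trivial bimodule -/

/-- This disposes of the degenerate case in which no section can preserve the unit. -/
theorem Bimodule.eq_zero_of_one_eq_zero {P : ShuffleOperad K} (h : P.one = 0) (A : Bimodule P)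
    {k : ℕ+} (a : A.carrier k) : a = 0 := by
  rw [← A.one_lact (Shuf.underRoot k) a, h, map_zero, LinearMap.zero_apply]

section EpsRel

variable (P : ShuffleOperad K)

/-- The elements `(ε | x) - ∑ i, x ∘_i ε` depend linearly on `x`. -/
def epsRelLinear (k : ℕ+) : P.carrier k →ₗ[K] (freeBimodule P UnitIndexed.{u}).carrier k :=
  (freeBimodule P UnitIndexed).ract (Shuf.underRoot k) (eps P) -
    ∑ i : Fin k, ((freeBimodule P UnitIndexed).lact (Shuf.onLeaf k i)).flip (eps P)

theorem epsRelLinear_apply {k : ℕ+} (x : P.carrier k) : epsRelLinear P k x = epsRel P x := by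
  rw [epsRelLinear, LinearMap.sub_apply, LinearMap.sum_apply]
  rfl

theorem epsRelLinear_one : epsRelLinear P 1 P.one = 0 := by
  rw [epsRelLinear_apply, epsRel, Bimodule.ract_one, Fintype.sum_subsingleton _ ⟨0, PNat.pos 1⟩,
    Bimodule.one_lact, sub_self]

/-- The relation of `Ω_P` is a derivation in `x`. When the inputs of the composite are split by
`sum_eq`, the missing term at the grafting position is `x ∘ (ε | y)`, which also occurs in the
second summand. -/
theorem epsRelLinear_comp {k l n : ℕ+} (E : Shuf k l n) (x : P.carrier k) (y : P.carrier l) :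
    epsRelLinear P n (P.comp E x y) =
      (freeBimodule P UnitIndexed).ract E (epsRelLinear P k x) y +
        (freeBimodule P UnitIndexed).lact E x (epsRelLinear P l y) := by
  simp only [epsRelLinear_apply, epsRel]
  rw [← Bimodule.nested_right _ (Shuf.nested_underRoot E), E.sum_eq, map_sub, map_sub, map_sum,
    map_sum, LinearMap.sub_apply, LinearMap.sum_apply]
  have h1 : ∀ b, (freeBimodule P UnitIndexed).lact (Shuf.onLeaf n (E.leaf b)) (P.comp E x y)
      (eps P) = (freeBimodule P UnitIndexed).lact E x
        ((freeBimodule P UnitIndexed).lact (Shuf.onLeaf l b) y (eps P)) := fun b =>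
    Bimodule.nested_left _ (Shuf.nested_onLeaf_leaf E b) _ _ _
  have h2 : ∑ a, (freeBimodule P UnitIndexed).lact (Shuf.onLeaf n (E.root a)) (P.comp E x y)
      (eps P) - (freeBimodule P UnitIndexed).lact (Shuf.onLeaf n (E.root E.pos)) (P.comp E x y)
      (eps P) = ∑ a, (freeBimodule P UnitIndexed).ract E
        ((freeBimodule P UnitIndexed).lact (Shuf.onLeaf k a) x (eps P)) y -
        (freeBimodule P UnitIndexed).ract E
        ((freeBimodule P UnitIndexed).lact (Shuf.onLeaf k E.pos) x (eps P)) y := by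
    rw [← Finset.sum_erase_eq_sub (Finset.mem_univ _), ← Finset.sum_erase_eq_sub (Finset.mem_univ _)]
    refine Finset.sum_congr rfl fun a ha => ?_
    exact (Bimodule.parallel_leaf _ (Shuf.parallel_onLeaf_root E (Finset.mem_erase.1 ha).1)
      _ _ _).symm
  have h3 := Bimodule.nested_mid (freeBimodule P UnitIndexed) (Shuf.nested_onLeaf_pos E) x (eps P) y
  rw [h2, Finset.sum_congr rfl (fun b _ => h1 b), h3]
  abel

end EpsRel

namespace Polygraph

open CellExpr ShuffleOperad

variable (X : Polygraph K)

/-- The boundary morphism to the free bimodule on the unit indexed set. -/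
def unitBoundary : Bimodule.Hom (freeBimodule X.presented (X.gens 0))
    (freeBimodule X.presented UnitIndexed) := X.boundary 0

theorem unitBoundary_bracket {k : ℕ+} (c : (X.cells 0).carrier k) :
    X.unitBoundary.map k (X.bracket 0 k c) = epsRelLinear X.presented k (X.proj.map k c) := by
  induction c using X.cells_zero_induction with
  | gen k x => exact (epsRelLinear_apply X.presented _).symm
  | one => rw [bracket_one, map_zero, Hom.map_one, epsRelLinear_one]
  | comp E a b iha ihb =>
    rw [bracket_comp, map_add, Bimodule.Hom.map_lact, Bimodule.Hom.map_ract, iha, ihb,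
      Hom.map_comp, epsRelLinear_comp]
    rfl
  | zero k => simp only [map_zero]
  | add k a b iha ihb => simp only [map_add, iha, ihb]
  | smul k r a ih => simp only [map_smul, ih]

/-- The relations of `Ω_P` run over all of `P`, yet each one is the boundary of the bracket of a
representing 0-cell, so those of the generators suffice. -/
theorem exact_unitBoundary_toTrivial (k : ℕ+) :
    Function.Exact (X.unitBoundary.map k) ((toTrivial X.presented).map k) := by
  intro y
  refine (Submodule.Quotient.mk_eq_zero _).trans ⟨fun h => ?_, ?_⟩
  · have h' : (freeBimodule X.presented UnitIndexed).SubMem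
      (fun k => {a | ∃ x : X.presented.carrier k, a = epsRel X.presented x}) y := h
    clear h
    induction h' with
    | of h =>
      obtain ⟨x, rfl⟩ := h
      obtain ⟨c, rfl⟩ := X.proj_surjective _ x
      exact ⟨X.bracket 0 _ c, by rw [unitBoundary_bracket, epsRelLinear_apply]⟩
    | zero => exact ⟨0, map_zero _⟩
    | add _ _ ih ih' =>
      obtain ⟨a, rfl⟩ := ih
      obtain ⟨b, rfl⟩ := ih'
      exact ⟨a + b, map_add _ _ _⟩
    | smul r _ ih =>
      obtain ⟨a, rfl⟩ := ih
      exact ⟨r • a, map_smul _ _ _⟩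
    | lact E x _ ih =>
      obtain ⟨a, rfl⟩ := ih
      exact ⟨_, Bimodule.Hom.map_lact _ E x a⟩
    | ract E x _ ih =>
      obtain ⟨a, rfl⟩ := ih
      exact ⟨_, Bimodule.Hom.map_ract _ E a x⟩
  · rintro ⟨a, rfl⟩
    induction a using freeBimodule.induction with
    | gen k x => exact Bimodule.SubMem.of ⟨_, rfl⟩
    | lact E x a ih =>
      rw [Bimodule.Hom.map_lact]
      exact Bimodule.SubMem.lact E x ih
    | ract E a x ih =>
      rw [Bimodule.Hom.map_ract]
      exact Bimodule.SubMem.ract E x ih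
    | zero k => rw [map_zero]; exact zero_mem _
    | add k a b iha ihb => rw [map_add]; exact add_mem iha ihb
    | smul k r a ih => rw [map_smul]; exact Submodule.smul_mem _ _ ih

/-! ### Homogeneous cells -/

section Homog

variable {X} {deg : ∀ n k, X.gens n k → ℕ}

theorem homog_zero {d n : ℕ} {k : ℕ+} : X.Homog deg d (0 : (X.cells n).carrier k) :=
  ⟨_, HomogExpr.zero, rfl⟩

theorem homog_one {n : ℕ} : X.Homog deg 0 (X.cells n).one := ⟨_, HomogExpr.one, rfl⟩

theorem Homog.add {d n : ℕ} {k : ℕ+} {a b : (X.cells n).carrier k} (ha : X.Homog deg d a)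
    (hb : X.Homog deg d b) : X.Homog deg d (a + b) := by
  obtain ⟨a, ha, rfl⟩ := ha
  obtain ⟨b, hb, rfl⟩ := hb
  exact ⟨_, HomogExpr.add ha hb, rfl⟩

theorem Homog.smul {d n : ℕ} {k : ℕ+} (r : K) {a : (X.cells n).carrier k}
    (ha : X.Homog deg d a) : X.Homog deg d (r • a) := by
  obtain ⟨a, ha, rfl⟩ := ha
  exact ⟨_, HomogExpr.smul r ha, rfl⟩

theorem Homog.comp {d e n : ℕ} {k l m : ℕ+} (E : Shuf k l m) {a : (X.cells n).carrier k}
    {b : (X.cells n).carrier l} (ha : X.Homog deg d a) (hb : X.Homog deg e b) :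
    X.Homog deg (d + e) ((X.cells n).comp E a b) := by
  obtain ⟨a, ha, rfl⟩ := ha
  obtain ⟨b, hb, rfl⟩ := hb
  exact ⟨_, HomogExpr.comp E ha hb, rfl⟩

theorem HomogExpr.homog_src (hdeg : X.IsGrading deg) {d n : ℕ} {k : ℕ+}
    {a : CellExpr K X.gens n k} (h : X.HomogExpr deg d a) :
    X.Homog deg d (X.cell (bdAll X.s a)) := by
  induction h with
  | @gen n k x =>
    cases n with
    -- On generators of dimension `0` the boundary is by convention the identity.
    | zero => exact ⟨_, HomogExpr.gen x, rfl⟩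
    | succ n => exact (hdeg n k x).1
  | ident h _ => exact ⟨_, h, rfl⟩
  | one => exact homog_one
  | comp E _ _ iha ihb => exact Homog.comp E iha ihb
  | zero => exact homog_zero
  | add _ _ iha ihb => exact iha.add ihb
  | smul r _ ih => exact ih.smul r

theorem Homog.srcIter (hdeg : X.IsGrading deg) {d n : ℕ} {k : ℕ+} {c : (X.cells n).carrier k}
    (h : X.Homog deg d c) : X.Homog deg d ((X.srcIter n).map k c) := by
  induction n with
  | zero => exact h
  | succ n ih =>
    obtain ⟨a, ha, rfl⟩ := h
    exact ih (ha.homog_src hdeg)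

theorem Homog.barHom_mem (hdeg : X.IsGrading deg) {d n : ℕ} (hd : 0 < d) {k : ℕ+}
    {c : (X.cells n).carrier k} (h : X.Homog deg d c) :
    (X.barHom n).map k c ∈ X.positivePart deg k :=
  Submodule.subset_span ⟨d, hd, _, h.srcIter hdeg, rfl⟩

theorem comp_mem_positivePart {k l n : ℕ+} (E : Shuf k l n) {x : X.presented.carrier k}
    {y : X.presented.carrier l} (hx : x ∈ X.positivePart deg k) (hy : y ∈ X.positivePart deg l) :
    X.presented.comp E x y ∈ X.positivePart deg n := by
  induction hx using Submodule.span_induction with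
  | zero => rw [map_zero]; exact zero_mem _
  | add x x' _ _ h h' => rw [map_add]; exact add_mem h h'
  | smul r x _ h => rw [map_smul]; exact Submodule.smul_mem _ _ h
  | mem x hx =>
    induction hy using Submodule.span_induction with
    | zero => rw [map_zero]; exact zero_mem _
    | add y y' _ _ h h' => rw [map_add]; exact add_mem h h'
    | smul r y _ h => rw [map_smul]; exact Submodule.smul_mem _ _ h
    | mem y hy =>
      obtain ⟨d, hd, a, ha, rfl⟩ := hx
      obtain ⟨e, -, b, hb, rfl⟩ := hy
      exact Submodule.subset_span ⟨d + e, by omega, _, ha.comp E hb, Hom.map_comp _ _ _ _⟩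

/-- Every element is the sum of an element of positive degree and of a multiple of the unit. -/
theorem mem_positivePart_sup (hpos : ∀ k (x : X.gens 0 k), 0 < deg 0 k x) {k : ℕ+}
    (x : X.presented.carrier k) : x ∈ X.positivePart deg k ⊔
      -- This span is generated by the unit in arity `1`, and is zero in all other arities.
      Submodule.span K {y | ∃ h : 1 = k, h ▸ X.presented.one = y} := by
  obtain ⟨c, rfl⟩ := X.proj_surjective k x
  induction c using X.cells_zero_induction with
  | gen k x =>
    exact Submodule.mem_sup_left (Submodule.subset_span ⟨_, hpos k x, _, ⟨_, HomogExpr.gen x, rfl⟩, rfl⟩)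
  | one => exact Submodule.mem_sup_right (Submodule.subset_span ⟨rfl, X.proj.map_one.symm⟩)
  | @comp k l m E a b iha ihb =>
    rw [Hom.map_comp]
    obtain ⟨x, hx, x', hx', e⟩ := Submodule.mem_sup.1 iha
    rw [← e, map_add, LinearMap.add_apply]
    refine add_mem ?_ ?_
    · obtain ⟨y, hy, y', hy', e'⟩ := Submodule.mem_sup.1 ihb
      rw [← e', map_add]
      refine add_mem (Submodule.mem_sup_left (comp_mem_positivePart E hx hy)) ?_
      clear e e' ihb
      induction hy' using Submodule.span_induction with
      | zero => rw [map_zero]; exact zero_mem _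
      | add y y' _ _ h h' => rw [map_add]; exact add_mem h h'
      | smul r y _ h => rw [map_smul]; exact Submodule.smul_mem _ _ h
      | mem y hy =>
        obtain ⟨rfl, rfl⟩ := hy
        obtain rfl := E.eq_of_unit_right
        rw [ShuffleOperad.comp_one]
        exact Submodule.mem_sup_left hx
    · clear e iha
      induction hx' using Submodule.span_induction with
      | zero => rw [map_zero]; exact zero_mem _
      | add y y' _ _ h h' => rw [map_add]; exact add_mem h h'
      | smul r y _ h => rw [map_smul]; exact Submodule.smul_mem _ _ h
      | mem y hy =>
        obtain ⟨rfl, rfl⟩ := hy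
        obtain rfl := E.eq_of_unit_left
        rw [ShuffleOperad.one_comp]
        exact ihb
  | zero k => rw [map_zero]; exact zero_mem _
  | add k a b iha ihb => rw [map_add]; exact add_mem iha ihb
  | smul k r a ih => rw [map_smul]; exact Submodule.smul_mem _ _ ih

/-- Modulo positive degree, `P` is reduced to multiples of the unit, which act as scalars; so the
span of single actions by positive elements is a sub-bimodule. -/
theorem lact_mem_actionSpan (hpos : ∀ k (x : X.gens 0 k), 0 < deg 0 k x)
    (A : Bimodule X.presented) {k l n : ℕ+} (E : Shuf k l n) (x : X.presented.carrier k)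
    {a : A.carrier l} (ha : a ∈ A.actionSpan (X.positivePart deg) l) :
    A.lact E x a ∈ A.actionSpan (X.positivePart deg) n := by
  obtain ⟨x, hx, x', hx', rfl⟩ := Submodule.mem_sup.1 (mem_positivePart_sup hpos x)
  rw [map_add, LinearMap.add_apply]
  refine add_mem (Submodule.subset_span (Or.inl ⟨k, l, E, x, a, hx, rfl⟩)) ?_
  induction hx' using Submodule.span_induction with
  | zero => rw [map_zero]; exact zero_mem _
  | add y y' _ _ h h' => rw [map_add]; exact add_mem h h'
  | smul r y _ h => rw [map_smul]; exact Submodule.smul_mem _ _ h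
  | mem y hy =>
    obtain ⟨rfl, rfl⟩ := hy
    obtain rfl := E.eq_of_unit_left
    rw [Bimodule.one_lact]
    exact ha

theorem ract_mem_actionSpan (hpos : ∀ k (x : X.gens 0 k), 0 < deg 0 k x)
    (A : Bimodule X.presented) {k l n : ℕ+} (E : Shuf k l n) {a : A.carrier k}
    (ha : a ∈ A.actionSpan (X.positivePart deg) k) (x : X.presented.carrier l) :
    A.ract E a x ∈ A.actionSpan (X.positivePart deg) n := by
  obtain ⟨x, hx, x', hx', rfl⟩ := Submodule.mem_sup.1 (mem_positivePart_sup hpos x)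
  rw [map_add]
  refine add_mem (Submodule.subset_span (Or.inr ⟨k, l, E, a, x, hx, rfl⟩)) ?_
  induction hx' using Submodule.span_induction with
  | zero => rw [map_zero]; exact zero_mem _
  | add y y' _ _ h h' => rw [map_add]; exact add_mem h h'
  | smul r y _ h => rw [map_smul]; exact Submodule.smul_mem _ _ h
  | mem y hy =>
    obtain ⟨rfl, rfl⟩ := hy
    obtain rfl := E.eq_of_unit_right
    rw [Bimodule.ract_one]
    exact ha

theorem reduction_eq_zero (hpos : ∀ k (x : X.gens 0 k), 0 < deg 0 k x) {Y : ℕ+ → Type u}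
    {A : Bimodule X.presented} (f : Bimodule.Hom (freeBimodule X.presented Y) A)
    (h : ∀ k y, f.map k (freeBimodule.gen _ y) ∈ A.actionSpan (X.positivePart deg) k) (k : ℕ+) :
    f.reduction (X.positivePart deg) k = 0 := by
  have key : ∀ a, f.map k a ∈ A.actionSpan (X.positivePart deg) k := by
    intro a
    induction a using freeBimodule.induction with
    | gen k y => exact h k y
    | lact E x a ih => rw [f.map_lact]; exact lact_mem_actionSpan hpos A E x ih
    | ract E a x ih => rw [f.map_ract]; exact ract_mem_actionSpan hpos A E ih x
    | zero k => rw [map_zero]; exact zero_mem _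
    | add k a b iha ihb => rw [map_add]; exact add_mem iha ihb
    | smul k r a ih => rw [map_smul]; exact Submodule.smul_mem _ _ ih
  refine LinearMap.ext fun a => ?_
  obtain ⟨a, rfl⟩ := Submodule.mkQ_surjective _ a
  exact (Submodule.Quotient.mk_eq_zero _).2 (key a)

theorem epsRel_mem_actionSpan {k : ℕ+} {x : X.presented.carrier k}
    (hx : x ∈ X.positivePart deg k) : epsRel X.presented x ∈
      (freeBimodule X.presented UnitIndexed).actionSpan (X.positivePart deg) k := by
  refine sub_mem (Submodule.subset_span (Or.inr ⟨_, _, _, _, x, hx, rfl⟩)) (sum_mem fun i _ => ?_)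
  exact Submodule.subset_span (Or.inl ⟨_, _, _, x, _, hx, rfl⟩)

/-- The generators weigh at most `e` and the whole weighs `d > e`, so the context of each generator
has positive weight. -/
theorem HomogExpr.bracketExpr_mem (hdeg : X.IsGrading deg)
    (hpos : ∀ k (x : X.gens 0 k), 0 < deg 0 k x) {d n e : ℕ} {k : ℕ+}
    {a : CellExpr K X.gens n k} (h : X.HomogExpr deg d a) (he : ∀ k (x : X.gens n k), deg n k x ≤ e)
    (hd : e < d) : X.bracketExpr a ∈
      (freeBimodule X.presented (X.gens n)).actionSpan (X.positivePart deg) k := by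
  induction h with
  | gen x => exact absurd (he _ x) (not_le.2 hd)
  | ident => exact zero_mem _
  | one => exact zero_mem _
  | @comp d₁ d₂ n k l m E a b ha hb iha ihb =>
    refine add_mem ?_ ?_
    · by_cases h0 : 0 < d₂
      · refine Submodule.subset_span (Or.inr ⟨k, l, E, _, X.bar b, ?_, rfl⟩)
        rw [← barHom_cell]
        exact Homog.barHom_mem hdeg h0 ⟨b, hb, rfl⟩
      -- If the other factor has weight zero, this one still carries the whole weight `d₁ + d₂ > e`.
      · exact ract_mem_actionSpan hpos _ E (iha he (by omega)) _
    · by_cases h0 : 0 < d₁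
      · refine Submodule.subset_span (Or.inl ⟨k, l, E, X.bar a, _, ?_, rfl⟩)
        rw [← barHom_cell]
        exact Homog.barHom_mem hdeg h0 ⟨a, ha, rfl⟩
      · exact lact_mem_actionSpan hpos _ E _ (ihb he (by omega))
  | zero => exact zero_mem _
  | add _ _ iha ihb => exact add_mem (iha he hd) (ihb he hd)
  | smul r _ ih => exact Submodule.smul_mem _ r (ih he hd)

theorem Homog.bracket_mem (hdeg : X.IsGrading deg) (hpos : ∀ k (x : X.gens 0 k), 0 < deg 0 k x)
    {d n e : ℕ} {k : ℕ+} {c : (X.cells n).carrier k} (h : X.Homog deg d c)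
    (he : ∀ k (x : X.gens n k), deg n k x ≤ e) (hd : e < d) : X.bracket n k c ∈
      (freeBimodule X.presented (X.gens n)).actionSpan (X.positivePart deg) k := by
  obtain ⟨a, ha, rfl⟩ := h
  exact ha.bracketExpr_mem hdeg hpos he hd

theorem boundary_reduction_eq_zero (hdeg : X.IsGrading deg) {w : ℕ → ℕ} (hw_pos : ∀ n, 0 < w n)
    (hw : StrictMono w) (hconc : ∀ n k (x : X.gens n k), deg n k x = w n) (n : ℕ) (k : ℕ+) :
    (X.boundary n).reduction (X.positivePart deg) k = 0 := by
  have hpos : ∀ k (x : X.gens 0 k), 0 < deg 0 k x := fun k x => by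
    rw [hconc]; exact hw_pos 0
  cases n with
  | zero =>
    refine reduction_eq_zero hpos X.unitBoundary (fun k x => ?_) k
    exact epsRel_mem_actionSpan
      (Submodule.subset_span ⟨_, hpos k x, _, ⟨_, HomogExpr.gen x, rfl⟩, rfl⟩)
  | succ n =>
    refine reduction_eq_zero hpos (X.bracketBoundary n) (fun k x => ?_) k
    have hd : w n < deg (n + 1) k x := by
      rw [hconc]; exact hw (Nat.lt_succ_self n)
    exact sub_mem
      ((hdeg n k x).1.bracket_mem hdeg hpos (fun k x => (hconc n k x).le) hd)
      ((hdeg n k x).2.bracket_mem hdeg hpos (fun k x => (hconc n k x).le) hd)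

end Homog

end Polygraph
end ShuffleOp

/-! ### Marked inputs: a bimodule in which a derivation becomes inner. -/

namespace ShuffleOp

variable {K : Type u} [Field K]

namespace Shuf

variable {k l n : ℕ+} (E : Shuf k l n)

open Classical in
/-- The input of the root element below which an input of the composite lies. -/
noncomputable def under (c : Fin n) : Fin k :=
  if h : ∃ a, a ≠ E.pos ∧ E.root a = c then h.choose else E.pos

theorem under_root (a : Fin k) : E.under (E.root a) = a := by
  unfold under
  split_ifs with h
  · exact E.root.injective h.choose_spec.2
  · by_contra hne
    exact h ⟨a, fun e => hne e.symm, rfl⟩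

theorem under_leaf (b : Fin l) : E.under (E.leaf b) = E.pos := by
  unfold under
  split_ifs with h
  · exact absurd (E.inter _ b h.choose_spec.2) h.choose_spec.1
  · rfl

theorem leaf_or_root (c : Fin n) : (∃ b, E.leaf b = c) ∨ ∃ a, a ≠ E.pos ∧ E.root a = c := by
  rcases E.cover c with ⟨a, rfl⟩ | h
  · by_cases ha : a = E.pos
    · exact Or.inl ⟨⟨0, l.pos⟩, by rw [E.base, ha]⟩
    · exact Or.inr ⟨a, ha, rfl⟩
  · exact Or.inl h

open Classical in
/-- The extension by zero of a function on the inputs of the upper element. -/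
noncomputable def extend {M : Type*} [Zero M] (p : Fin l → M) (c : Fin n) : M :=
  if h : ∃ b, E.leaf b = c then p h.choose else 0

variable {M : Type*} [Zero M]

theorem extend_leaf (p : Fin l → M) (b : Fin l) : E.extend p (E.leaf b) = p b := by
  have h : ∃ b', E.leaf b' = E.leaf b := ⟨b, rfl⟩
  rw [extend, dif_pos h, E.leaf.injective h.choose_spec]

theorem extend_root (p : Fin l → M) {a : Fin k} (ha : a ≠ E.pos) :
    E.extend p (E.root a) = 0 := by
  rw [extend, dif_neg]
  rintro ⟨b, hb⟩
  exact ha (E.inter a b hb.symm)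

end Shuf

/-! ### The bimodule of leafwise derivatives -/

section LeafBimodule

open Tot (order_embedding_eq_refl)

variable {P : ShuffleOperad K} {A : Bimodule P} (d : ∀ k, P.carrier k →ₗ[K] A.carrier k)
  (hone : d 1 P.one = 0)
  (hcomp : ∀ {k l n : ℕ+} (E : Shuf k l n) (x : P.carrier k) (y : P.carrier l),
    d n (P.comp E x y) = A.ract E (d k x) y + A.lact E x (d l y))

/-- The extension of a bimodule, by the elements of `P` with a marked input, that trivializes a
derivation. -/
noncomputable def leafBimodule : Bimodule P where
  carrier k := A.carrier k × (Fin k → P.carrier k)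
  -- Under a left action the marked input stays in the upper element; the inputs of `x` carry no
  -- mark.
  lact {k l n} E := LinearMap.mk₂ K
    (fun x a => (A.lact E x a.1, fun c => E.extend (fun b => P.comp E x (a.2 b)) c))
    (fun x x' a => by
      refine Prod.ext (LinearMap.map_add₂ _ _ _ _) (funext fun c => ?_)
      change E.extend (fun b => P.comp E (x + x') (a.2 b)) c =
        E.extend (fun b => P.comp E x (a.2 b)) c + E.extend (fun b => P.comp E x' (a.2 b)) c
      rcases E.leaf_or_root c with ⟨b, rfl⟩ | ⟨e, he, rfl⟩
      · simp only [Shuf.extend_leaf, map_add, LinearMap.add_apply]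
      · simp only [Shuf.extend_root _ _ he, add_zero])
    (fun r x a => by
      refine Prod.ext (LinearMap.map_smul₂ _ _ _ _) (funext fun c => ?_)
      change E.extend (fun b => P.comp E (r • x) (a.2 b)) c =
        r • E.extend (fun b => P.comp E x (a.2 b)) c
      rcases E.leaf_or_root c with ⟨b, rfl⟩ | ⟨e, he, rfl⟩
      · simp only [Shuf.extend_leaf, map_smul, LinearMap.smul_apply]
      · simp only [Shuf.extend_root _ _ he, smul_zero])
    (fun x a a' => by
      refine Prod.ext (map_add _ _ _) (funext fun c => ?_)
      change E.extend (fun b => P.comp E x (a.2 b + a'.2 b)) c =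
        E.extend (fun b => P.comp E x (a.2 b)) c + E.extend (fun b => P.comp E x (a'.2 b)) c
      rcases E.leaf_or_root c with ⟨b, rfl⟩ | ⟨e, he, rfl⟩
      · simp only [Shuf.extend_leaf, map_add]
      · simp only [Shuf.extend_root _ _ he, add_zero])
    (fun r x a => by
      refine Prod.ext (map_smul _ _ _) (funext fun c => ?_)
      change E.extend (fun b => P.comp E x (r • a.2 b)) c =
        r • E.extend (fun b => P.comp E x (a.2 b)) c
      rcases E.leaf_or_root c with ⟨b, rfl⟩ | ⟨e, he, rfl⟩
      · simp only [Shuf.extend_leaf, map_smul]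
      · simp only [Shuf.extend_root _ _ he, smul_zero])
  -- Grafting `y` onto the marked input marks every input of `y` and adds the twisting term given by
  -- `d y`; at any other input the mark stays where it is.
  ract {k l n} E := LinearMap.mk₂ K
    (fun a y => (A.ract E a.1 y + A.lact E (a.2 E.pos) (d l y),
      fun c => P.comp E (a.2 (E.under c)) y))
    (fun a a' y => by
      refine Prod.ext ?_ (funext fun c => LinearMap.map_add₂ _ _ _ _)
      change A.ract E (a.1 + a'.1) y + A.lact E (a.2 E.pos + a'.2 E.pos) (d l y) =
        (A.ract E a.1 y + A.lact E (a.2 E.pos) (d l y)) +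
          (A.ract E a'.1 y + A.lact E (a'.2 E.pos) (d l y))
      simp only [map_add, LinearMap.add_apply]
      abel)
    (fun r a y => by
      refine Prod.ext ?_ (funext fun c => LinearMap.map_smul₂ _ _ _ _)
      change A.ract E (r • a.1) y + A.lact E (r • a.2 E.pos) (d l y) =
        r • (A.ract E a.1 y + A.lact E (a.2 E.pos) (d l y))
      simp only [map_smul, LinearMap.smul_apply, smul_add])
    (fun a y y' => by
      refine Prod.ext ?_ (funext fun c => map_add _ _ _)
      change A.ract E a.1 (y + y') + A.lact E (a.2 E.pos) (d l (y + y')) =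
        (A.ract E a.1 y + A.lact E (a.2 E.pos) (d l y)) +
          (A.ract E a.1 y' + A.lact E (a.2 E.pos) (d l y'))
      simp only [map_add]
      abel)
    (fun r a y => by
      refine Prod.ext ?_ (funext fun c => map_smul _ _ _)
      change A.ract E a.1 (r • y) + A.lact E (a.2 E.pos) (d l (r • y)) =
        r • (A.ract E a.1 y + A.lact E (a.2 E.pos) (d l y))
      simp only [map_smul, smul_add])
  one_lact {k} E a := by
    refine Prod.ext (A.one_lact E _) (funext fun c => ?_)
    change E.extend (fun b => P.comp E P.one (a.2 b)) c = a.2 c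
    have hc : E.leaf c = c := by rw [order_embedding_eq_refl E.leaf]; rfl
    conv_lhs => rw [← hc]
    rw [Shuf.extend_leaf, P.one_comp]
  ract_one {k} E a := by
    refine Prod.ext ?_ (funext fun c => ?_)
    · change A.ract E a.1 P.one + A.lact E (a.2 E.pos) (d 1 P.one) = a.1
      rw [hone, map_zero, add_zero, A.ract_one]
    · change P.comp E (a.2 (E.under c)) P.one = a.2 c
      have hc : E.root c = c := by rw [order_embedding_eq_refl E.root]; rfl
      have hu : E.under c = c := by
        conv_lhs => rw [← hc]
        exact E.under_root c
      rw [P.comp_one, hu]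
  nested_left {k l m n q N E F F' E'} h x y a := by
    refine Prod.ext (A.nested_left h _ _ _) (funext fun c => ?_)
    change F.extend (fun b => P.comp F (P.comp E x y) (a.2 b)) c =
      E'.extend (fun e => P.comp E' x (F'.extend (fun b => P.comp F' y (a.2 b)) e)) c
    rcases E'.leaf_or_root c with ⟨e, rfl⟩ | ⟨r, hr, rfl⟩
    · rw [Shuf.extend_leaf]
      rcases F'.leaf_or_root e with ⟨b, rfl⟩ | ⟨r, hr, rfl⟩
      · rw [Shuf.extend_leaf, ← h.leaf_leaf, Shuf.extend_leaf, P.nested h]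
      · rw [Shuf.extend_root _ _ hr, map_zero, ← h.root_leaf, Shuf.extend_root]
        rw [h.pos_F]
        exact fun e => hr (E.leaf.injective e)
    · rw [Shuf.extend_root _ _ hr, ← h.root_root, Shuf.extend_root]
      rw [h.pos_F]
      intro e
      exact hr ((E.inter _ _ e).trans h.pos_E.symm)
  nested_mid {k l m n q N E F F' E'} h x a z := by
    refine Prod.ext ?_ (funext fun c => ?_)
    · change A.ract F (A.lact E x a.1) z +
          A.lact F (E.extend (fun b => P.comp E x (a.2 b)) F.pos) (d m z) =
        A.lact E' x (A.ract F' a.1 z + A.lact F' (a.2 F'.pos) (d m z))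
      rw [map_add, A.nested_mid h, h.pos_F, Shuf.extend_leaf, A.nested_left h]
    · change P.comp F (E.extend (fun b => P.comp E x (a.2 b)) (F.under c)) z =
        E'.extend (fun e => P.comp E' x (P.comp F' (a.2 (F'.under e)) z)) c
      rcases E'.leaf_or_root c with ⟨e, rfl⟩ | ⟨r, hr, rfl⟩
      · rw [Shuf.extend_leaf]
        rcases F'.cover e with ⟨r, rfl⟩ | ⟨b, rfl⟩
        · rw [← h.root_leaf, Shuf.under_root, Shuf.under_root, Shuf.extend_leaf, P.nested h]
        · rw [← h.leaf_leaf, Shuf.under_leaf, Shuf.under_leaf, h.pos_F, Shuf.extend_leaf,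
            P.nested h]
      · rw [Shuf.extend_root _ _ hr, ← h.root_root, Shuf.under_root, Shuf.extend_root, map_zero,
          LinearMap.zero_apply]
        rw [← h.pos_E]
        exact hr
  nested_right {k l m n q N E F F' E'} h a y z := by
    refine Prod.ext ?_ (funext fun c => ?_)
    · change A.ract F (A.ract E a.1 y + A.lact E (a.2 E.pos) (d l y)) z +
          A.lact F (P.comp E (a.2 (E.under F.pos)) y) (d m z) =
        A.ract E' a.1 (P.comp F' y z) + A.lact E' (a.2 E'.pos) (d q (P.comp F' y z))
      -- Associativity of the twisted right action is exactly the Leibniz rule for `d`.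
      rw [hcomp, map_add, map_add, LinearMap.add_apply, A.nested_right h, A.nested_mid h, h.pos_F,
        Shuf.under_leaf, A.nested_left h, h.pos_E, add_assoc]
    · change P.comp F (P.comp E (a.2 (E.under (F.under c))) y) z =
        P.comp E' (a.2 (E'.under c)) (P.comp F' y z)
      have hu : E.under (F.under c) = E'.under c := by
        rcases F.cover c with ⟨e, rfl⟩ | ⟨b, rfl⟩
        · rw [Shuf.under_root]
          rcases E.cover e with ⟨r, rfl⟩ | ⟨b, rfl⟩
          · rw [h.root_root, Shuf.under_root, Shuf.under_root]
          · rw [h.root_leaf, Shuf.under_leaf, Shuf.under_leaf, h.pos_E]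
        · rw [Shuf.under_leaf, h.pos_F, Shuf.under_leaf, h.leaf_leaf, Shuf.under_leaf, h.pos_E]
      rw [hu, P.nested h]
  parallel_root {k l m n n' N E F G H} h a y z := by
    refine Prod.ext ?_ (funext fun c => ?_)
    · change A.ract F (A.ract E a.1 y + A.lact E (a.2 E.pos) (d l y)) z +
          A.lact F (P.comp E (a.2 (E.under F.pos)) y) (d m z) =
        A.ract H (A.ract G a.1 z + A.lact G (a.2 G.pos) (d m z)) y +
          A.lact H (P.comp G (a.2 (G.under H.pos)) z) (d l y)
      rw [map_add, map_add, LinearMap.add_apply, LinearMap.add_apply, A.parallel_root h,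
        A.parallel_leaf h, ← A.parallel_leaf h.symm, h.pos_F, h.pos_H, Shuf.under_root,
        Shuf.under_root]
      abel
    · change P.comp F (P.comp E (a.2 (E.under (F.under c))) y) z =
        P.comp H (P.comp G (a.2 (G.under (H.under c))) z) y
      have hu : E.under (F.under c) = G.under (H.under c) := by
        rcases F.cover c with ⟨e, rfl⟩ | ⟨b, rfl⟩
        · rw [Shuf.under_root]
          rcases E.cover e with ⟨r, rfl⟩ | ⟨b, rfl⟩
          · rw [h.root_root, Shuf.under_root, Shuf.under_root, Shuf.under_root]
          · rw [h.root_leaf, Shuf.under_leaf, Shuf.under_leaf, h.pos_H, Shuf.under_root]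
        · rw [Shuf.under_leaf, h.pos_F, Shuf.under_root, h.leaf_root, Shuf.under_root,
            Shuf.under_leaf]
      rw [hu, P.parallel h]
  parallel_leaf {k l m n n' N E F G H} h x a z := by
    refine Prod.ext ?_ (funext fun c => ?_)
    · change A.ract F (A.lact E x a.1) z +
          A.lact F (E.extend (fun b => P.comp E x (a.2 b)) F.pos) (d m z) =
        A.lact H (P.comp G x z) a.1
      rw [A.parallel_leaf h, h.pos_F, Shuf.extend_root _ _ h.ne.symm, map_zero,
        LinearMap.zero_apply, add_zero]
    · change P.comp F (E.extend (fun b => P.comp E x (a.2 b)) (F.under c)) z =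
        H.extend (fun b => P.comp H (P.comp G x z) (a.2 b)) c
      rcases H.leaf_or_root c with ⟨b, rfl⟩ | ⟨e, he, rfl⟩
      · rw [Shuf.extend_leaf, ← h.root_leaf, Shuf.under_root, Shuf.extend_leaf, P.parallel h]
      · rw [Shuf.extend_root _ _ he]
        have h0 : E.extend (fun b => P.comp E x (a.2 b)) (F.under (H.root e)) = 0 := by
          rcases G.cover e with ⟨r, rfl⟩ | ⟨b, rfl⟩
          · rw [← h.root_root, Shuf.under_root, Shuf.extend_root]
            rintro rfl
            exact he h.pos_H.symm
          · rw [← h.leaf_root, Shuf.under_leaf, h.pos_F, Shuf.extend_root _ _ h.ne.symm]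
        rw [h0, map_zero, LinearMap.zero_apply]

/-- The inclusion of a bimodule into its extension by elements with a marked input. -/
noncomputable def leafInl : Bimodule.Hom A (leafBimodule d hone hcomp) where
  map k := LinearMap.inl K (A.carrier k) (Fin k → P.carrier k)
  map_lact E x a := by
    refine Prod.ext rfl (funext fun c => ?_)
    change (0 : P.carrier _) = E.extend (fun b => P.comp E x 0) c
    rcases E.leaf_or_root c with ⟨b, rfl⟩ | ⟨e, he, rfl⟩
    · rw [Shuf.extend_leaf, map_zero]
    · rw [Shuf.extend_root _ _ he]
  map_ract E a y := by
    refine Prod.ext ?_ (funext fun c => (LinearMap.map_zero₂ _ _).symm)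
    change A.ract E a y = A.ract E a y + A.lact E 0 _
    rw [map_zero, LinearMap.zero_apply, add_zero]

/-- The morphism that sends `ε` to the unit with its input marked. -/
noncomputable def leafHom : Bimodule.Hom (freeBimodule P UnitIndexed) (leafBimodule d hone hcomp) :=
  freeBimodule.lift (B := leafBimodule d hone hcomp) (fun _ e => match e with
    | UnitIndexed.eps => ((0, fun _ => P.one) : A.carrier 1 × (Fin ((1 : ℕ+) : ℕ) → P.carrier 1)))

/-- The element `(ε | x)` becomes `d x` together with `x` marked at every input, and `x ∘_i ε`
becomes `x` marked at `i`; the marks cancel and `d x` remains. -/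
theorem leafHom_epsRel {k : ℕ+} (x : P.carrier k) :
    (leafHom d hone hcomp).map k (epsRel P x) = (leafInl d hone hcomp).map k (d k x) := by
  rw [epsRel, map_sub, map_sum, Bimodule.Hom.map_ract]
  simp only [Bimodule.Hom.map_lact]
  have e : (leafHom d hone hcomp).map 1 (eps P) =
    ((0, fun _ => P.one) : A.carrier 1 × (Fin ((1 : ℕ+) : ℕ) → P.carrier 1)) := rfl
  rw [e]
  have e1 : (leafBimodule d hone hcomp).ract (Shuf.underRoot k)
      ((0, fun _ => P.one) : A.carrier 1 × (Fin ((1 : ℕ+) : ℕ) → P.carrier 1)) x =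
      ((d k x, fun _ => x) : A.carrier k × (Fin k → P.carrier k)) := by
    refine Prod.ext ?_ (funext fun c => P.one_comp _ x)
    change A.ract (Shuf.underRoot k) 0 x + A.lact (Shuf.underRoot k) P.one (d k x) = d k x
    rw [map_zero, LinearMap.zero_apply, zero_add, A.one_lact]
  have e2 : ∀ i, (leafBimodule d hone hcomp).lact (Shuf.onLeaf k i) x
      ((0, fun _ => P.one) : A.carrier 1 × (Fin ((1 : ℕ+) : ℕ) → P.carrier 1)) =
      ((0, Pi.single i x) : A.carrier k × (Fin k → P.carrier k)) := by
    intro i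
    refine Prod.ext (map_zero _) (funext fun c => ?_)
    change (Shuf.onLeaf k i).extend (fun _ => P.comp (Shuf.onLeaf k i) x P.one) c =
      (Pi.single i x : Fin k → P.carrier k) c
    rw [P.comp_one]
    by_cases hc : c = i
    · subst hc
      exact ((Shuf.onLeaf k c).extend_leaf _ ⟨0, PNat.pos 1⟩).trans (Pi.single_eq_same (M := fun _ : Fin (k : ℕ) => P.carrier k) c x).symm
    · exact ((Shuf.onLeaf k i).extend_root _ hc).trans (Pi.single_eq_of_ne (M := fun _ : Fin (k : ℕ) => P.carrier k) hc x).symm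
  rw [e1, Finset.sum_congr rfl (fun i _ => e2 i)]
  change ((d k x, fun _ => x) : A.carrier k × (Fin k → P.carrier k)) -
    ∑ i : Fin k, ((0, Pi.single i x) : A.carrier k × (Fin k → P.carrier k)) = (d k x, 0)
  refine Prod.ext ?_ ?_
  · rw [Prod.fst_sub, Prod.fst_sum]
    simp
  · rw [Prod.snd_sub, Prod.snd_sum]
    funext c
    simp [Finset.sum_apply, Pi.single_apply]

end LeafBimodule

/-! ### Exactness on generators of all dimensions. -/

namespace Polygraph

open CellExpr ShuffleOperad

variable (X : Polygraph K)

/-- The quotient of the free bimodule on `0`-generators by boundaries. -/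
def differentials : Bimodule X.presented :=
  (freeBimodule X.presented (X.gens 0)).quotient
    (fun k => Set.range ((X.bracketBoundary 0).map k))

/-- The projection onto the quotient by boundaries. -/
def differentialsMap : Bimodule.Hom (freeBimodule X.presented (X.gens 0)) X.differentials :=
  (freeBimodule X.presented (X.gens 0)).quotientMap
    (fun k => Set.range ((X.bracketBoundary 0).map k))

/-- The image of a morphism of bimodules is a sub-bimodule, so the quotient kills nothing beyond it.
-/
theorem differentialsMap_eq_zero_iff {k : ℕ+}
    (a : (freeBimodule X.presented (X.gens 0)).carrier k) :
    X.differentialsMap.map k a = 0 ↔ a ∈ Set.range ((X.bracketBoundary 0).map k) := by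
  refine (Submodule.Quotient.mk_eq_zero _).trans ⟨fun h => ?_, fun h => Bimodule.SubMem.of h⟩
  have h' : (freeBimodule X.presented (X.gens 0)).SubMem
    (fun k => Set.range ((X.bracketBoundary 0).map k)) a := h
  clear h
  induction h' with
  | of h => exact h
  | zero => exact ⟨0, map_zero _⟩
  | add _ _ ih ih' =>
    obtain ⟨a, rfl⟩ := ih
    obtain ⟨b, rfl⟩ := ih'
    exact ⟨a + b, map_add _ _ _⟩
  | smul r _ ih =>
    obtain ⟨a, rfl⟩ := ih
    exact ⟨r • a, map_smul _ _ _⟩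
  | lact E x _ ih =>
    obtain ⟨a, rfl⟩ := ih
    exact ⟨_, Bimodule.Hom.map_lact _ E x a⟩
  | ract E x _ ih =>
    obtain ⟨a, rfl⟩ := ih
    exact ⟨_, Bimodule.Hom.map_ract _ E a x⟩

/-- The derivation of the presented operad induced by the bracket. -/
def differential (k : ℕ+) : X.presented.carrier k →ₗ[K] X.differentials.carrier k :=
  X.presentedLift (X.differentialsMap.map k ∘ₗ X.bracket 0 k) (fun u hu => by
    obtain ⟨c, rfl⟩ := X.exists_of_proj_eq_zero hu
    refine (X.differentialsMap_eq_zero_iff _).2 ⟨X.bracket 1 k c, ?_⟩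
    rw [bracketBoundary_bracket, map_sub])

theorem differential_proj {k : ℕ+} (u : (X.cells 0).carrier k) :
    X.differential k (X.proj.map k u) = X.differentialsMap.map k (X.bracket 0 k u) := rfl

theorem differential_one : X.differential 1 X.presented.one = 0 := by
  rw [← X.proj.map_one, differential_proj, bracket_one, map_zero]

theorem differential_comp {k l n : ℕ+} (E : Shuf k l n) (x : X.presented.carrier k)
    (y : X.presented.carrier l) : X.differential n (X.presented.comp E x y) =
      X.differentials.ract E (X.differential k x) y +
        X.differentials.lact E x (X.differential l y) := by
  obtain ⟨u, rfl⟩ := X.proj_surjective _ x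
  obtain ⟨v, rfl⟩ := X.proj_surjective _ y
  rw [← X.proj.map_comp, differential_proj, bracket_comp, map_add, Bimodule.Hom.map_lact,
    Bimodule.Hom.map_ract]
  rfl

/-- Composing `δ_{-1}` with `leafHom` gives the projection to the cokernel of `δ_0` followed by the
injection `leafInl`, as is seen on generators. So a chain killed by `δ_{-1}` is zero in that
cokernel. -/
theorem exact_bracketBoundary_unitBoundary (k : ℕ+) :
    Function.Exact ((X.bracketBoundary 0).map k) (X.unitBoundary.map k) := by
  intro a
  constructor
  · intro ha
    rw [← differentialsMap_eq_zero_iff]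
    set L := leafHom X.differential X.differential_one X.differential_comp
    set I := leafInl X.differential X.differential_one X.differential_comp
    have key : ∀ (k : ℕ+) (a : (freeBimodule X.presented (X.gens 0)).carrier k),
        L.map k (X.unitBoundary.map k a) = I.map k (X.differentialsMap.map k a) := by
      intro k a
      induction a using freeBimodule.induction with
      | gen k x =>
        exact leafHom_epsRel X.differential X.differential_one X.differential_comp
          (X.proj.map k (X.cell (gen x)))
      | lact E x a ih => rw [Bimodule.Hom.map_lact, Bimodule.Hom.map_lact, Bimodule.Hom.map_lact,
          Bimodule.Hom.map_lact, ih]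
      | ract E a x ih => rw [Bimodule.Hom.map_ract, Bimodule.Hom.map_ract, Bimodule.Hom.map_ract,
          Bimodule.Hom.map_ract, ih]
      | zero k => simp only [map_zero]
      | add k a b iha ihb => simp only [map_add, iha, ihb]
      | smul k r a ih => simp only [map_smul, ih]
    have e := key k a
    rw [ha, map_zero] at e
    exact (congrArg Prod.fst e).symm
  · rintro ⟨b, rfl⟩
    obtain ⟨c, rfl, -⟩ := X.exists_bracket_eq 0 b
    rw [bracketBoundary_bracket, map_sub, unitBoundary_bracket, unitBoundary_bracket, proj_src,
      sub_self]

/-- A cycle is represented by a cell of target zero whose source has bracket zero. It is enough to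
make the source vanish without changing the bracket of the cell, after which acyclicity fills the
cell. -/
theorem exact_bracketBoundary (hX : X.Acyclic) (h1 : X.presented.one ≠ 0) (n : ℕ) (k : ℕ+) :
    Function.Exact ((X.bracketBoundary (n + 1)).map k) ((X.bracketBoundary n).map k) := by
  intro a
  constructor
  · intro ha
    obtain ⟨f, rfl, hf⟩ := X.exists_bracket_eq n a
    rw [bracketBoundary_bracket, hf, map_zero, sub_zero] at ha
    have lift : ∀ f' : (X.cells (n + 1)).carrier k,
        X.bracket (n + 1) k f' = X.bracket (n + 1) k f → (X.src n).map k f' = 0 →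
        (X.tgt n).map k f' = 0 → X.bracket (n + 1) k f ∈
          Set.range ((X.bracketBoundary (n + 1)).map k) := by
      intro f' h hs ht
      obtain ⟨F, hF, hF'⟩ := hX n k f' 0 (by rw [hs, map_zero]) (by rw [ht, map_zero])
      refine ⟨X.bracket (n + 2) k F, ?_⟩
      rw [bracketBoundary_bracket, hF, hF', map_zero, sub_zero, h]
    match n with
    -- The source is a 0-cell that need not vanish. It is the source of a 1-cell `T` with zero
    -- target and zero bracket, and `f - T` has zero boundary.
    | 0 =>
      obtain ⟨T, hT, hT', hT''⟩ := X.exists_src_eq_of_bracket_eq_zero h1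
        (c := (X.src 0).map k f) (by rw [proj_src, hf, map_zero]) ha
      refine lift (f - T) ?_ ?_ ?_
      · rw [map_sub, hT'', sub_zero]
      · rw [map_sub, hT, sub_self]
      · rw [map_sub, hT', hf, sub_self]
    -- The source is a 1-cell which, by globularity, has zero source and target.
    | 1 =>
      refine lift f rfl (X.eq_zero_of_mem_nullCells_of_bracket_eq_zero h1 ?_ ?_ ha) hf
      · rw [src_src, hf, map_zero]
      · rw [tgt_src, hf, map_zero]
    | n + 2 =>
      refine lift f rfl (X.eq_zero_of_bracket_eq_zero ?_ ha) hf
      rw [tgt_src, hf, map_zero]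
  · rintro ⟨b, rfl⟩
    obtain ⟨c, rfl, -⟩ := X.exists_bracket_eq (n + 1) b
    rw [bracketBoundary_bracket, map_sub, bracketBoundary_bracket, bracketBoundary_bracket, src_src,
      tgt_src, sub_self]

/-- If the unit of `P` is zero, all bimodules vanish; otherwise a section preserving the unit exists
and the argument by lifts applies. -/
theorem exact_boundary (hX : X.Acyclic) (n : ℕ) (k : ℕ+) :
    Function.Exact ((X.boundary (n + 1)).map k) ((X.boundary n).map k) := by
  cases n with
  | zero => exact X.exact_bracketBoundary_unitBoundary k
  | succ n =>
    by_cases h1 : X.presented.one = 0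
    · intro a
      refine iff_of_true (Bimodule.eq_zero_of_one_eq_zero h1 _ _) ⟨0, ?_⟩
      rw [Bimodule.eq_zero_of_one_eq_zero h1 _ a, map_zero]
    · exact X.exact_bracketBoundary hX h1 n k

end Polygraph
end ShuffleOp

theorem propositionP {K : Type u} [Field K] [CharZero K] (X : ShuffleOp.Polygraph K)
    (hX : X.Acyclic) (deg : ∀ n k, X.gens n k → ℕ) (hdeg : X.IsGrading deg)
    (w : ℕ → ℕ) (hw_pos : ∀ n, 0 < w n) (hw : StrictMono w)
    (hconc : ∀ n k (x : X.gens n k), deg n k x = w n) :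
    ShuffleOp.Bimodule.IsMinimalFreeResolution (X.positivePart deg) X.chain X.boundary
      (ShuffleOp.trivialBimodule X.presented) (ShuffleOp.toTrivial X.presented) where
  free n := ShuffleOp.freeBimodule.isFree X.presented (X.chainGens n)
  surjective _ := Submodule.mkQ_surjective _
  exact_zero k := X.exact_unitBoundary_toTrivial k
  exact_succ n k := X.exact_boundary hX n k
  minimal n k := X.boundary_reduction_eq_zero hdeg hw_pos hw hconc n k
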